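/- **Conventions.** Graphs are finite, with vertex weights in $\mathbb Z_{\ge 0}$ and $n\ge 1$ labelled legs (loops and multiple edges are allowed). A stable graph of genus $g$ is connected, has $\sum_v w(v)+b_1=g$, and satisfies $2w(v)-2+\deg(v)+L(v)>0$ at every vertex, where $L(v)$ is the number of legs at $v$. A *specialization* $\iota\colon\Gamma\to\Gamma'$ is an identification of $\Gamma'$ with a (weighted) edge contraction of $\Gamma$; it gives a surjection $V(\Gamma)\to V(\Gamma')$ and an injection $E(\Gamma')\hookrightarrow E(\Gamma)$. Let $\mu$ be a universal genus-$g$ polarization of degree $d$: functions $\mu_\Gamma\colon V(\Gamma)\to\mathbb R$ of total sum $d\in\mathbb Z$, one for every stable genus-$g$ graph with $n$ legs, compatible with pushforward along specializations. For $W\subseteq V(\Gamma)$, $E(W,W^c)$ is the set of edges between $W$ and its complement. For $\mathcal E\subseteq E(\Gamma)$ let $\Gamma^{\mathcal E}$ be obtained from $\Gamma$ by inserting one (exceptional) vertex in every edge of $\mathcal E$. A *pseudo-divisor* $(\mathcal E,D)$ on $\Gamma$ is such a subset together with $D\colon V(\Gamma^{\mathcal E})\to\mathbb Z$ equal to $-1$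 at the exceptional vertices. Put $\beta_D(W)=\deg D|_W-\mu(W)+\tfrac12\#E(W,W^c)$. With $v_0$ the vertex of the first leg, $(\mathcal E,D)$ is *$\mu$-quasistable* if $\deg D=d$ and, on $\Gamma^{\mathcal E}$ with $\mu$ extended by $0$, $\beta_D(W)\ge 0$ for all $W\subsetneq V(\Gamma^{\mathcal E})$, strictly if $v_0\in W$. It is *$\mu$-polystable* if $\deg D=d$ and, for every $W\subseteq V(\Gamma)$, the number $\beta_{\mathcal E,D}(W)$ computed on $\Gamma$ without the edges of $\mathcal E$, with polarization $\mu(v)+\frac12\deg_{\mathcal E}(v)$, is $\ge0$, and $>0$ if $E(W,W^c)\not\subseteq\mathcal E$. A specialization of triples $(\Gamma,\mathcal E,D)\ge(\Gamma',\mathcal E',D')$ is a specialization $\iota\colon\Gamma\to\Gamma'$ with $\mathcal E'\subseteq\mathcal E\cap E(\Gamma')$ and a compatible specialization $\Gamma^{\mathcal E}\to\Gamma'^{\mathcal E'}$ taking $D$ to $D'$. These are the arrows of the categories $\mathbf{QD}$ of quasistable and $\mathbf{PSD}$ of polystable triples on stable genus-$g$ graphs with $n$ legs. For pseudo-divisors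 on the same graph, $(\mathcal E,D)\ge(\mathcal E',D')$ means that there is such a specialization with $\iota=\mathrm{id}$, and $\mathrm{pol}(\mathcal E',D')$ is the unique minimal (that is, the least) $\mu$-polystable pseudo-divisor $\ge(\mathcal E',D')$. Put $\tau_{(\Gamma,\mathcal E,D)}=\mathbb R_{\ge0}^{E(\Gamma^{\mathcal E})}$ and $\tau^\circ_{(\Gamma,\mathcal E,D)}=\mathbb R_{>0}^{E(\Gamma^{\mathcal E})}$, and let $\sigma_{(\Gamma,\mathcal E,D)}$ be the image of $\mathbb R_{\ge0}^{E(\Gamma^{\mathcal E})}$ in $\mathbb R^{E(\Gamma^{\mathcal E})}/\mathcal L_{\mathcal E}$. Here $\mathcal L_{\mathcal E}$ is spanned by the vectors $u_W$, for $W\subseteq V(\Gamma)$ with $E(W,W^c)\subseteq\mathcal E$, having coordinate $+1$ (resp. $-1$) at the edges over $E(W,W^c)$ incident to $W$ (resp. $W^c$), and $0$ elsewhere. Lattices are the images of integer lattices. Specializations induce maps of cones (extension by zero); let $J=J^{trop}_{\mu,g,n}=\varinjlim_{\mathbf{QD}}\tau$ and $P=P^{trop}_{\mu,g,n}=\varinjlim_{\mathbf{PSD}}\sigma$,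 as topological spaces. A generalized cone complex is the colimit of a (here: essentially) finite diagram of rational polyhedral cones with face morphisms. A morphism of generalized cone complexes is a continuous map such that each cone of the source diagram maps through a morphism of cones to a cone of the target diagram; a refinement is a bijective morphism. **Theorem.** $J$ and $P$ are generalized cone complexes. There is a well-defined map $\rho=\rho_P^{trop}\colon J\to P$ that takes the point of a pair $(X,\mathcal D)$, with $X$ a stable $n$-pointed tropical curve of genus $g$ and $\mathcal D$ a $\mu$-quasistable divisor on $X$, to the point of $(X,\mathcal D')$ for any $\mu$-polystable divisor $\mathcal D'$ on $X$ linearly equivalent to $\mathcal D$ (such a $\mathcal D'$ exists). The map $\rho$ is a refinement of generalized cone complexes. Moreover, let $(\mathcal E,D)$ be a $\mu$-polystable pseudo-divisor on a stable genus-$g$ graph $\Gamma$ with $n$ legs. Every specialization $(\Gamma,\mathcal E,D)\ge(\Gamma',\mathcal E',D')$ with $(\Gamma',\mathcal E',D')\in\mathbf{QD}$ induces an injective map $\tau_{(\Gamma',\mathcal E',D')}\to\sigma_{(\Gamma,\mathcal E,D)}$, and with respect to these maps $$\sigma^\circ_{(\Gamma,\mathcal E,D)}=\coprod_{\substack{(\Gamma,\mathcal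 E',D')\in\mathbf{QD}\\(\mathcal E,D)=\mathrm{pol}(\mathcal E',D')}}\tau^\circ_{(\Gamma,\mathcal E',D')},\qquad \sigma_{(\Gamma,\mathcal E,D)}=\coprod_{\substack{(\Gamma,\mathcal E,D)\ge(\Gamma',\mathcal E',D')\\(\Gamma',\mathcal E',D')\in\mathbf{QD}}}\tau^\circ_{(\Gamma',\mathcal E',D')},$$ where $\sigma^\circ$ is the relative interior. In the first decomposition the index runs over pseudo-divisors on $\Gamma$, $\tau^\circ_{(\Gamma,\mathcal E',D')}$ is embedded through specializations over $\mathrm{id}_\Gamma$, and its image does not depend on the choice of the specialization. In the second decomposition the index runs over the specializations out of $(\Gamma,\mathcal E,D)$ with target in $\mathbf{QD}$, up to isomorphism of the target. -/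

import Mathlib

open CategoryTheory

noncomputable section

namespace TropJac

/-! ## Rational polyhedral cones and generalized cone complexes -/

/-- A rational polyhedral cone: a finite-dimensional real vector space `N` with its canonical
topology, a full-rank lattice in `N` (the integer span of a basis), and a subset of `N` that
consists of the nonnegative combinations of finitely many lattice vectors. -/
structure RPCone where
  N : Type
  [acg : AddCommGroup N]
  [mod : Module ℝ N]
  [top : TopologicalSpace N]
  [modTop : IsModuleTopology ℝ N]
  lattice : AddSubgroup N
  carrier : Set N
  exists_basis : ∃ (k : ℕ) (b : Module.Basis (Fin k) ℝ N),
    lattice = AddSubgroup.closure (Set.range b)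
  exists_gens : ∃ (m : ℕ) (v : Fin m → N), (∀ i, v i ∈ lattice) ∧
    carrier = {x | ∃ c : Fin m → ℝ, (∀ i, 0 ≤ c i) ∧ x = ∑ i, c i • v i}

namespace RPCone

attribute [instance] RPCone.acg RPCone.mod RPCone.top RPCone.modTop

/-- The relative interior of a cone. -/
def relint (C : RPCone) : Set C.N := intrinsicInterior ℝ C.carrier

/-- A linear map between the ambient spaces is integral if it preserves the lattices. -/
def IsIntegral {C D : RPCone} (T : C.N →ₗ[ℝ] D.N) : Prop := ∀ z ∈ C.lattice, T z ∈ D.lattice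

/-- A morphism of cones: the restriction of an integral linear map that takes the first cone into
the second. -/
@[ext]
structure Hom (C D : RPCone) where
  toFun : C.carrier → D.carrier
  exists_linear : ∃ T : C.N →ₗ[ℝ] D.N, IsIntegral T ∧ ∀ x, (toFun x : D.N) = T x

/-- The morphism induced by an integral linear map. -/
def Hom.ofLinear {C D : RPCone} (T : C.N →ₗ[ℝ] D.N) (hT : IsIntegral T)
    (h : ∀ x ∈ C.carrier, T x ∈ D.carrier) : Hom C D where
  toFun x := ⟨T x, h x x.2⟩
  exists_linear := ⟨T, hT, fun _ => rfl⟩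

instance : Category RPCone where
  Hom := Hom
  id C := { toFun := id, exists_linear := ⟨LinearMap.id, fun _ h => h, fun _ => rfl⟩ }
  comp f g :=
    { toFun := g.toFun ∘ f.toFun
      exists_linear := by
        obtain ⟨T, hT, h⟩ := f.exists_linear
        obtain ⟨U, hU, h'⟩ := g.exists_linear
        exact ⟨U ∘ₗ T, fun z hz => hU _ (hT z hz), fun x => by simp [h', h]⟩ }

/-- A face morphism: an isomorphism onto a face. A face of `D` is the zero locus in `D` of a linear
functional that is nonnegative on `D` (the zero functional gives `D` itself), and the inverse of
the isomorphism is the restriction of an integral linear map. -/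
def IsFaceMorphism {C D : RPCone} (f : C ⟶ D) : Prop :=
  (∃ l : D.N →ₗ[ℝ] ℝ, (∀ y ∈ D.carrier, 0 ≤ l y) ∧
    {y | y ∈ D.carrier ∧ l y = 0} = Set.range fun x => (f.toFun x : D.N)) ∧
  ∃ U : D.N →ₗ[ℝ] C.N, IsIntegral U ∧ ∀ x, U (f.toFun x) = x

end RPCone

section ConeComplex

universe u v u' v'

variable {C : Type u} [Category.{v} C] (F : Cᵒᵖ ⥤ RPCone)

/-- The disjoint union of the cones of a contravariant functor to cones. -/
abbrev ConeSum : Type u := Σ x : C, (F.obj (Opposite.op x)).carrier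

/-- The gluing relation: a point of the cone of `y` is glued to its images under arrows `x ⟶ y`. -/
inductive Glue : ConeSum F → ConeSum F → Prop
  | of {x y : C} (f : x ⟶ y) (z : (F.obj (Opposite.op y)).carrier) :
      Glue ⟨y, z⟩ ⟨x, (F.map f.op).toFun z⟩

/-- The colimit, as a topological space, of a diagram of cones (with the quotient topology). -/
def ConeSpace : Type u := Quot (Glue F)

instance : TopologicalSpace (ConeSpace F) := inferInstanceAs (TopologicalSpace (Quot (Glue F)))

/-- The canonical map from a cone of the diagram to the colimit. -/
def ConeSpace.mk (x : C) (z : (F.obj (Opposite.op x)).carrier) : ConeSpace F :=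
  Quot.mk _ ⟨x, z⟩

/-- The colimit of `F` is a generalized cone complex: the diagram is (essentially) finite and
consists of face morphisms. -/
structure IsGeneralizedConeComplex : Prop where
  face : ∀ {x y : C} (f : x ⟶ y), RPCone.IsFaceMorphism (F.map f.op)
  finite_obj : ∃ s : Set C, s.Finite ∧ ∀ x, ∃ y ∈ s, Nonempty (x ≅ y)
  finite_hom : ∀ x y : C, Finite (x ⟶ y)

variable {F} {C' : Type u'} [Category.{v'} C'] {F' : C'ᵒᵖ ⥤ RPCone}

/-- A morphism of generalized cone complexes: a continuous map whose restriction to every cone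
factors through a morphism to a cone of the target. -/
def IsConeComplexMorphism (φ : ConeSpace F → ConeSpace F') : Prop :=
  Continuous φ ∧ ∀ x : C, ∃ (y : C') (h : F.obj (Opposite.op x) ⟶ F'.obj (Opposite.op y)),
    ∀ z, φ (ConeSpace.mk F x z) = ConeSpace.mk F' y (h.toFun z)

/-- A refinement: a bijective morphism of generalized cone complexes. -/
def IsRefinement (φ : ConeSpace F → ConeSpace F') : Prop :=
  IsConeComplexMorphism φ ∧ Function.Bijective φ

end ConeComplex

/-! ### Orthants and their quotients -/

section Orthant

variable (ι : Type)

/-- The lattice of integer vectors in `ℝ^ι`. -/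
def intLattice : AddSubgroup (ι → ℝ) where
  carrier := {x | ∀ i, ∃ k : ℤ, x i = k}
  zero_mem' i := ⟨0, by simp⟩
  add_mem' {x y} hx hy i := by
    obtain ⟨a, ha⟩ := hx i
    obtain ⟨b, hb⟩ := hy i
    exact ⟨a + b, by simp [ha, hb]⟩
  neg_mem' {x} hx i := by
    obtain ⟨a, ha⟩ := hx i
    exact ⟨-a, by simp [ha]⟩

/-- The closed orthant. -/
def orthant : Set (ι → ℝ) := {x | ∀ i, 0 ≤ x i}

/-- The open orthant. -/
def openOrthant : Set (ι → ℝ) := {x | ∀ i, 0 < x i}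

theorem single_mem_intLattice {ι : Type} [DecidableEq ι] (i : ι) :
    (Pi.single i 1 : ι → ℝ) ∈ intLattice ι := fun j => by
  by_cases h : j = i
  · subst h; exact ⟨1, by simp⟩
  · exact ⟨0, by simp [h]⟩

variable {ι} [Fintype ι] [DecidableEq ι]

theorem eq_sum_single (x : ι → ℝ) : x = ∑ i, x i • (Pi.single i 1 : ι → ℝ) := by
  ext j; simp [Finset.sum_apply, Pi.single_apply]

theorem closure_single : AddSubgroup.closure (Set.range fun i : ι => (Pi.single i 1 : ι → ℝ)) =
    intLattice ι := by
  apply le_antisymm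
  · rw [AddSubgroup.closure_le]
    rintro _ ⟨i, rfl⟩
    exact single_mem_intLattice i
  · intro x hx
    rw [eq_sum_single x]
    refine sum_mem fun i _ => ?_
    obtain ⟨k, hk⟩ := hx i
    rw [hk, Int.cast_smul_eq_zsmul]
    exact zsmul_mem (AddSubgroup.subset_closure (Set.mem_range_self i)) k

theorem orthant_gens : ∃ (m : ℕ) (v : Fin m → ι → ℝ), (∀ i, v i ∈ intLattice ι) ∧
    orthant ι = {x | ∃ c : Fin m → ℝ, (∀ i, 0 ≤ c i) ∧ x = ∑ i, c i • v i} := by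
  refine ⟨Fintype.card ι, fun k => Pi.single ((Fintype.equivFin ι).symm k) 1,
    fun k => single_mem_intLattice _, ?_⟩
  ext x
  constructor
  · intro hx
    refine ⟨fun k => x ((Fintype.equivFin ι).symm k), fun k => hx _, ?_⟩
    conv_lhs => rw [eq_sum_single x]
    exact ((Fintype.equivFin ι).symm.sum_comp
      (fun i => x i • (Pi.single i 1 : ι → ℝ))).symm
  · rintro ⟨c, hc, rfl⟩ j
    rw [Finset.sum_apply]
    refine Finset.sum_nonneg fun k _ => ?_
    simp only [Pi.smul_apply, smul_eq_mul]
    refine mul_nonneg (hc k) ?_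
    rw [Pi.single_apply]
    split_ifs <;> simp

/-- The orthant `ℝ^ι_{≥0}` in `ℝ^ι` with the lattice `ℤ^ι`. -/
def orthantCone (ι : Type) [Fintype ι] [DecidableEq ι] : RPCone where
  N := ι → ℝ
  lattice := intLattice ι
  carrier := orthant ι
  exists_basis := by
    refine ⟨_, (Pi.basisFun ℝ ι).reindex (Fintype.equivFin ι), ?_⟩
    rw [← closure_single, Module.Basis.range_reindex]
    congr 2
    ext1 i
    simp
  exists_gens := orthant_gens

/-- A subspace of `ℝ^ι` is rational if it is spanned by integer vectors. -/
def IsRationalSubspace (L : Submodule ℝ (ι → ℝ)) : Prop :=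
  ∃ U : Set (ι → ℝ), U ⊆ intLattice ι ∧ L = Submodule.span ℝ U

theorem exists_basis_quotient (L : Submodule ℝ (ι → ℝ)) (hL : IsRationalSubspace L) :
    ∃ (k : ℕ) (b : Module.Basis (Fin k) ℝ ((ι → ℝ) ⧸ L)),
      (intLattice ι).map L.mkQ.toAddMonoidHom = AddSubgroup.closure (Set.range b) := by
  classical
  obtain ⟨U, hU, rfl⟩ := hL
  set L := Submodule.span ℝ U with hLdef
  let castZ : (ι → ℤ) →ₗ[ℤ] (ι → ℝ) :=
    { toFun := fun z i => z i
      map_add' := fun x y => by ext i; simp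
      map_smul' := fun k x => by ext i; simp }
  let φ : (ι → ℤ) →ₗ[ℤ] ((ι → ℝ) ⧸ L) := (L.mkQ.restrictScalars ℤ) ∘ₗ castZ
  let Λ : Submodule ℤ ((ι → ℝ) ⧸ L) := LinearMap.range φ
  have : Module.IsTorsionFree ℤ ((ι → ℝ) ⧸ L) :=
    Module.IsTorsionFree.trans_faithfulSMul ℤ ℝ _
  have : Module.Finite ℤ Λ := inferInstance
  have : Module.Free ℤ Λ := inferInstance
  let c := Module.finBasis ℤ Λ
  let φ' : (ι → ℤ) →ₗ[ℤ] Λ := φ.rangeRestrict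
  -- the real-linear extension of the coordinates
  let ψ : (ι → ℝ) →ₗ[ℝ] (Fin (Module.finrank ℤ Λ) → ℝ) :=
    Fintype.linearCombination ℝ (fun j k => ((c.repr (φ' (Pi.single j 1)) k : ℤ) : ℝ))
  have hψ : ∀ z : ι → ℤ, ψ (castZ z) = fun k => ((c.repr (φ' z) k : ℤ) : ℝ) := by
    intro z
    have hz : z = ∑ j, z j • (Pi.single j 1 : ι → ℤ) := by
      ext i; simp [Finset.sum_apply, Pi.single_apply]
    ext k
    conv_rhs => rw [hz, map_sum]
    simp only [map_smul]
    simp [ψ, castZ, Fintype.linearCombination_apply, Finset.sum_apply]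
  have hint : ∀ x ∈ intLattice ι, ∃ z, castZ z = x := fun x hx => by
    choose z hz using hx
    exact ⟨z, by ext i; simp [castZ, hz]⟩
  have hker : L ≤ LinearMap.ker ψ := by
    refine Submodule.span_le.2 ?_
    intro u hu
    obtain ⟨z, rfl⟩ := hint u (hU hu)
    have : φ' z = 0 := by
      apply Subtype.ext
      change L.mkQ (castZ z) = 0
      rw [Submodule.mkQ_apply, Submodule.Quotient.mk_eq_zero]
      exact Submodule.subset_span hu
    simp only [SetLike.mem_coe, LinearMap.mem_ker]
    rw [hψ, this]
    ext k; simp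
  let ψ' := L.liftQ ψ hker
  have hψ' : ∀ i, ψ' (c i : (ι → ℝ) ⧸ L) = Pi.single i 1 := by
    intro i
    obtain ⟨z, hz⟩ := LinearMap.surjective_rangeRestrict φ (c i)
    have h1 : (c i : (ι → ℝ) ⧸ L) = L.mkQ (castZ z) := by rw [← hz]; rfl
    rw [h1]
    change ψ (castZ z) = _
    rw [hψ]
    change (fun k => ((c.repr (φ.rangeRestrict z) k : ℤ) : ℝ)) = _
    rw [hz]
    ext k
    simp [Finsupp.single_apply, Pi.single_apply, eq_comm]
  have hcl : (intLattice ι).map L.mkQ.toAddMonoidHom =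
      AddSubgroup.closure (Set.range fun i => (c i : (ι → ℝ) ⧸ L)) := by
    apply le_antisymm
    · rintro _ ⟨x, hx, rfl⟩
      obtain ⟨z, rfl⟩ := hint x hx
      have : L.mkQ (castZ z) = ((φ' z : Λ) : (ι → ℝ) ⧸ L) := rfl
      change L.mkQ (castZ z) ∈ _
      rw [this, ← c.sum_repr (φ' z), Submodule.coe_sum]
      refine sum_mem fun i _ => ?_
      rw [Submodule.coe_smul]
      exact zsmul_mem (AddSubgroup.subset_closure (Set.mem_range_self i)) _
    · rw [AddSubgroup.closure_le]
      rintro _ ⟨i, rfl⟩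
      obtain ⟨z, hz⟩ := LinearMap.surjective_rangeRestrict φ (c i)
      refine ⟨castZ z, fun i => ⟨z i, rfl⟩, ?_⟩
      change _ = ((c i : Λ) : (ι → ℝ) ⧸ L)
      rw [← hz]; rfl
  have hli : LinearIndependent ℝ fun i => (c i : (ι → ℝ) ⧸ L) := by
    apply LinearIndependent.of_comp ψ'
    have : (ψ' ∘ fun i => (c i : (ι → ℝ) ⧸ L)) = fun i => Pi.single i (1 : ℝ) := funext hψ'
    rw [this]
    exact Pi.linearIndependent_single_one _ ℝ
  have hsp : ⊤ ≤ Submodule.span ℝ (Set.range fun i => (c i : (ι → ℝ) ⧸ L)) := by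
    rintro y -
    obtain ⟨x, rfl⟩ := L.mkQ_surjective y
    rw [eq_sum_single x, map_sum]
    refine Submodule.sum_mem _ fun j _ => ?_
    rw [map_smul]
    refine Submodule.smul_mem _ _ ?_
    have : L.mkQ (Pi.single j 1) ∈ (intLattice ι).map L.mkQ.toAddMonoidHom :=
      ⟨_, single_mem_intLattice j, rfl⟩
    rw [hcl] at this
    exact (AddSubgroup.closure_le (K := (Submodule.span ℝ _).toAddSubgroup)).2
      Submodule.subset_span this
  refine ⟨_, Module.Basis.mk hli hsp, ?_⟩
  rw [hcl, Module.Basis.coe_mk]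

/-- The image of the orthant `ℝ^ι_{≥0}` in `ℝ^ι / L`, for a rational subspace `L`, with the image
of the lattice `ℤ^ι`. -/
def quotientCone (L : Submodule ℝ (ι → ℝ)) (hL : IsRationalSubspace L) : RPCone where
  N := (ι → ℝ) ⧸ L
  lattice := (intLattice ι).map L.mkQ.toAddMonoidHom
  carrier := L.mkQ '' orthant ι
  exists_basis := exists_basis_quotient L hL
  exists_gens := by
    obtain ⟨m, v, hv, h⟩ := orthant_gens (ι := ι)
    refine ⟨m, fun i => L.mkQ (v i), fun i => ⟨_, hv i, rfl⟩, ?_⟩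
    ext y
    constructor
    · rintro ⟨x, hx, rfl⟩
      rw [h] at hx
      obtain ⟨c, hc, rfl⟩ := hx
      exact ⟨c, hc, by simp only [map_sum, map_smul]⟩
    · rintro ⟨c, hc, rfl⟩
      refine ⟨∑ i, c i • v i, ?_, by simp only [map_sum, map_smul]⟩
      rw [h]
      exact ⟨c, hc, rfl⟩

end Orthant

/-! ## Graphs and specializations -/

/-- A finite vertex-weighted graph with `n` labelled legs (loops and multiple edges allowed). The
edge `e` joins `src e` and `tgt e`; this reference orientation is auxiliary. -/
structure WGraph (n : ℕ) where
  V : Type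
  E : Type
  [fintypeV : Fintype V]
  [fintypeE : Fintype E]
  [decEqV : DecidableEq V]
  [decEqE : DecidableEq E]
  src : E → V
  tgt : E → V
  weight : V → ℕ
  leg : Fin n → V

namespace WGraph

attribute [instance] WGraph.fintypeV WGraph.fintypeE WGraph.decEqV WGraph.decEqE

variable {n : ℕ} (G : WGraph n)

/-- The unordered pair of end-vertices of an edge. -/
def ends (e : G.E) : Sym2 G.V := s(G.src e, G.tgt e)

/-- Two vertices are joined by a path with edges in `S`. -/
def Joined (S : Set G.E) : G.V → G.V → Prop :=
  Relation.ReflTransGen fun a b => ∃ e ∈ S, G.ends e = s(a, b)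

/-- The graph is nonempty and connected. -/
def IsConnected : Prop := Nonempty G.V ∧ ∀ a b, G.Joined Set.univ a b

/-- The number of connected components. -/
def b0 : ℕ := Nat.card (Quot fun a b : G.V => ∃ e, G.ends e = s(a, b))

/-- The first Betti number. -/
def b1 : ℤ := Fintype.card G.E - Fintype.card G.V + G.b0

/-- The genus. -/
def genus : ℤ := ∑ v, (G.weight v : ℤ) + G.b1

/-- The number of edges of `S` incident to a vertex, loops counting twice. -/
def degIn (S : Finset G.E) (v : G.V) : ℕ :=
  (S.filter fun e => G.src e = v).card + (S.filter fun e => G.tgt e = v).card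

/-- The number of legs incident to a vertex. -/
def legs (v : G.V) : ℕ := (Finset.univ.filter fun i => G.leg i = v).card

/-- Stable (connected) graphs of genus `g`. -/
def IsStable (g : ℕ) : Prop :=
  G.IsConnected ∧ G.genus = g ∧
    ∀ v, 0 < 2 * (G.weight v : ℤ) - 2 + G.degIn Finset.univ v + G.legs v

/-- The set `E(W, Wᶜ)` of edges with one end-vertex in `W` and the other one in `Wᶜ`. -/
def cut (W : Finset G.V) : Finset G.E :=
  Finset.univ.filter fun e => (G.src e ∈ W ∧ G.tgt e ∉ W) ∨ (G.tgt e ∈ W ∧ G.src e ∉ W)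

/-- The graph obtained by removing the edges in `S`. -/
def remove (S : Finset G.E) : WGraph n where
  V := G.V
  E := {e // e ∉ S}
  src e := G.src e
  tgt e := G.tgt e
  weight := G.weight
  leg := G.leg

/-- The graph obtained by inserting one (exceptional) vertex in the interior of every edge
in `S`. Its vertices are the vertices `inl v` of `G` and the exceptional vertices `inr e`. Its edges
are the edges `inl e` of `G` not in `S`, and for `e ∈ S` the edge `inr (e, false)` from `src e` to
the exceptional vertex and the edge `inr (e, true)` from `tgt e` to the exceptional vertex. -/
def subdiv (S : Finset G.E) : WGraph n where
  V := G.V ⊕ {e // e ∈ S}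
  E := {e // e ∉ S} ⊕ ({e // e ∈ S} × Bool)
  src := Sum.elim (fun e => Sum.inl (G.src e))
    (fun h => Sum.inl (if h.2 then G.tgt h.1 else G.src h.1))
  tgt := Sum.elim (fun e => Sum.inl (G.tgt e)) (fun h => Sum.inr h.1)
  weight := Sum.elim G.weight (fun _ => 0)
  leg i := Sum.inl (G.leg i)

/-- The edge of `G` which lies under an edge of the subdivision. -/
def under (S : Finset G.E) : (G.subdiv S).E → G.E :=
  Sum.elim (fun e => e.1) (fun h => h.1.1)

end WGraph

/-- A specialization `G → H`, that is, an identification of `H` with the graph obtained from `G` by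
contracting the edges that are not in the image of `onE`. The weight of a vertex of `H` is the genus
of the connected subgraph of `G` (with the contracted edges) over it:
`∑ w(v) + #edges - #vertices + 1`. -/
@[ext]
structure Spec {n : ℕ} (G H : WGraph n) where
  onV : G.V → H.V
  onE : H.E → G.E
  surjective_onV : Function.Surjective onV
  injective_onE : Function.Injective onE
  ends_eq : ∀ e, H.ends e = (G.ends (onE e)).map onV
  fiber : ∀ a b, onV a = onV b ↔ G.Joined (Set.range onE)ᶜ a b
  weight_eq : ∀ x, H.weight x + (Finset.univ.filter fun v => onV v = x).card =
    ∑ v with onV v = x, G.weight v +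
      (Finset.univ.filter fun e => (∀ e', onE e' ≠ e) ∧ onV (G.src e) = x).card + 1
  leg_eq : ∀ i, H.leg i = onV (G.leg i)

namespace Spec

variable {n : ℕ} {G H K : WGraph n}

theorem joined_map (f : Spec G H) (S : Set G.E) {a b : G.V} (h : G.Joined S a b) :
    H.Joined (f.onE ⁻¹' S) (f.onV a) (f.onV b) := by
  induction h with
  | refl => exact Relation.ReflTransGen.refl
  | @tail b c _ hbc ih =>
    obtain ⟨e, he, hes⟩ := hbc
    by_cases hr : e ∈ Set.range f.onE
    · obtain ⟨e', rfl⟩ := hr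
      exact ih.tail ⟨e', he, by rw [f.ends_eq, hes, Sym2.map_mk]⟩
    · have : f.onV b = f.onV c := (f.fiber b c).2 (Relation.ReflTransGen.single ⟨e, hr, hes⟩)
      rwa [← this]

theorem joined_mono {S T : Set G.E} (hST : S ⊆ T) {a b : G.V} (h : G.Joined S a b) :
    G.Joined T a b := by
  refine Relation.ReflTransGen.mono ?_ _ _ h
  rintro x y ⟨e, he, h⟩
  exact ⟨e, hST he, h⟩

theorem joined_lift (f : Spec G H) (S : Set H.E) {x y : H.V} (h : H.Joined S x y) :
    ∀ a b, f.onV a = x → f.onV b = y → G.Joined (f.onE '' S ∪ (Set.range f.onE)ᶜ) a b := by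
  induction h with
  | refl =>
    intro a b ha hb
    exact joined_mono Set.subset_union_right ((f.fiber a b).1 (ha.trans hb.symm))
  | @tail y z _ hyz ih =>
    intro a b ha hb
    obtain ⟨e, he, hes⟩ := hyz
    rw [f.ends_eq] at hes
    obtain ⟨p, q, hpq, hp, hq⟩ : ∃ p q, G.ends (f.onE e) = s(p, q) ∧ f.onV p = y ∧ f.onV q = z := by
      have h0 : (s(f.onV (G.src (f.onE e)), f.onV (G.tgt (f.onE e))) : Sym2 H.V) = s(y, z) := hes
      rcases Sym2.eq_iff.1 h0 with ⟨h1, h2⟩ | ⟨h1, h2⟩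
      · exact ⟨_, _, rfl, h1, h2⟩
      · exact ⟨_, _, Sym2.eq_swap, h2, h1⟩
    have h1 := ih a p ha hp
    have h2 : G.Joined (f.onE '' S ∪ (Set.range f.onE)ᶜ) q b :=
      joined_mono Set.subset_union_right ((f.fiber q b).1 (hq.trans hb.symm))
    exact (h1.tail ⟨f.onE e, Or.inl ⟨e, he, rfl⟩, hpq⟩).trans h2

/-- The pushforward of a function (a divisor or a polarization) along a specialization. -/
def push {M : Type} [AddCommMonoid M] (f : Spec G H) (D : G.V → M) (x : H.V) : M :=
  ∑ v with f.onV v = x, D v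

/-- The identity specialization. -/
def id (G : WGraph n) : Spec G G where
  onV v := v
  onE e := e
  surjective_onV v := ⟨v, rfl⟩
  injective_onE _ _ h := h
  ends_eq e := (congrFun Sym2.map_id _).symm
  fiber a b := by
    constructor
    · rintro rfl; exact Relation.ReflTransGen.refl
    · intro h
      induction h with
      | refl => rfl
      | tail _ h _ => obtain ⟨e, he, _⟩ := h; exact absurd ⟨e, rfl⟩ he
  weight_eq x := by
    simp [Finset.filter_eq', Finset.sum_singleton]
  leg_eq _ := rfl

theorem src_eq_or (f : Spec G H) (e : H.E) :
    (H.src e = f.onV (G.src (f.onE e)) ∧ H.tgt e = f.onV (G.tgt (f.onE e))) ∨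
    (H.src e = f.onV (G.tgt (f.onE e)) ∧ H.tgt e = f.onV (G.src (f.onE e))) :=
  Sym2.eq_iff.1 (f.ends_eq e)

theorem onV_src_eq_onV_tgt (f : Spec G H) (e : G.E) (he : ∀ e', f.onE e' ≠ e) :
    f.onV (G.src e) = f.onV (G.tgt e) :=
  (f.fiber _ _).2 (Relation.ReflTransGen.single ⟨e, fun ⟨e', h⟩ => he e' h, rfl⟩)

theorem comp_fiber (f : Spec G H) (k : Spec H K) (a b : G.V) :
    k.onV (f.onV a) = k.onV (f.onV b) ↔ G.Joined (Set.range (f.onE ∘ k.onE))ᶜ a b := by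
  constructor
  · intro h
    refine joined_mono ?_ (f.joined_lift _ ((k.fiber _ _).1 h) a b rfl rfl)
    rintro _ (⟨e, he, rfl⟩ | he) ⟨e', h'⟩
    · exact he ⟨e', f.injective_onE h'⟩
    · exact he ⟨_, h'⟩
  · intro h
    rw [k.fiber]
    refine joined_mono ?_ (f.joined_map _ h)
    rintro e he ⟨e', rfl⟩
    exact he ⟨e', rfl⟩

theorem comp_weight (f : Spec G H) (k : Spec H K) (x : K.V) :
    K.weight x + (Finset.univ.filter fun v => k.onV (f.onV v) = x).card =
    ∑ v with k.onV (f.onV v) = x, G.weight v +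
      (Finset.univ.filter fun e => (∀ e', f.onE (k.onE e') ≠ e) ∧
        k.onV (f.onV (G.src e)) = x).card + 1 := by
  have hk := k.weight_eq x
  have hf : ∑ y with k.onV y = x, (H.weight y + (Finset.univ.filter fun v => f.onV v = y).card) =
      ∑ y with k.onV y = x, (∑ v with f.onV v = y, G.weight v +
      (Finset.univ.filter fun e => (∀ e', f.onE e' ≠ e) ∧ f.onV (G.src e) = y).card + 1) :=
    Finset.sum_congr rfl fun y _ => f.weight_eq y
  rw [Finset.sum_add_distrib, Finset.sum_add_distrib, Finset.sum_add_distrib] at hf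
  have h1 : ∑ y with k.onV y = x, (Finset.univ.filter fun v => f.onV v = y).card =
      (Finset.univ.filter fun v => k.onV (f.onV v) = x).card := by
    rw [Finset.card_eq_sum_card_fiberwise (f := f.onV) (t := Finset.univ.filter fun y => k.onV y = x)]
    · refine Finset.sum_congr rfl fun y hy => ?_
      congr 1
      ext v
      simp only [Finset.mem_filter, Finset.mem_univ, true_and] at hy ⊢
      constructor
      · rintro rfl; exact ⟨hy, rfl⟩
      · exact fun h => h.2
    · intro v hv; simpa using hv
  have h2 : ∑ y with k.onV y = x, ∑ v with f.onV v = y, G.weight v =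
      ∑ v with k.onV (f.onV v) = x, G.weight v := by
    rw [← Finset.sum_fiberwise_of_maps_to (g := f.onV)
      (s := Finset.univ.filter fun v => k.onV (f.onV v) = x)
      (t := Finset.univ.filter fun y => k.onV y = x)]
    · refine Finset.sum_congr rfl fun y hy => ?_
      refine Finset.sum_congr ?_ fun _ _ => rfl
      ext v
      simp only [Finset.mem_filter, Finset.mem_univ, true_and] at hy ⊢
      constructor
      · rintro rfl; exact ⟨hy, rfl⟩
      · exact fun h => h.2
    · intro v hv; simpa using hv
  have h3 : ∑ y with k.onV y = x,
      (Finset.univ.filter fun e => (∀ e', f.onE e' ≠ e) ∧ f.onV (G.src e) = y).card =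
      (Finset.univ.filter fun e => (∀ e', f.onE e' ≠ e) ∧ k.onV (f.onV (G.src e)) = x).card := by
    rw [Finset.card_eq_sum_card_fiberwise (f := fun e => f.onV (G.src e))
      (t := Finset.univ.filter fun y => k.onV y = x)]
    · refine Finset.sum_congr rfl fun y hy => ?_
      congr 1
      ext v
      simp only [Finset.mem_filter, Finset.mem_univ, true_and] at hy ⊢
      constructor
      · rintro ⟨h, rfl⟩; exact ⟨⟨h, hy⟩, rfl⟩
      · exact fun h => ⟨h.1.1, h.2⟩
    · intro v hv
      simp only [Finset.coe_filter, Finset.mem_univ, true_and, Set.mem_ofPred_eq] at hv ⊢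
      exact hv.2
  have h4 : (Finset.univ.filter fun e => (∀ e', f.onE (k.onE e') ≠ e) ∧
        k.onV (f.onV (G.src e)) = x).card =
      (Finset.univ.filter fun e => (∀ e', f.onE e' ≠ e) ∧ k.onV (f.onV (G.src e)) = x).card +
      (Finset.univ.filter fun e => (∀ e', k.onE e' ≠ e) ∧ k.onV (H.src e) = x).card := by
    rw [← Finset.card_map ⟨f.onE, f.injective_onE⟩
      (s := Finset.univ.filter fun e => (∀ e', k.onE e' ≠ e) ∧ k.onV (H.src e) = x),
      ← Finset.card_union_of_disjoint]
    · congr 1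
      ext e
      simp only [Finset.mem_filter, Finset.mem_univ, true_and, Finset.mem_union, Finset.mem_map,
        Function.Embedding.coeFn_mk]
      have key : ∀ e', (∀ e'', k.onE e'' ≠ e') →
          k.onV (f.onV (G.src (f.onE e'))) = k.onV (H.src e') := fun e' he' => by
        have hst := k.onV_src_eq_onV_tgt e' he'
        rcases f.src_eq_or e' with ⟨h, _⟩ | ⟨_, h⟩
        · rw [h]
        · rw [hst, h]
      constructor
      · rintro ⟨h, hx⟩
        by_cases hr : ∃ e', f.onE e' = e
        · obtain ⟨e', rfl⟩ := hr
          have h' : ∀ e'', k.onE e'' ≠ e' := fun e'' h'' => h e'' (by rw [h''])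
          exact Or.inr ⟨e', ⟨h', (key e' h').symm.trans hx⟩, rfl⟩
        · exact Or.inl ⟨fun e' he' => hr ⟨e', he'⟩, hx⟩
      · rintro (⟨h, hx⟩ | ⟨e', ⟨h, hx⟩, rfl⟩)
        · exact ⟨fun e' => h _, hx⟩
        · exact ⟨fun e'' he'' => h e'' (f.injective_onE he''), (key e' h).trans hx⟩
    · rw [Finset.disjoint_left]
      intro e he he'
      simp only [Finset.mem_filter, Finset.mem_univ, true_and, Finset.mem_map,
        Function.Embedding.coeFn_mk] at he he'
      obtain ⟨e', _, h⟩ := he'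
      exact he.1 e' h
  have h5 : ∑ y with k.onV y = x, 1 = (Finset.univ.filter fun y => k.onV y = x).card := by simp
  rw [h1, h2, h3, h5] at hf
  omega

/-- The composition of specializations. -/
def comp (f : Spec G H) (k : Spec H K) : Spec G K where
  onV v := k.onV (f.onV v)
  onE e := f.onE (k.onE e)
  surjective_onV := k.surjective_onV.comp f.surjective_onV
  injective_onE := f.injective_onE.comp k.injective_onE
  ends_eq e := by
    rw [k.ends_eq, f.ends_eq, Sym2.map_map]; rfl
  fiber := comp_fiber f k
  weight_eq := comp_weight f k
  leg_eq i := by rw [k.leg_eq, f.leg_eq]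

theorem push_id {M : Type} [AddCommMonoid M] (D : G.V → M) : (Spec.id G).push D = D := by
  ext x
  change ∑ v with v = x, D v = D x
  simp [Finset.filter_eq', Finset.sum_singleton]

theorem push_comp {M : Type} [AddCommMonoid M] (f : Spec G H) (k : Spec H K) (D : G.V → M) :
    (f.comp k).push D = k.push (f.push D) := by
  ext x
  change ∑ v with k.onV (f.onV v) = x, D v = ∑ y with k.onV y = x, ∑ v with f.onV v = y, D v
  rw [← Finset.sum_fiberwise_of_maps_to (g := f.onV)
    (s := Finset.univ.filter fun v => k.onV (f.onV v) = x)
    (t := Finset.univ.filter fun y => k.onV y = x)]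
  · refine Finset.sum_congr rfl fun y hy => ?_
    refine Finset.sum_congr ?_ fun _ _ => rfl
    ext v
    simp only [Finset.mem_filter, Finset.mem_univ, true_and] at hy ⊢
    constructor
    · exact fun h => h.2
    · rintro rfl; exact ⟨hy, rfl⟩
  · intro v hv; simpa using hv

end Spec

/-! ## Pseudo-divisors and stability -/

namespace WGraph

variable {n : ℕ} (G : WGraph n)

/-- `β_D(W) = deg D|_W - μ(W) + #E(W, Wᶜ) / 2`. -/
def beta (D : G.V → ℤ) (μ : G.V → ℝ) (W : Finset G.V) : ℝ :=
  ∑ v ∈ W, (D v : ℝ) - ∑ v ∈ W, μ v + ((G.cut W).card : ℝ) / 2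

end WGraph

/-- A pseudo-divisor `(𝓔, D)` on `G`: a set `𝓔` of edges and a divisor `D` on the graph obtained
from `G` by inserting a vertex in every edge in `𝓔`, with value `-1` at the exceptional vertices. -/
structure PseudoDiv {n : ℕ} (G : WGraph n) where
  exc : Finset G.E
  div : (G.subdiv exc).V → ℤ
  div_exc : ∀ e : {e // e ∈ exc}, div (Sum.inr e) = -1

namespace PseudoDiv

variable {n : ℕ} {G : WGraph n} (P : PseudoDiv G)

/-- The graph which carries the divisor. -/
abbrev graph : WGraph n := G.subdiv P.exc

/-- The divisor has the degree of the polarization. -/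
def HasDegreeOf (μ : G.V → ℝ) : Prop := ∑ v, (P.div v : ℝ) = ∑ v, μ v

/-- `(v₀, μ)`-quasistability; the polarization is extended by `0` to the exceptional vertices. -/
def IsQuasistable (μ : G.V → ℝ) (v₀ : G.V) : Prop :=
  P.HasDegreeOf μ ∧ ∀ W : Finset P.graph.V, W ≠ Finset.univ →
    0 ≤ P.graph.beta P.div (Sum.elim μ fun _ => 0) W ∧
    (Sum.inl v₀ ∈ W → 0 < P.graph.beta P.div (Sum.elim μ fun _ => 0) W)

/-- `β_{𝓔,D}(W)`, the invariant of the restriction of `D` to the graph `G` without the edges `𝓔`,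
with respect to the polarization `v ↦ μ(v) + deg_𝓔(v) / 2`. -/
def betaExc (μ : G.V → ℝ) (W : Finset G.V) : ℝ :=
  (G.remove P.exc).beta (fun v => P.div (Sum.inl v))
    (fun v => μ v + (G.degIn P.exc v : ℝ) / 2) W

/-- `μ`-polystability. -/
def IsPolystable (μ : G.V → ℝ) : Prop :=
  P.HasDegreeOf μ ∧ ∀ W : Finset G.V, 0 ≤ P.betaExc μ W ∧
    (¬ G.cut W ⊆ P.exc → 0 < P.betaExc μ W)

end PseudoDiv

/-! ## The category of triples -/

/-- A triple `(Γ, 𝓔, D)`. -/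
structure Triple (n : ℕ) where
  G : WGraph n
  pd : PseudoDiv G

namespace Triple

variable {n : ℕ}

/-- The graph `Γ^𝓔` of a triple. -/
abbrev graph (A : Triple n) : WGraph n := A.pd.graph

/-- A specialization of triples: a specialization `base` of graphs and a compatible specialization
`hat` of the subdivided graphs which takes the first divisor to the second one. -/
@[ext]
structure Hom (A B : Triple n) where
  base : Spec A.G B.G
  hat : Spec A.graph B.graph
  exc_subset : ∀ e ∈ B.pd.exc, base.onE e ∈ A.pd.exc
  onV_comm : ∀ v : A.G.V, hat.onV (Sum.inl v) = Sum.inl (base.onV v)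
  onE_comm : ∀ h : B.graph.E, A.G.under A.pd.exc (hat.onE h) = base.onE (B.G.under B.pd.exc h)
  div_eq : B.pd.div = hat.push A.pd.div

instance : Category (Triple n) where
  Hom := Hom
  id A :=
    { base := Spec.id A.G
      hat := Spec.id A.graph
      exc_subset := fun _ h => h
      onV_comm := fun _ => rfl
      onE_comm := fun _ => rfl
      div_eq := (Spec.push_id _).symm }
  comp {A B C} f k :=
    { base := f.base.comp k.base
      hat := f.hat.comp k.hat
      exc_subset := fun e h => f.exc_subset _ (k.exc_subset e h)
      onV_comm := fun v => (congrArg k.hat.onV (f.onV_comm v)).trans (k.onV_comm _)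
      onE_comm := fun h => (f.onE_comm _).trans (congrArg f.base.onE (k.onE_comm h))
      div_eq := by rw [k.div_eq, f.div_eq, Spec.push_comp] }

end Triple

/-- `(𝓔, D) ≥ (𝓔', D')` for pseudo-divisors on the same graph `G`: there is a specialization of
triples over the identity of `G`. -/
def PseudoDiv.Ge {n : ℕ} {G : WGraph n} (P Q : PseudoDiv G) : Prop :=
  ∃ f : Triple.mk G P ⟶ Triple.mk G Q, f.base = Spec.id G

/-- `P = pol(Q)`: the pseudo-divisor `P` is the unique minimal (that is, the least) `μ`-polystable
pseudo-divisor on `G` with `P ≥ Q`. -/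
def PseudoDiv.IsPol {n : ℕ} {G : WGraph n} (μ : G.V → ℝ) (P Q : PseudoDiv G) : Prop :=
  P.IsPolystable μ ∧ P.Ge Q ∧ ∀ R : PseudoDiv G, R.IsPolystable μ → R.Ge Q → R.Ge P

/-! ## The cones of a triple -/

namespace WGraph

variable {n : ℕ} (G : WGraph n) (S : Finset G.E)

/-- The vector `u_W`, for a set `W` with `E(W, Wᶜ) ⊆ S`: an edge of the subdivision over an edge in
`E(W, Wᶜ)` has coordinate `1` if it is incident to `W` and `-1` if it is incident to `Wᶜ`; the other
coordinates are `0`. -/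
def cutVector (W : Finset G.V) : (G.subdiv S).E → ℝ :=
  Sum.elim (fun _ => 0) fun h =>
    if h.1.1 ∈ G.cut W then (if (if h.2 then G.tgt h.1 else G.src h.1) ∈ W then 1 else -1) else 0

/-- The subspace `𝓛_S` generated by the vectors `u_W` with `E(W, Wᶜ) ⊆ S`. -/
def cutSpace : Submodule ℝ ((G.subdiv S).E → ℝ) :=
  Submodule.span ℝ {u | ∃ W : Finset G.V, G.cut W ⊆ S ∧ u = G.cutVector S W}

theorem cutSpace_rational : IsRationalSubspace (G.cutSpace S) := by
  refine ⟨_, ?_, rfl⟩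
  rintro _ ⟨W, -, rfl⟩ (h | h)
  · exact ⟨0, by simp [cutVector]⟩
  · simp only [cutVector, Sum.elim_inr]
    split_ifs
    exacts [⟨1, by simp⟩, ⟨-1, by simp⟩, ⟨1, by simp⟩, ⟨-1, by simp⟩, ⟨0, by simp⟩]

end WGraph

namespace Triple

variable {n : ℕ} {A B C : Triple n}

/-- The cone `τ = ℝ_{≥0}^{E(Γ^𝓔)}`. -/
def tau (A : Triple n) : RPCone := orthantCone A.graph.E

/-- The cone `σ`, the image of `ℝ_{≥0}^{E(Γ^𝓔)}` in `ℝ^{E(Γ^𝓔)} / 𝓛_𝓔`. -/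
def sigma (A : Triple n) : RPCone :=
  quotientCone (A.G.cutSpace A.pd.exc) (A.G.cutSpace_rational A.pd.exc)

/-- The inclusion `ℝ^{E(Γ'^𝓔')} → ℝ^{E(Γ^𝓔)}` (extension by zero) defined by a specialization
`(Γ, 𝓔, D) ≥ (Γ', 𝓔', D')`. -/
def Hom.extend (f : A ⟶ B) : (B.graph.E → ℝ) →ₗ[ℝ] (A.graph.E → ℝ) :=
  Function.ExtendByZero.linearMap ℝ f.hat.onE

theorem Hom.extend_apply (f : A ⟶ B) (x : B.graph.E → ℝ) (h : B.graph.E) :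
    Hom.extend f x (f.hat.onE h) = x h :=
  f.hat.injective_onE.extend_apply x (0 : A.graph.E → ℝ) h

theorem Hom.extend_apply' (f : A ⟶ B) (x : B.graph.E → ℝ) (h : A.graph.E)
    (hh : ¬ ∃ h', f.hat.onE h' = h) : Hom.extend f x h = 0 :=
  Function.extend_apply' x (0 : A.graph.E → ℝ) h hh

theorem Hom.extend_id (A : Triple n) (x : A.graph.E → ℝ) : Hom.extend (𝟙 A) x = x :=
  funext fun h => Hom.extend_apply (𝟙 A) x h

theorem Hom.extend_comp (f : A ⟶ B) (k : B ⟶ C) (x : C.graph.E → ℝ) :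
    Hom.extend (f ≫ k) x = Hom.extend f (Hom.extend k x) := by
  funext h
  by_cases h1 : ∃ h', f.hat.onE h' = h
  · obtain ⟨h', rfl⟩ := h1
    rw [Hom.extend_apply]
    by_cases h2 : ∃ h'', k.hat.onE h'' = h'
    · obtain ⟨h'', rfl⟩ := h2
      rw [Hom.extend_apply]
      exact Hom.extend_apply (f ≫ k) x h''
    · rw [Hom.extend_apply' k _ _ h2]
      refine Hom.extend_apply' (f ≫ k) x _ ?_
      rintro ⟨h'', e⟩
      exact h2 ⟨h'', f.hat.injective_onE e⟩
  · rw [Hom.extend_apply' f _ _ h1]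
    refine Hom.extend_apply' (f ≫ k) x _ ?_
    rintro ⟨h'', e⟩
    exact h1 ⟨_, e⟩

theorem Hom.extend_orthant (f : A ⟶ B) {x : B.graph.E → ℝ} (hx : x ∈ orthant B.graph.E) :
    Hom.extend f x ∈ orthant A.graph.E := by
  intro h
  by_cases h1 : ∃ h', f.hat.onE h' = h
  · obtain ⟨h', rfl⟩ := h1
    rw [Hom.extend_apply]; exact hx h'
  · rw [Hom.extend_apply' f _ _ h1]

theorem Hom.extend_intLattice (f : A ⟶ B) {x : B.graph.E → ℝ} (hx : x ∈ intLattice B.graph.E) :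
    Hom.extend f x ∈ intLattice A.graph.E := by
  intro h
  by_cases h1 : ∃ h', f.hat.onE h' = h
  · obtain ⟨h', rfl⟩ := h1
    rw [Hom.extend_apply]; exact hx h'
  · rw [Hom.extend_apply' f _ _ h1]; exact ⟨0, by simp⟩

/-- The preimage of a set of vertices under a specialization. -/
def preimage (f : A ⟶ B) (W : Finset B.G.V) : Finset A.G.V :=
  Finset.univ.filter fun v => f.base.onV v ∈ W

theorem mem_cut_preimage (f : A ⟶ B) (W : Finset B.G.V) (e : B.G.E) :
    f.base.onE e ∈ A.G.cut (preimage f W) ↔ e ∈ B.G.cut W := by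
  simp only [WGraph.cut, preimage, Finset.mem_filter, Finset.mem_univ, true_and]
  rcases f.base.src_eq_or e with ⟨h1, h2⟩ | ⟨h1, h2⟩ <;> rw [h1, h2]
  tauto

theorem exists_of_mem_cut_preimage (f : A ⟶ B) (W : Finset B.G.V) (e : A.G.E)
    (he : e ∈ A.G.cut (preimage f W)) : ∃ e' ∈ B.G.cut W, f.base.onE e' = e := by
  by_cases h : ∃ e', f.base.onE e' = e
  · obtain ⟨e', rfl⟩ := h
    exact ⟨e', (mem_cut_preimage f W e').1 he, rfl⟩
  · exfalso
    have := f.base.onV_src_eq_onV_tgt e fun e' he' => h ⟨e', he'⟩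
    simp only [WGraph.cut, preimage, Finset.mem_filter, Finset.mem_univ, true_and, this] at he
    tauto

theorem Hom.extend_cutVector (f : A ⟶ B) (W : Finset B.G.V) (hW : B.G.cut W ⊆ B.pd.exc) :
    Hom.extend f (B.G.cutVector B.pd.exc W) = A.G.cutVector A.pd.exc (preimage f W) := by
  funext h
  by_cases h1 : ∃ h', f.hat.onE h' = h
  · obtain ⟨h', rfl⟩ := h1
    rw [Hom.extend_apply]
    have hcomm := f.onE_comm h'
    have hsrc := f.hat.src_eq_or h'
    rcases h' with e' | ⟨e', c⟩
    · -- the edge `e'` is not in the cut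
      have he' : (e' : B.G.E) ∉ B.G.cut W := fun h => e'.2 (hW h)
      rcases hh : f.hat.onE (Sum.inl e') with e | ⟨e, b⟩
      · rfl
      · rw [hh] at hcomm
        have hcomm' : (e : A.G.E) = f.base.onE e' := hcomm
        have : (e : A.G.E) ∉ A.G.cut (preimage f W) := by
          rw [hcomm', mem_cut_preimage]; exact he'
        simp [WGraph.cutVector, this]
    · rcases hh : f.hat.onE (Sum.inr (e', c)) with e | ⟨e, b⟩
      · exfalso
        rw [hh] at hcomm
        have hcomm' : (e : A.G.E) = f.base.onE e' := hcomm
        exact e.2 (hcomm' ▸ f.exc_subset _ e'.2)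
      · rw [hh] at hcomm hsrc
        have hcomm' : (e : A.G.E) = f.base.onE e' := hcomm
        have hsrc' : (if c then B.G.tgt e' else B.G.src e') =
            f.base.onV (if b then A.G.tgt e else A.G.src e) := by
          rcases hsrc with ⟨h1, -⟩ | ⟨-, h1⟩
          · have := h1.trans (f.onV_comm _)
            exact Sum.inl_injective this
          · have := h1.trans (f.onV_comm _)
            exact absurd this Sum.inr_ne_inl
        have hmem : (e : A.G.E) ∈ A.G.cut (preimage f W) ↔ (e' : B.G.E) ∈ B.G.cut W := by
          rw [hcomm', mem_cut_preimage]
        have hW' : (if b then A.G.tgt e else A.G.src e) ∈ preimage f W ↔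
            (if c then B.G.tgt e' else B.G.src e') ∈ W := by
          rw [hsrc']; simp [preimage]
        change (if _ then (if _ then (1 : ℝ) else -1) else 0) =
          (if _ then (if _ then (1 : ℝ) else -1) else 0)
        simp only [hmem, hW']
  · rw [Hom.extend_apply' f _ _ h1]
    rcases h with e | ⟨e, b⟩
    · rfl
    · have he : (e : A.G.E) ∉ A.G.cut (preimage f W) := by
        intro he
        obtain ⟨e', he', hee⟩ := exists_of_mem_cut_preimage f W e he
        have hex : ∀ c : Bool, ∃ b', f.hat.onE (Sum.inr (⟨e', hW he'⟩, c)) = Sum.inr (e, b') := by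
          intro c
          have hcomm := f.onE_comm (Sum.inr (⟨e', hW he'⟩, c))
          rcases hh : f.hat.onE (Sum.inr (⟨e', hW he'⟩, c)) with e₁ | ⟨e₁, b₁⟩
          · rw [hh] at hcomm
            have hcomm' : (e₁ : A.G.E) = f.base.onE e' := hcomm
            exact absurd (hcomm' ▸ f.exc_subset _ (hW he')) e₁.2
          · rw [hh] at hcomm
            have hcomm' : (e₁ : A.G.E) = f.base.onE e' := hcomm
            obtain rfl : e₁ = e := Subtype.ext (hcomm'.trans hee)
            exact ⟨b₁, rfl⟩
        obtain ⟨b0, hb0⟩ := hex false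
        obtain ⟨b1, hb1⟩ := hex true
        have hne : b0 ≠ b1 := by
          rintro rfl
          have := f.hat.injective_onE (hb0.trans hb1.symm)
          exact Bool.false_ne_true (congrArg Prod.snd (Sum.inr_injective this))
        rcases Bool.eq_or_eq_not b b0 with rfl | hb
        · exact h1 ⟨_, hb0⟩
        · have : b = b1 := by
            revert hb hne
            cases b <;> cases b0 <;> cases b1 <;> simp
          subst this
          exact h1 ⟨_, hb1⟩
      exact (if_neg he).symm

theorem Hom.extend_cutSpace (f : A ⟶ B) :
    B.G.cutSpace B.pd.exc ≤ (A.G.cutSpace A.pd.exc).comap (Hom.extend f) := by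
  refine Submodule.span_le.2 ?_
  rintro _ ⟨W, hW, rfl⟩
  refine Submodule.subset_span ⟨preimage f W, ?_, Hom.extend_cutVector f W hW⟩
  intro e he
  obtain ⟨e', he', rfl⟩ := exists_of_mem_cut_preimage f W e he
  exact f.exc_subset _ (hW he')

/-- The linear map `ℝ^{E(Γ'^𝓔')} / 𝓛_𝓔' → ℝ^{E(Γ^𝓔)} / 𝓛_𝓔` induced by a specialization. -/
def Hom.extendQuot (f : A ⟶ B) : ((B.graph.E → ℝ) ⧸ B.G.cutSpace B.pd.exc) →ₗ[ℝ]
    ((A.graph.E → ℝ) ⧸ A.G.cutSpace A.pd.exc) :=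
  Submodule.mapQ _ _ (Hom.extend f) (Hom.extend_cutSpace f)

/-- The contravariant functor `(Γ, 𝓔, D) ↦ τ`. -/
def tauFunctor (n : ℕ) : (Triple n)ᵒᵖ ⥤ RPCone where
  obj A := tau A.unop
  map f := RPCone.Hom.ofLinear (C := tau _) (D := tau _) (Hom.extend f.unop)
    (fun _ => Hom.extend_intLattice f.unop) (fun _ => Hom.extend_orthant f.unop)
  map_id A := RPCone.Hom.ext (funext fun x => Subtype.ext (Hom.extend_id A.unop x.1))
  map_comp f k := RPCone.Hom.ext (funext fun x => Subtype.ext (Hom.extend_comp k.unop f.unop x.1))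

/-- The contravariant functor `(Γ, 𝓔, D) ↦ σ`. -/
def sigmaFunctor (n : ℕ) : (Triple n)ᵒᵖ ⥤ RPCone where
  obj A := sigma A.unop
  map f := RPCone.Hom.ofLinear (C := sigma _) (D := sigma _) (Hom.extendQuot f.unop)
    (by
      rintro _ ⟨x, hx, rfl⟩
      exact ⟨Hom.extend f.unop x, Hom.extend_intLattice f.unop hx, rfl⟩)
    (by
      rintro _ ⟨x, hx, rfl⟩
      exact ⟨Hom.extend f.unop x, Hom.extend_orthant f.unop hx, rfl⟩)
  map_id A := RPCone.Hom.ext (funext fun ⟨_, x, _, hx⟩ => Subtype.ext (by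
    subst hx
    exact congrArg (Submodule.mkQ _) (Hom.extend_id A.unop x)))
  map_comp f k := RPCone.Hom.ext (funext fun ⟨_, x, _, hx⟩ => Subtype.ext (by
    subst hx
    exact congrArg (Submodule.mkQ _) (Hom.extend_comp k.unop f.unop x)))

/-- The natural map from the ambient space of the cone `τ` of `(Γ', 𝓔', D')` to the ambient space of
the cone `σ` of `(Γ, 𝓔, D)`, for a specialization `(Γ, 𝓔, D) ≥ (Γ', 𝓔', D')`. -/
def cellMap (f : A ⟶ B) : (B.graph.E → ℝ) →ₗ[ℝ] (sigma A).N :=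
  (A.G.cutSpace A.pd.exc).mkQ ∘ₗ Hom.extend f

/-- The copy in `σ`, the cone of `(Γ, 𝓔, D)`, of the open cone `τ° = ℝ_{>0}^{E(Γ'^𝓔')}` that is
defined by a specialization `(Γ, 𝓔, D) ≥ (Γ', 𝓔', D')`. -/
def cell (f : A ⟶ B) : Set (sigma A).N := cellMap f '' openOrthant B.graph.E

end Triple

/-! ## The universal tropical Jacobians -/

/-- A universal genus-`g` polarization of degree `d` for graphs with `n` legs. -/
structure UnivPolarization (g n : ℕ) (d : ℤ) where
  val : ∀ G : WGraph n, G.IsStable g → G.V → ℝ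
  degree : ∀ G hG, ∑ v, val G hG v = d
  push_eq : ∀ (G H : WGraph n) (hG : G.IsStable g) (hH : H.IsStable g) (f : Spec G H),
    f.push (val G hG) = val H hH

namespace UnivPolarization

variable {g n : ℕ} {d : ℤ} (μ : UnivPolarization g n d)

/-- Triples `(Γ, 𝓔, D)` with `Γ` stable of genus `g` and `(𝓔, D)` a `(v₀, μ)`-quasistable
pseudo-divisor, where the first leg is incident to `v₀`. -/
def isQD [NeZero n] : ObjectProperty (Triple n) := fun A =>
  ∃ h : A.G.IsStable g, A.pd.IsQuasistable (μ.val A.G h) (A.G.leg 0)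

/-- Triples `(Γ, 𝓔, D)` with `Γ` stable of genus `g` and `(𝓔, D)` a `μ`-polystable
pseudo-divisor. -/
def isPSD : ObjectProperty (Triple n) := fun A =>
  ∃ h : A.G.IsStable g, A.pd.IsPolystable (μ.val A.G h)

/-- The category of quasistable triples (a full subcategory of the category of triples). -/
abbrev QD [NeZero n] := μ.isQD.FullSubcategory

/-- The category of polystable triples (a full subcategory of the category of triples). -/
abbrev PSD := μ.isPSD.FullSubcategory

/-- The diagram of the cones `τ` of the quasistable triples. -/
abbrev diagramJ [NeZero n] : μ.QDᵒᵖ ⥤ RPCone := μ.isQD.ι.op ⋙ Triple.tauFunctor n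

/-- The diagram of the cones `σ` of the polystable triples. -/
abbrev diagramP : μ.PSDᵒᵖ ⥤ RPCone := μ.isPSD.ι.op ⋙ Triple.sigmaFunctor n

/-- The universal tropical Jacobian of `μ`-quasistable divisors. -/
abbrev J [NeZero n] := ConeSpace μ.diagramJ

/-- The universal tropical Jacobian of `μ`-polystable divisors. -/
abbrev P := ConeSpace μ.diagramP

/-- The point of `J` given by a point of the cone `τ` of a quasistable triple. -/
def mkJ [NeZero n] (A : Triple n) (hA : μ.isQD A) (x : A.graph.E → ℝ)
    (hx : x ∈ openOrthant A.graph.E) : μ.J :=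
  ConeSpace.mk μ.diagramJ ⟨A, hA⟩ ⟨x, fun h => (hx h).le⟩

/-- The point of `P` given by the image in the cone `σ` of a polystable triple of a point of the
orthant. -/
def mkP (A : Triple n) (hA : μ.isPSD A) (x : A.graph.E → ℝ)
    (hx : x ∈ openOrthant A.graph.E) : μ.P :=
  ConeSpace.mk μ.diagramP ⟨A, hA⟩
    ⟨(A.G.cutSpace A.pd.exc).mkQ x, x, fun h => (hx h).le, rfl⟩

end UnivPolarization

/-! ## Divisors on tropical curves -/

/-- A tropical curve (metric graph): a graph with positive edge lengths. -/
structure TropCurve (n : ℕ) where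
  G : WGraph n
  len : G.E → ℝ
  len_pos : ∀ e, 0 < len e

namespace TropCurve

variable {n : ℕ} (X : TropCurve n)

/-- The points of `X`: the vertices, and for each edge `e` the points of its interior, given by the
distance `t ∈ (0, len e)` from `src e` along `e`. -/
def Point : Type := X.G.V ⊕ Σ e : X.G.E, Set.Ioo (0 : ℝ) (X.len e)

variable {X} in
/-- The restriction of a function on `X` to the edge `e`, as a function of the distance
`t ∈ [0, len e]` from `src e`. -/
def along (f : X.Point → ℝ) (e : X.G.E) (t : ℝ) : ℝ := by
  classical
  exact if h : t ∈ Set.Ioo (0 : ℝ) (X.len e) then f (Sum.inr ⟨e, t, h⟩)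
    else if t ≤ 0 then f (Sum.inl (X.G.src e)) else f (Sum.inl (X.G.tgt e))

/-- A rational function on `X`, that is, a continuous piecewise linear function with integer slopes:
on every closed edge and at each of its points, the function is affine with an integer slope on a
small interval on either side. Here `up e t` and `down e t` are the outgoing slopes at the point `t`
of `e` towards `tgt e` and towards `src e`. -/
structure RatFun where
  val : X.Point → ℝ
  up : X.G.E → ℝ → ℤ
  down : X.G.E → ℝ → ℤ
  up_spec : ∀ e, ∀ t ∈ Set.Ico 0 (X.len e), ∃ ε > 0, ∀ s ∈ Set.Icc 0 ε,
    along val e (t + s) = along val e t + up e t * s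
  down_spec : ∀ e, ∀ t ∈ Set.Ioc 0 (X.len e), ∃ ε > 0, ∀ s ∈ Set.Icc 0 ε,
    along val e (t - s) = along val e t + down e t * s

variable {X}

/-- The sum of the outgoing slopes of a rational function at a point. -/
def RatFun.ord (f : X.RatFun) : X.Point → ℤ :=
  Sum.elim
    (fun v => ∑ e, ((if X.G.src e = v then f.up e 0 else 0) +
      (if X.G.tgt e = v then f.down e (X.len e) else 0)))
    (fun p => f.up p.1 p.2 + f.down p.1 p.2)

/-- Linear equivalence of divisors on `X`: the difference is the divisor of a rational function. -/
def LinEquiv (D D' : X.Point → ℤ) : Prop := ∃ f : X.RatFun, ∀ p, D p - D' p = f.ord p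

end TropCurve

/-- The linear map `𝓢` from edge lengths of the subdivided graph to edge lengths of the graph: the
length of an edge is the sum of the lengths of the edges over it. -/
def PseudoDiv.totalLength {n : ℕ} {G : WGraph n} (Q : PseudoDiv G) (x : Q.graph.E → ℝ) (e : G.E) :
    ℝ :=
  ∑ h with G.under Q.exc h = e, x h

/-- The unitary divisor on `X` of combinatorial type `Q = (𝓔, D)` with positions given by `x`: it
takes the value `D(v)` at the vertices `v` of `X`, the value `-1` at the point of `e ∈ 𝓔` at distance
`x (e, false)` from `src e`, and it vanishes elsewhere. -/
def PseudoDiv.unitaryDivisor {n : ℕ} {X : TropCurve n} (Q : PseudoDiv X.G)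
    (x : Q.graph.E → ℝ) : X.Point → ℤ :=
  Sum.elim (fun v => Q.div (Sum.inl v)) fun p => by
    classical
    exact if ∃ h : p.1 ∈ Q.exc, (p.2 : ℝ) = x (Sum.inr (⟨p.1, h⟩, false)) then -1 else 0

/-- The graph of the map `ρ : J → P`: the point of `J` is the class of `(X, 𝓓)` with `𝓓`
quasistable, and the point of `P` is the class of `(X, 𝓓')` with `𝓓'` polystable and linearly
equivalent to `𝓓`. -/
def UnivPolarization.IsRho {g n : ℕ} [NeZero n] {d : ℤ} (μ : UnivPolarization g n d)
    (j : μ.J) (p : μ.P) : Prop :=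
  ∃ (X : TropCurve n) (Q R : PseudoDiv X.G)
    (hQ : μ.isQD ⟨X.G, Q⟩) (hR : μ.isPSD ⟨X.G, R⟩)
    (x : Q.graph.E → ℝ) (y : R.graph.E → ℝ)
    (hx : x ∈ openOrthant Q.graph.E) (hy : y ∈ openOrthant R.graph.E),
    Q.totalLength x = X.len ∧ R.totalLength y = X.len ∧
    TropCurve.LinEquiv (Q.unitaryDivisor x) (R.unitaryDivisor y) ∧
    j = μ.mkJ ⟨X.G, Q⟩ hQ x hx ∧ p = μ.mkP ⟨X.G, R⟩ hR y hy

end TropJac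

end

open TropJac

/-! ### Edge-by-edge formulas for the stability invariants on a graph and its subdivision. -/

noncomputable section

namespace TropJac

/-! Quasistability and polystability are both treated as refinements of semistability, the
nonnegativity of all `betaExc`. Quasistable means semistable without a zero on a proper subset
containing `v₀`; polystable means semistable with zeros only on sets whose cut is exceptional. On
the subdivision, the invariant of `Y` is `betaExc` of its old vertices plus a nonnegative defect
(`PseudoDiv.beta_eq`). Hence a specialization can only raise invariants, and
`Hom.betaExc_eq_zero_iff` says which zeros survive.

Decomposition of σ. The space 𝓛 consists of the coboundaries `delta φ` of potentials that are
constant along non-exceptional edges. For a point of the orthant, allow steps in both directions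
along non-exceptional edges, and along an exceptional edge towards an end whose half has length
zero. A maximum principle shows that each class in σ has exactly one representative in the orthant
for which every vertex is reachable from `v₀`: uniqueness is `WGraph.eq_of_reach`, and existence
(`WGraph.exists_reach`) comes from the least potential that keeps the point in the orthant. On the
other side, a specialization of a polystable triple has quasistable target if and only if every
vertex is reachable from `v₀` when the contracted halves are the ones of length zero
(`Hom.reach_of_isQuasistable`, `Hom.isQuasistable_of_reach`), because the sets of invariant zero in
the target correspond to the sets that no step leaves. Contracting the zero coordinates of the
normalized representative therefore puts each point of σ into exactly one open cell.

The map ρ. If `betaExc` of a semistable pseudo-divisor vanishes on `W`, the cut of `W` can be made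
exceptional; modularity of the invariant keeps the result semistable. Iteration gives a polystable
pseudo-divisor through which every specialization from a polystable triple factors
(`Triple.exists_polystable`). It is `pol`, and this factorization makes the maps of cones from τ to
σ compatible with the gluing. A small multiple of `u_W` moves τ° into the image of the open orthant,
which is the relative interior of σ. Bijectivity of ρ follows from the cell decomposition.

Cone complexes. When the target is polystable, a contracted half lies on a directed cycle of steps.
The sum of the coordinates along this cycle vanishes on 𝓛, and such sums cut out the face in σ; an
integral left inverse comes from integrating along loose edges. Finiteness holds since stability
bounds the graphs and semistability bounds the divisors.

Tropical curves. Linear equivalence of unitary divisors is encoded by the values of a rational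
function at the vertices and its integer slopes at the sources of the edges. Points that agree
modulo 𝓛 give linearly equivalent divisors (`Hom.IsStandard.isLinEquiv`), and a second maximum
principle shows that a linear equivalence class contains at most one quasistable divisor
(`IsLinEquiv.eq`). This identifies the graph of ρ with `IsRho`. -/

theorem sum_subtype_eq_sum_dite {ι M : Type} [Fintype ι] [AddCommMonoid M] (p : ι → Prop)
    [DecidablePred p] [Fintype {i // p i}] (F : {i // p i} → M) :
    ∑ i, F i = ∑ i, if h : p i then F ⟨i, h⟩ else 0 := by
  have h1 : ∀ i : {i // p i}, F i = (fun i => if h : p i then F ⟨i, h⟩ else 0) i.1 := by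
    rintro ⟨i, hi⟩
    simp [hi]
  rw [Finset.sum_congr rfl fun i _ => h1 i,
    ← Finset.sum_subtype (Finset.univ.filter p) (by simp) (fun i => if h : p i then F ⟨i, h⟩ else 0),
    Finset.sum_filter]
  refine Finset.sum_congr rfl fun i _ => ?_
  split_ifs <;> rfl

namespace WGraph

variable {n : ℕ} (G : WGraph n)

/-- The end-vertices of an edge: the target for `true`, the source for `false`. -/
def endp (e : G.E) (b : Bool) : G.V := if b then G.tgt e else G.src e

@[simp] theorem endp_true (e : G.E) : G.endp e true = G.tgt e := rfl

@[simp] theorem endp_false (e : G.E) : G.endp e false = G.src e := rfl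

theorem ends_eq_endp (e : G.E) (b : Bool) : G.ends e = s(G.endp e b, G.endp e !b) := by
  cases b
  · rfl
  · exact Sym2.eq_swap

theorem exists_endp_of_ends_eq {e : G.E} {a b : G.V} (h : G.ends e = s(a, b)) :
    ∃ c, G.endp e c = b ∧ G.endp e (!c) = a := by
  rcases Sym2.eq_iff.1 h with ⟨h1, h2⟩ | ⟨h1, h2⟩
  · exact ⟨true, h2, h1⟩
  · exact ⟨false, h1, h2⟩

/-- The end `b` is arbitrary, so that later arguments can name the relevant end without splitting on
the reference orientation. -/
theorem mem_cut_iff (W : Finset G.V) (e : G.E) (b : Bool) :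
    e ∈ G.cut W ↔ (G.endp e b ∈ W ↔ G.endp e (!b) ∉ W) := by
  cases b <;> simp [cut, endp] <;> tauto

section Subdivision

variable (S : Finset G.E)

/-- A vertex of the graph as a vertex of the subdivision. -/
def oldV (v : G.V) : (G.subdiv S).V := Sum.inl v

/-- The exceptional vertex on an edge of `S`. -/
def midV (e : G.E) (h : e ∈ S) : (G.subdiv S).V := Sum.inr ⟨e, h⟩

/-- An edge outside `S` as an edge of the subdivision. -/
def oldE (e : G.E) (h : e ∉ S) : (G.subdiv S).E := Sum.inl ⟨e, h⟩

/-- The half of an edge in `S` which is incident to the end-vertex `endp e b`. -/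
def halfE (e : G.E) (h : e ∈ S) (b : Bool) : (G.subdiv S).E := Sum.inr (⟨e, h⟩, b)

theorem subdiv_V_cases (v : (G.subdiv S).V) :
    (∃ w, v = G.oldV S w) ∨ ∃ e h, v = G.midV S e h := by
  rcases v with w | ⟨e, h⟩
  exacts [Or.inl ⟨w, rfl⟩, Or.inr ⟨e, h, rfl⟩]

theorem subdiv_E_cases (k : (G.subdiv S).E) :
    (∃ e h, k = G.oldE S e h) ∨ ∃ e h b, k = G.halfE S e h b := by
  rcases k with ⟨e, h⟩ | ⟨⟨e, h⟩, b⟩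
  exacts [Or.inl ⟨e, h, rfl⟩, Or.inr ⟨e, h, b, rfl⟩]

variable {S}

/-- The extension by zero of a function on the vertices to the subdivision. -/
def extendV (S : Finset G.E) (μ : G.V → ℝ) : (G.subdiv S).V → ℝ := Sum.elim μ fun _ => 0

@[simp] theorem extendV_oldV (μ : G.V → ℝ) (v : G.V) : G.extendV S μ (G.oldV S v) = μ v := rfl

@[simp] theorem extendV_midV (μ : G.V → ℝ) (e : G.E) (h : e ∈ S) :
    G.extendV S μ (G.midV S e h) = 0 := rfl

@[simp] theorem oldV_inj {v w : G.V} : G.oldV S v = G.oldV S w ↔ v = w :=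
  Sum.inl_injective.eq_iff

@[simp] theorem midV_inj {e e' : G.E} {h : e ∈ S} {h' : e' ∈ S} :
    G.midV S e h = G.midV S e' h' ↔ e = e' :=
  Sum.inr_injective.eq_iff.trans Subtype.mk_eq_mk

@[simp] theorem oldE_inj {e e' : G.E} {h : e ∉ S} {h' : e' ∉ S} :
    G.oldE S e h = G.oldE S e' h' ↔ e = e' :=
  Sum.inl_injective.eq_iff.trans Subtype.mk_eq_mk

@[simp] theorem halfE_inj {e e' : G.E} {h : e ∈ S} {h' : e' ∈ S} {b b' : Bool} :
    G.halfE S e h b = G.halfE S e' h' b' ↔ e = e' ∧ b = b' :=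
  Sum.inr_injective.eq_iff.trans (Prod.mk_inj.trans (and_congr_left' Subtype.mk_eq_mk))

@[simp] theorem oldV_ne_midV {v : G.V} {e : G.E} {h : e ∈ S} : G.oldV S v ≠ G.midV S e h :=
  Sum.inl_ne_inr

@[simp] theorem midV_ne_oldV {v : G.V} {e : G.E} {h : e ∈ S} : G.midV S e h ≠ G.oldV S v :=
  Sum.inr_ne_inl

@[simp] theorem under_oldE (e : G.E) (h : e ∉ S) : G.under S (G.oldE S e h) = e := rfl

@[simp] theorem under_halfE (e : G.E) (h : e ∈ S) (b : Bool) :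
    G.under S (G.halfE S e h b) = e := rfl

@[simp] theorem endp_oldE (e : G.E) (h : e ∉ S) (b : Bool) :
    (G.subdiv S).endp (G.oldE S e h) b = G.oldV S (G.endp e b) := by
  cases b <;> rfl

@[simp] theorem src_halfE (e : G.E) (h : e ∈ S) (b : Bool) :
    (G.subdiv S).src (G.halfE S e h b) = G.oldV S (G.endp e b) := rfl

@[simp] theorem tgt_halfE (e : G.E) (h : e ∈ S) (b : Bool) :
    (G.subdiv S).tgt (G.halfE S e h b) = G.midV S e h := rfl

theorem ends_halfE (e : G.E) (h : e ∈ S) (b : Bool) :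
    (G.subdiv S).ends (G.halfE S e h b) = s(G.oldV S (G.endp e b), G.midV S e h) := rfl

theorem ends_oldE (e : G.E) (h : e ∉ S) :
    (G.subdiv S).ends (G.oldE S e h) = s(G.oldV S (G.src e), G.oldV S (G.tgt e)) := rfl

/-- Sums over the subdivision become sums over the vertices and edges of `G`, so that identities
between invariants can be checked one edge at a time. -/
theorem sum_subdiv_V {M : Type} [AddCommMonoid M] (F : (G.subdiv S).V → M) :
    ∑ v, F v = ∑ v, F (G.oldV S v) + ∑ e, if h : e ∈ S then F (G.midV S e h) else 0 := by
  rw [← sum_subtype_eq_sum_dite (fun e => e ∈ S) (fun e => F (G.midV S e.1 e.2))]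
  exact Fintype.sum_sum_type (α₁ := G.V) (α₂ := {e // e ∈ S}) F

theorem sum_subdiv_E {M : Type} [AddCommMonoid M] (F : (G.subdiv S).E → M) :
    ∑ h, F h = ∑ e, if h : e ∈ S then F (G.halfE S e h false) + F (G.halfE S e h true)
      else F (G.oldE S e h) := by
  have h1 : ∑ h, F h = ∑ e : {e // e ∉ S}, F (G.oldE S e.1 e.2) +
      ∑ e : {e // e ∈ S}, (F (G.halfE S e.1 e.2 false) + F (G.halfE S e.1 e.2 true)) := by
    refine (Fintype.sum_sum_type (α₁ := {e // e ∉ S}) (α₂ := {e // e ∈ S} × Bool) F).trans ?_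
    congr 1
    rw [Fintype.sum_prod_type]
    refine Finset.sum_congr rfl fun e _ => ?_
    exact (Fintype.sum_bool _).trans (add_comm _ _)
  rw [h1, sum_subtype_eq_sum_dite (fun e => e ∉ S) (fun e => F (G.oldE S e.1 e.2)),
    sum_subtype_eq_sum_dite (fun e => e ∈ S)
      (fun e => F (G.halfE S e.1 e.2 false) + F (G.halfE S e.1 e.2 true)), ← Finset.sum_add_distrib]
  refine Finset.sum_congr rfl fun e _ => ?_
  by_cases h : e ∈ S <;> simp [h]

end Subdivision

theorem sum_degIn (S : Finset G.E) (W : Finset G.V) : ∑ v ∈ W, (G.degIn S v : ℝ) =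
    ∑ e ∈ S, ((if G.src e ∈ W then 1 else 0) + if G.tgt e ∈ W then 1 else 0) := by
  simp only [degIn, Nat.cast_add, Finset.sum_add_distrib, Finset.card_filter, Nat.cast_sum,
    Nat.cast_ite, Nat.cast_one, Nat.cast_zero]
  congr 1 <;>
  · rw [Finset.sum_comm]
    refine Finset.sum_congr rfl fun e _ => ?_
    simp

theorem card_cut (W : Finset G.V) : ((G.cut W).card : ℝ) = ∑ e, if e ∈ G.cut W then 1 else 0 := by
  simp

theorem joined_symm {S : Set G.E} {a b : G.V} (h : G.Joined S a b) : G.Joined S b a := by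
  induction h with
  | refl => exact Relation.ReflTransGen.refl
  | tail _ h ih =>
    obtain ⟨e, he, h⟩ := h
    exact ih.head ⟨e, he, h.trans Sym2.eq_swap⟩

end WGraph

namespace PseudoDiv

variable {n : ℕ} {G : WGraph n} (P : PseudoDiv G)

/-- Semistability: the invariants of polystability are nonnegative. -/
def IsSemistable (μ : G.V → ℝ) : Prop :=
  P.HasDegreeOf μ ∧ ∀ W : Finset G.V, 0 ≤ P.betaExc μ W

@[simp] theorem div_midV (e : G.E) (h : e ∈ P.exc) : P.div (G.midV P.exc e h) = -1 :=
  P.div_exc ⟨e, h⟩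

/-- Each exceptional vertex carries -1, and the old vertices have to compensate for it. -/
theorem hasDegreeOf_iff (μ : G.V → ℝ) :
    P.HasDegreeOf μ ↔ ∑ v, (P.div (G.oldV P.exc v) : ℝ) = ∑ v, μ v + P.exc.card := by
  have h : ∑ v, (P.div v : ℝ) = ∑ v, (P.div (G.oldV P.exc v) : ℝ) - P.exc.card := by
    rw [G.sum_subdiv_V (fun v => (P.div v : ℝ))]
    have : ∀ e, (if h : e ∈ P.exc then (P.div (G.midV P.exc e h) : ℝ) else 0) =
        -(if e ∈ P.exc then 1 else 0) := by
      intro e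
      split_ifs with h
      · rw [div_midV]; simp
      · simp
    rw [Finset.sum_congr rfl fun e _ => this e]
    simp [sub_eq_add_neg]
  unfold HasDegreeOf
  rw [h, sub_eq_iff_eq_add]

/-- An exceptional edge is removed and enters only through the correction of the polarization, hence
counts -1/2 for each end in `W`; a remaining edge counts 1/2 if it is cut. -/
theorem betaExc_formula (μ : G.V → ℝ) (W : Finset G.V) :
    P.betaExc μ W = ∑ v ∈ W, ((P.div (G.oldV P.exc v) : ℝ) - μ v) +
      ∑ e, if e ∈ P.exc then -((if G.src e ∈ W then 1 else 0) + if G.tgt e ∈ W then 1 else 0) / 2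
        else if e ∈ G.cut W then (1 / 2 : ℝ) else 0 := by
  have h1 : (((G.remove P.exc).cut W).card : ℝ) =
      ∑ e, if e ∈ P.exc then 0 else if e ∈ G.cut W then (1 : ℝ) else 0 := by
    refine ((G.remove P.exc).card_cut W).trans ?_
    let W' : Finset (G.remove P.exc).V := W
    let c := (G.remove P.exc).cut W'
    refine (sum_subtype_eq_sum_dite (fun e => e ∉ P.exc) (fun e : (G.remove P.exc).E =>
      if e ∈ c then (1 : ℝ) else 0)).trans ?_
    refine Finset.sum_congr rfl fun e _ => ?_
    by_cases h : e ∈ P.exc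
    · simp [h]
    · simp only [h, not_false_eq_true, dite_true, if_false]
      have key : (⟨e, h⟩ : (G.remove P.exc).E) ∈ c ↔ e ∈ G.cut W :=
        ((G.remove P.exc).mem_cut_iff W' ⟨e, h⟩ false).trans (G.mem_cut_iff W e false).symm
      by_cases hc : e ∈ G.cut W
      · exact (if_pos (key.2 hc)).trans (if_pos hc).symm
      · exact (if_neg fun h => hc (key.1 h)).trans (if_neg hc).symm
  have h2 : ∑ v ∈ W, (G.degIn P.exc v : ℝ) = ∑ e, if e ∈ P.exc then
      ((if G.src e ∈ W then 1 else 0) + if G.tgt e ∈ W then (1 : ℝ) else 0) else 0 := by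
    rw [WGraph.sum_degIn]
    simp
  unfold betaExc WGraph.beta
  change ∑ v ∈ W, (P.div (G.oldV P.exc v) : ℝ) - ∑ v ∈ W, (μ v + (G.degIn P.exc v : ℝ) / 2) +
    (((G.remove P.exc).cut W).card : ℝ) / 2 = _
  rw [h1, Finset.sum_add_distrib, ← Finset.sum_div, h2, Finset.sum_sub_distrib,
    sub_add_eq_sub_sub, sub_add, sub_eq_add_neg (∑ v ∈ W, (P.div (G.oldV P.exc v) : ℝ) - _)]
  congr 1
  rw [Finset.sum_div, Finset.sum_div, ← Finset.sum_sub_distrib, ← Finset.sum_neg_distrib]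
  refine Finset.sum_congr rfl fun e _ => ?_
  split_ifs <;> ring

theorem beta_formula (μ : G.V → ℝ) (Y : Finset P.graph.V) :
    P.graph.beta P.div (G.extendV P.exc μ) Y =
      ∑ v, (if G.oldV P.exc v ∈ Y then (P.div (G.oldV P.exc v) : ℝ) - μ v else 0) +
      ∑ e, if h : e ∈ P.exc then
        (if G.midV P.exc e h ∈ Y then (-1 : ℝ) else 0) +
        (if (G.oldV P.exc (G.src e) ∈ Y ↔ G.midV P.exc e h ∉ Y) then 1 / 2 else 0) +
        (if (G.oldV P.exc (G.tgt e) ∈ Y ↔ G.midV P.exc e h ∉ Y) then 1 / 2 else 0)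
        else if (G.oldV P.exc (G.src e) ∈ Y ↔ G.oldV P.exc (G.tgt e) ∉ Y) then (1 / 2 : ℝ) else 0 := by
  unfold WGraph.beta
  rw [← Finset.sum_sub_distrib, ← Finset.sum_ite_mem_eq, G.sum_subdiv_V, WGraph.card_cut, add_assoc]
  congr 1
  rw [G.sum_subdiv_E, Finset.sum_div, ← Finset.sum_add_distrib]
  refine Finset.sum_congr rfl fun e _ => ?_
  by_cases h : e ∈ P.exc
  · simp only [h, dite_true]
    have h1 : ∀ b, G.halfE P.exc e h b ∈ P.graph.cut Y ↔
        (G.oldV P.exc (G.endp e b) ∈ Y ↔ G.midV P.exc e h ∉ Y) := fun b =>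
      (P.graph.mem_cut_iff Y _ false)
    simp only [div_midV, h1, WGraph.endp_true, WGraph.endp_false, WGraph.extendV_midV, Int.cast_neg,
      Int.cast_one, sub_zero, add_div, ite_div, zero_div, add_assoc]
  · simp only [h, dite_false, zero_add]
    have h1 : G.oldE P.exc e h ∈ P.graph.cut Y ↔
        (G.oldV P.exc (G.src e) ∈ Y ↔ G.oldV P.exc (G.tgt e) ∉ Y) := P.graph.mem_cut_iff Y _ false
    simp only [h1, ite_div, zero_div]

end PseudoDiv

end TropJac

end

/-! ### Semistability, modularity of the invariant, and pushforward. -/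

noncomputable section

namespace TropJac

namespace WGraph

variable {n : ℕ} (G : WGraph n) (S : Finset G.E)

open Classical in
/-- The vertices of the graph in a set of vertices of the subdivision. -/
def oldPart (Y : Finset (G.subdiv S).V) : Finset G.V :=
  Finset.univ.filter fun v => G.oldV S v ∈ Y

open Classical in
/-- A set of vertices together with the exceptional vertices adjacent to it. -/
def hull (W : Finset G.V) : Finset (G.subdiv S).V :=
  Finset.univ.filter fun v =>
    (∃ w ∈ W, v = G.oldV S w) ∨ ∃ e h b, v = G.midV S e h ∧ G.endp e b ∈ W

variable {S}

@[simp] theorem mem_oldPart {Y : Finset (G.subdiv S).V} {v : G.V} :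
    v ∈ G.oldPart S Y ↔ G.oldV S v ∈ Y := by
  simp [oldPart]

@[simp] theorem oldV_mem_hull {W : Finset G.V} {v : G.V} : G.oldV S v ∈ G.hull S W ↔ v ∈ W := by
  simp [hull]

@[simp] theorem midV_mem_hull {W : Finset G.V} {e : G.E} {h : e ∈ S} :
    G.midV S e h ∈ G.hull S W ↔ ∃ b, G.endp e b ∈ W := by
  simp only [hull, Finset.mem_filter, Finset.mem_univ, true_and, midV_ne_oldV, and_false,
    exists_false, false_or, midV_inj]
  constructor
  · rintro ⟨e', _, b, rfl, hb⟩; exact ⟨b, hb⟩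
  · rintro ⟨b, hb⟩; exact ⟨e, h, b, rfl, hb⟩

@[simp] theorem oldPart_hull (W : Finset G.V) : G.oldPart S (G.hull S W) = W := by
  ext v; simp

end WGraph

namespace PseudoDiv

variable {n : ℕ} {G : WGraph n} {P : PseudoDiv G} {μ : G.V → ℝ}

/-- The exceptional edges with exceptional vertex outside `Y`, each weighted by the number of its
ends in `Y`. -/
def defect (P : PseudoDiv G) (Y : Finset P.graph.V) : ℝ :=
  ∑ e, if h : e ∈ P.exc then (if G.midV P.exc e h ∈ Y then (0 : ℝ) else
      (if G.oldV P.exc (G.src e) ∈ Y then 1 else 0) +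
        (if G.oldV P.exc (G.tgt e) ∈ Y then 1 else 0)) else 0

theorem defect_nonneg (Y : Finset P.graph.V) : 0 ≤ P.defect Y := by
  refine Finset.sum_nonneg fun e _ => ?_
  split_ifs <;> norm_num

theorem defect_eq_zero_iff (Y : Finset P.graph.V) : P.defect Y = 0 ↔
    ∀ e h b, G.oldV P.exc (G.endp e b) ∈ Y → G.midV P.exc e h ∈ Y := by
  unfold defect
  rw [Finset.sum_eq_zero_iff_of_nonneg]
  · constructor
    · intro H e h b hb
      by_contra hm
      have := H e (Finset.mem_univ _)
      simp only [h, dite_true, hm, if_false] at this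
      cases b
      · simp only [WGraph.endp_false] at hb
        simp only [hb, if_true] at this
        split_ifs at this <;> norm_num at this
      · simp only [WGraph.endp_true] at hb
        simp only [hb, if_true] at this
        split_ifs at this <;> norm_num at this
    · intro H e _
      by_cases h : e ∈ P.exc
      · simp only [h, dite_true]
        split_ifs with h1 h2 h3 h3
        · rfl
        · exact absurd (H e h false h2) h1
        · exact absurd (H e h false h2) h1
        · exact absurd (H e h true h3) h1
        · norm_num
      · simp [h]
  · intro e _
    split_ifs <;> norm_num

/-- Consider an exceptional edge with `k` ends in `Y`. If its exceptional vertex is in `Y`, it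
contributes -1 + (2 - k)/2 = -k/2, as in `betaExc`. Otherwise it contributes k/2, and the excess k
is the defect. -/
theorem beta_eq (μ : G.V → ℝ) (Y : Finset P.graph.V) :
    P.graph.beta P.div (G.extendV P.exc μ) Y = P.betaExc μ (G.oldPart P.exc Y) + P.defect Y := by
  rw [beta_formula, betaExc_formula, add_assoc, defect, ← Finset.sum_add_distrib,
    ← Finset.sum_ite_mem_eq (G.oldPart P.exc Y)]
  congr 1
  · simp
  · refine Finset.sum_congr rfl fun e _ => ?_
    by_cases h : e ∈ P.exc
    · simp only [h, dite_true, if_true, WGraph.mem_oldPart]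
      by_cases h1 : G.midV P.exc e h ∈ Y <;> by_cases h2 : G.oldV P.exc (G.src e) ∈ Y <;>
        by_cases h3 : G.oldV P.exc (G.tgt e) ∈ Y <;> simp only [h1, h2, h3] <;> norm_num
    · simp only [h, dite_false, if_false, add_zero]
      refine if_congr ?_ rfl rfl
      rw [G.mem_cut_iff _ e false]
      simp

theorem beta_hull (μ : G.V → ℝ) (W : Finset G.V) :
    P.graph.beta P.div (G.extendV P.exc μ) (G.hull P.exc W) = P.betaExc μ W := by
  rw [beta_eq, WGraph.oldPart_hull, (defect_eq_zero_iff _).2, add_zero]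
  intro e h b hb
  simp only [WGraph.oldV_mem_hull] at hb
  exact G.midV_mem_hull.2 ⟨b, hb⟩

theorem betaExc_univ (h : P.HasDegreeOf μ) : P.betaExc μ Finset.univ = 0 := by
  rw [hasDegreeOf_iff] at h
  rw [betaExc_formula, Finset.sum_sub_distrib, h]
  have : ∀ e : G.E, (if e ∈ P.exc then
      -((if G.src e ∈ Finset.univ then (1 : ℝ) else 0) +
        if G.tgt e ∈ Finset.univ then 1 else 0) / 2
      else if e ∈ G.cut Finset.univ then (1 / 2 : ℝ) else 0) = -(if e ∈ P.exc then 1 else 0) := by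
    intro e
    have : e ∉ G.cut Finset.univ := by rw [G.mem_cut_iff _ e false]; simp
    simp only [this, Finset.mem_univ, if_true, if_false]
    split_ifs <;> norm_num
  rw [Finset.sum_congr rfl fun e _ => this e]
  simp

/-- The number of non-exceptional edges between `A \ B` and `B \ A`. -/
def crossing (P : PseudoDiv G) (A B : Finset G.V) : ℝ :=
  ∑ e, if e ∈ P.exc then (0 : ℝ) else
    if ∃ b, (G.endp e b ∈ A ∧ G.endp e b ∉ B) ∧ (G.endp e !b) ∉ A ∧ (G.endp e !b) ∈ B then 1 else 0

/-- Vertex sums and end counts are modular. Only the cuts are not: an edge between `A \ B` and `B \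
A` counts 1/2 twice on the left and not at all on the right. -/
theorem betaExc_modular (μ : G.V → ℝ) (A B : Finset G.V) :
    P.betaExc μ A + P.betaExc μ B =
      P.betaExc μ (A ∩ B) + P.betaExc μ (A ∪ B) + P.crossing A B := by
  simp only [betaExc_formula]
  have h := Finset.sum_union_inter (s₁ := A) (s₂ := B)
    (f := fun v => (P.div (G.oldV P.exc v) : ℝ) - μ v)
  suffices H : (∑ e, if e ∈ P.exc then
        -((if G.src e ∈ A then 1 else 0) + if G.tgt e ∈ A then 1 else 0) / 2
        else if e ∈ G.cut A then (1 / 2 : ℝ) else 0) +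
      (∑ e, if e ∈ P.exc then
        -((if G.src e ∈ B then 1 else 0) + if G.tgt e ∈ B then 1 else 0) / 2
        else if e ∈ G.cut B then (1 / 2 : ℝ) else 0) =
      (∑ e, if e ∈ P.exc then
        -((if G.src e ∈ A ∩ B then 1 else 0) + if G.tgt e ∈ A ∩ B then 1 else 0) / 2
        else if e ∈ G.cut (A ∩ B) then (1 / 2 : ℝ) else 0) +
      (∑ e, if e ∈ P.exc then
        -((if G.src e ∈ A ∪ B then 1 else 0) + if G.tgt e ∈ A ∪ B then 1 else 0) / 2
        else if e ∈ G.cut (A ∪ B) then (1 / 2 : ℝ) else 0) + P.crossing A B by linarith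
  rw [crossing, ← Finset.sum_add_distrib, ← Finset.sum_add_distrib, ← Finset.sum_add_distrib]
  refine Finset.sum_congr rfl fun e _ => ?_
  simp only [G.mem_cut_iff _ e false, Finset.mem_inter, Finset.mem_union, Bool.exists_bool,
    WGraph.endp_false, WGraph.endp_true, Bool.not_false, Bool.not_true]
  by_cases h0 : e ∈ P.exc <;> by_cases h1 : G.src e ∈ A <;> by_cases h2 : G.tgt e ∈ A <;>
    by_cases h3 : G.src e ∈ B <;> by_cases h4 : G.tgt e ∈ B <;>
    simp only [h0, h1, h2, h3, h4] <;> norm_num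

theorem betaExc_add_compl (h : P.HasDegreeOf μ) (W : Finset G.V) :
    P.betaExc μ W + P.betaExc μ Wᶜ = ∑ e, if e ∈ P.exc then (0 : ℝ) else
      if e ∈ G.cut W then 1 else 0 := by
  have h0 : P.betaExc μ ∅ = 0 := by
    rw [betaExc_formula]
    simp [G.mem_cut_iff _ _ false]
  rw [betaExc_modular, Finset.inter_compl, Finset.union_compl, h0, betaExc_univ h, add_zero,
    zero_add, crossing]
  refine Finset.sum_congr rfl fun e _ => ?_
  refine if_congr Iff.rfl rfl (if_congr ?_ rfl rfl)
  rw [G.mem_cut_iff W e false]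
  simp only [Finset.mem_compl, Bool.exists_bool, Bool.not_true, Bool.not_false]
  tauto

/-- The invariants of `W` and its complement add up to the number of non-exceptional edges in the
cut. If there are none, two nonnegative numbers have sum zero. -/
theorem IsSemistable.betaExc_eq_zero (hP : P.IsSemistable μ) {W : Finset G.V}
    (hW : G.cut W ⊆ P.exc) : P.betaExc μ W = 0 := by
  have h := betaExc_add_compl hP.1 W
  rw [Finset.sum_eq_zero] at h
  · linarith [hP.2 W, hP.2 Wᶜ]
  · intro e _
    split_ifs with h1 h2
    exacts [rfl, absurd (hW h2) h1, rfl]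

theorem IsPolystable.isSemistable (hP : P.IsPolystable μ) : P.IsSemistable μ :=
  ⟨hP.1, fun W => (hP.2 W).1⟩

theorem IsPolystable.cut_subset (hP : P.IsPolystable μ) {W : Finset G.V}
    (hW : P.betaExc μ W = 0) : G.cut W ⊆ P.exc := by
  by_contra h
  exact ((hP.2 W).2 h).ne' hW

theorem IsSemistable.isPolystable (hP : P.IsSemistable μ)
    (h : ∀ W, P.betaExc μ W = 0 → G.cut W ⊆ P.exc) : P.IsPolystable μ :=
  ⟨hP.1, fun W => ⟨hP.2 W, fun hW => lt_of_le_of_ne (hP.2 W) fun h0 => hW (h W h0.symm)⟩⟩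

theorem IsQuasistable.isSemistable {v₀ : G.V} (hP : P.IsQuasistable μ v₀) : P.IsSemistable μ := by
  refine ⟨hP.1, fun W => ?_⟩
  by_cases h : G.hull P.exc W = Finset.univ
  · have : W = Finset.univ := by
      rw [← G.oldPart_hull (S := P.exc) W, h]
      ext v; simp
    rw [this, betaExc_univ hP.1]
  · rw [← beta_hull]
    exact (hP.2 _ h).1

theorem IsQuasistable.betaExc_pos {v₀ : G.V} (hP : P.IsQuasistable μ v₀) {W : Finset G.V}
    (hW : W ≠ Finset.univ) (hv : v₀ ∈ W) : 0 < P.betaExc μ W := by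
  rw [← beta_hull]
  refine (hP.2 _ ?_).2 (G.oldV_mem_hull.2 hv)
  intro h
  apply hW
  rw [← G.oldPart_hull (S := P.exc) W, h]
  ext v; simp

/-- A zero of the invariant on the subdivision forces both `betaExc` of the old part and the defect
to vanish. Vanishing defect puts into `Y` every exceptional vertex adjacent to it, so properness of
`Y` passes to its old part, and only sets of old vertices have to be tested. -/
theorem IsSemistable.isQuasistable {v₀ : G.V} (hP : P.IsSemistable μ)
    (h : ∀ W, W ≠ Finset.univ → v₀ ∈ W → P.betaExc μ W ≠ 0) : P.IsQuasistable μ v₀ := by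
  refine ⟨hP.1, fun Y hY => ?_⟩
  change 0 ≤ P.graph.beta P.div (G.extendV P.exc μ) Y ∧
    (G.oldV P.exc v₀ ∈ Y → 0 < P.graph.beta P.div (G.extendV P.exc μ) Y)
  have h1 := hP.2 (G.oldPart P.exc Y)
  have h2 := P.defect_nonneg Y
  rw [beta_eq]
  refine ⟨add_nonneg h1 h2, fun hv => lt_of_le_of_ne (add_nonneg h1 h2) fun h0 => ?_⟩
  have h3 : P.betaExc μ (G.oldPart P.exc Y) = 0 := by linarith
  have h4 := (defect_eq_zero_iff Y).1 (by linarith)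
  refine h _ (fun hu => hY ?_) (G.mem_oldPart.2 hv) h3
  have h5 : ∀ v, G.oldV P.exc v ∈ Y := fun v => G.mem_oldPart.1 (hu ▸ Finset.mem_univ v)
  ext v
  simp only [Finset.mem_univ, iff_true]
  obtain ⟨w, rfl⟩ | ⟨e, he, rfl⟩ := G.subdiv_V_cases _ v
  · exact h5 w
  · exact h4 e he false (h5 _)

end PseudoDiv

namespace Spec

variable {n : ℕ} {G H : WGraph n} (f : Spec G H)

/-- The preimage of a set of vertices under a specialization. -/
def pre (W : Finset H.V) : Finset G.V := Finset.univ.filter fun v => f.onV v ∈ W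

@[simp] theorem mem_pre {W : Finset H.V} {v : G.V} : v ∈ f.pre W ↔ f.onV v ∈ W := by
  simp [pre]

/-- A specialization may reverse the reference orientation of an edge; `ε` records whether it does.
-/
theorem exists_flip (e : H.E) :
    ∃ ε : Bool, ∀ b, H.endp e b = f.onV (G.endp (f.onE e) (b ^^ ε)) := by
  rcases f.src_eq_or e with ⟨h1, h2⟩ | ⟨h1, h2⟩
  · exact ⟨false, fun b => by cases b <;> simpa⟩
  · exact ⟨true, fun b => by cases b <;> simpa⟩

theorem onV_endp_of_notMem_range {e : G.E} (he : e ∉ Set.range f.onE) (b c : Bool) :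
    f.onV (G.endp e b) = f.onV (G.endp e c) := by
  have := f.onV_src_eq_onV_tgt e fun e' h => he ⟨e', h⟩
  cases b <;> cases c <;> simp [this]

theorem onE_mem_cut_pre {W : Finset H.V} {e : H.E} : f.onE e ∈ G.cut (f.pre W) ↔ e ∈ H.cut W := by
  obtain ⟨ε, h⟩ := f.exists_flip e
  rw [G.mem_cut_iff _ _ ε, H.mem_cut_iff W e false, h, h]
  simp

theorem mem_cut_pre {W : Finset H.V} {e : G.E} :
    e ∈ G.cut (f.pre W) ↔ ∃ e' ∈ H.cut W, f.onE e' = e := by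
  constructor
  · intro h
    by_cases he : e ∈ Set.range f.onE
    · obtain ⟨e', rfl⟩ := he
      exact ⟨e', f.onE_mem_cut_pre.1 h, rfl⟩
    · rw [G.mem_cut_iff _ _ false, mem_pre, mem_pre,
        f.onV_endp_of_notMem_range he false (!false)] at h
      tauto
  · rintro ⟨e', h, rfl⟩
    exact f.onE_mem_cut_pre.2 h

theorem sum_push {M : Type} [AddCommMonoid M] (D : G.V → M) (W : Finset H.V) :
    ∑ x ∈ W, f.push D x = ∑ v ∈ f.pre W, D v := by
  unfold push
  rw [← Finset.sum_fiberwise_of_maps_to (s := f.pre W) (t := W) (g := f.onV)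
    (fun v hv => f.mem_pre.1 hv)]
  refine Finset.sum_congr rfl fun x hx => Finset.sum_congr ?_ fun _ _ => rfl
  ext v
  simp only [Finset.mem_filter, Finset.mem_univ, true_and, mem_pre]
  constructor
  · rintro rfl; exact ⟨hx, rfl⟩
  · exact fun h => h.2

theorem sum_push_univ {M : Type} [AddCommMonoid M] (D : G.V → M) :
    ∑ x, f.push D x = ∑ v, D v := by
  rw [f.sum_push D Finset.univ]
  congr 1
  ext v; simp

theorem beta_push (D : G.V → ℤ) (μ : G.V → ℝ) (W : Finset H.V) :
    H.beta (f.push D) (f.push μ) W = G.beta D μ (f.pre W) := by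
  have h1 : (G.cut (f.pre W)) = (H.cut W).image f.onE := by
    ext e
    rw [f.mem_cut_pre, Finset.mem_image]
  unfold WGraph.beta
  rw [f.sum_push μ, h1, Finset.card_image_of_injective _ f.injective_onE]
  congr 2
  rw [← f.sum_push (fun v => (D v : ℝ))]
  refine Finset.sum_congr rfl fun x _ => ?_
  simp [push]

end Spec

end TropJac

end

/-! ### Specializations of subdivided graphs. -/

noncomputable section

namespace TropJac

namespace Spec

variable {n : ℕ} {G H : WGraph n} (k : Spec G H) (S : Finset G.E) (T : Finset H.E)
  (η : H.E → Bool)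

open Classical in
/-- The map on vertices of a specialization of subdivisions; see `Spec.subdiv`. -/
def subdivV : (G.subdiv S).V → (H.subdiv T).V :=
  Sum.elim (fun v => H.oldV T (k.onV v)) fun e =>
    -- An exceptional vertex survives if its edge stays exceptional. If its edge becomes ordinary,
    -- the vertex is merged into the end of the half that is not kept. If its edge is contracted,
    -- both ends have the same image and either may be used.
    if h : ∃ e' ∈ T, k.onE e' = e then H.midV T h.choose h.choose_spec.1
    else if h : ∃ e', k.onE e' = e then H.oldV T (k.onV (G.endp e !(η h.choose)))
    else H.oldV T (k.onV (G.src e))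

/-- The map on edges of a specialization of subdivisions; see `Spec.subdiv`. -/
def subdivE (hT : ∀ e ∈ T, k.onE e ∈ S) : (H.subdiv T).E → (G.subdiv S).E :=
  Sum.elim (fun e => if h : k.onE e ∈ S then G.halfE S _ h (η e) else G.oldE S _ h)
    -- On `T` the function `η` has a second role: it records whether the reference orientations of
    -- `e` and `k.onE e` disagree, which is the hypothesis `hη` of `Spec.subdiv`.
    fun p => G.halfE S (k.onE p.1.1) (hT _ p.1.2) (p.2 ^^ η p.1.1)

variable {S T} (hT : ∀ e ∈ T, k.onE e ∈ S)

@[simp] theorem subdivV_oldV (v : G.V) :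
    k.subdivV S T η (G.oldV S v) = H.oldV T (k.onV v) := rfl

theorem subdivV_midV_of_mem {e : H.E} (he : e ∈ T) (h : k.onE e ∈ S) :
    k.subdivV S T η (G.midV S (k.onE e) h) = H.midV T e he := by
  have h1 : ∃ e' ∈ T, k.onE e' = k.onE e := ⟨e, he, rfl⟩
  refine (dif_pos h1).trans (WGraph.midV_inj H |>.2 (k.injective_onE h1.choose_spec.2))

theorem subdivV_midV_of_notMem {e : H.E} (he : e ∉ T) (h : k.onE e ∈ S) :
    k.subdivV S T η (G.midV S (k.onE e) h) = H.oldV T (k.onV (G.endp (k.onE e) !(η e))) := by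
  have h1 : ¬ ∃ e' ∈ T, k.onE e' = k.onE e := by
    rintro ⟨e', h', h''⟩
    exact he (k.injective_onE h'' ▸ h')
  have h2 : ∃ e', k.onE e' = k.onE e := ⟨e, rfl⟩
  have h3 : h2.choose = e := k.injective_onE h2.choose_spec
  refine (dif_neg h1).trans ((dif_pos h2).trans ?_)
  rw [h3]

theorem subdivV_midV_of_notMem_range {e : G.E} (he : e ∉ Set.range k.onE) (h : e ∈ S) (b : Bool) :
    k.subdivV S T η (G.midV S e h) = H.oldV T (k.onV (G.endp e b)) := by
  have h1 : ¬ ∃ e' ∈ T, k.onE e' = e := by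
    rintro ⟨e', h', h''⟩
    exact he ⟨e', h''⟩
  refine (dif_neg h1).trans ((dif_neg fun ⟨e', h'⟩ => he ⟨e', h'⟩).trans ?_)
  exact congrArg _ (k.onV_endp_of_notMem_range he false b)

theorem subdivE_halfE {e : H.E} (he : e ∈ T) (b : Bool) :
    k.subdivE S T η hT (H.halfE T e he b) = G.halfE S (k.onE e) (hT e he) (b ^^ η e) := rfl

theorem subdivE_oldE_of_mem {e : H.E} (he : e ∉ T) (h : k.onE e ∈ S) :
    k.subdivE S T η hT (H.oldE T e he) = G.halfE S (k.onE e) h (η e) := dif_pos h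

theorem subdivE_oldE_of_notMem {e : H.E} (he : e ∉ T) (h : k.onE e ∉ S) :
    k.subdivE S T η hT (H.oldE T e he) = G.oldE S (k.onE e) h := dif_neg h

theorem under_subdivE (h : (H.subdiv T).E) :
    G.under S (k.subdivE S T η hT h) = k.onE (H.under T h) := by
  obtain ⟨e, he, rfl⟩ | ⟨e, he, b, rfl⟩ := H.subdiv_E_cases _ h
  · by_cases h' : k.onE e ∈ S
    · rw [k.subdivE_oldE_of_mem η hT he h']; rfl
    · rw [k.subdivE_oldE_of_notMem η hT he h']; rfl
  · rfl

theorem oldE_mem_range_subdivE {e : G.E} (he : e ∉ S) :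
    G.oldE S e he ∈ Set.range (k.subdivE S T η hT) ↔ e ∈ Set.range k.onE := by
  constructor
  · rintro ⟨h, hh⟩
    exact ⟨_, (k.under_subdivE η hT h).symm.trans (congrArg (G.under S) hh)⟩
  · rintro ⟨e', rfl⟩
    exact ⟨_, k.subdivE_oldE_of_notMem η hT (fun h => he (hT _ h)) he⟩

theorem halfE_notMem_range_subdivE {e : G.E} (he : e ∈ S) (b : Bool) (h : e ∉ Set.range k.onE) :
    G.halfE S e he b ∉ Set.range (k.subdivE S T η hT) := by
  rintro ⟨h', hh⟩
  exact h ⟨_, (k.under_subdivE η hT h').symm.trans (congrArg (G.under S) hh)⟩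

theorem halfE_mem_range_subdivE {e : H.E} (he : k.onE e ∈ S) (b : Bool) :
    G.halfE S (k.onE e) he b ∈ Set.range (k.subdivE S T η hT) ↔ e ∈ T ∨ b = η e := by
  constructor
  · rintro ⟨h', hh⟩
    have h1 := k.injective_onE ((k.under_subdivE η hT h').symm.trans (congrArg (G.under S) hh))
    obtain ⟨e', he', rfl⟩ | ⟨e', he', c, rfl⟩ := H.subdiv_E_cases _ h'
    · obtain rfl : e' = e := h1
      rw [k.subdivE_oldE_of_mem η hT he' he, WGraph.halfE_inj] at hh
      exact Or.inr hh.2.symm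
    · obtain rfl : e' = e := h1
      exact Or.inl he'
  · intro h
    by_cases h' : e ∈ T
    · refine ⟨H.halfE T e h' (b ^^ η e), ?_⟩
      rw [subdivE_halfE]
      simp
    · obtain rfl := h.resolve_left h'
      exact ⟨_, k.subdivE_oldE_of_mem η hT h' he⟩

theorem injective_subdivE : Function.Injective (k.subdivE S T η hT) := by
  intro h h' hh
  have h1 := congrArg (G.under S) hh
  rw [under_subdivE, under_subdivE] at h1
  have h2 := k.injective_onE h1
  obtain ⟨e, he, rfl⟩ | ⟨e, he, b, rfl⟩ := H.subdiv_E_cases _ h <;>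
  obtain ⟨e', he', rfl⟩ | ⟨e', he', b', rfl⟩ := H.subdiv_E_cases _ h'
  · exact H.oldE_inj.2 h2
  · obtain rfl : e = e' := h2
    exact absurd he' he
  · obtain rfl : e = e' := h2
    exact absurd he he'
  · obtain rfl : e = e' := h2
    rw [subdivE_halfE, subdivE_halfE, WGraph.halfE_inj] at hh
    rw [WGraph.halfE_inj]
    exact ⟨rfl, by simpa using hh.2⟩

theorem ends_subdivE
    (hη : ∀ e ∈ T, ∀ b, H.endp e b = k.onV (G.endp (k.onE e) (b ^^ η e)))
    (h : (H.subdiv T).E) : (H.subdiv T).ends h =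
    ((G.subdiv S).ends (k.subdivE S T η hT h)).map (k.subdivV S T η) := by
  obtain ⟨e, he, rfl⟩ | ⟨e, he, b, rfl⟩ := H.subdiv_E_cases _ h
  · by_cases h' : k.onE e ∈ S
    · rw [k.subdivE_oldE_of_mem η hT he h', WGraph.ends_halfE, Sym2.map_mk,
        k.subdivV_midV_of_notMem η he h', WGraph.ends_oldE, subdivV_oldV]
      have := (k.ends_eq e).trans (congrArg _ (G.ends_eq_endp (k.onE e) (η e)))
      exact congrArg (Sym2.map (H.oldV T)) this
    · rw [k.subdivE_oldE_of_notMem η hT he h', WGraph.ends_oldE, WGraph.ends_oldE]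
      exact congrArg (Sym2.map (H.oldV T)) (k.ends_eq e)
  · rw [k.subdivE_halfE η hT he, WGraph.ends_halfE, WGraph.ends_halfE, Sym2.map_mk,
      k.subdivV_midV_of_mem η he, subdivV_oldV, hη e he]

theorem subdivV_eq_of_notMem_range {h : (G.subdiv S).E}
    (hh : h ∉ Set.range (k.subdivE S T η hT)) :
    k.subdivV S T η ((G.subdiv S).src h) = k.subdivV S T η ((G.subdiv S).tgt h) := by
  obtain ⟨e, he, rfl⟩ | ⟨e, he, b, rfl⟩ := G.subdiv_E_cases _ h
  · rw [oldE_mem_range_subdivE] at hh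
    exact congrArg (H.oldV T) (k.onV_endp_of_notMem_range hh false true)
  · rw [WGraph.src_halfE, WGraph.tgt_halfE, subdivV_oldV]
    by_cases hr : e ∈ Set.range k.onE
    · obtain ⟨e', rfl⟩ := hr
      rw [halfE_mem_range_subdivE, not_or] at hh
      rw [k.subdivV_midV_of_notMem η hh.1]
      have : b = !(η e') := by
        have := hh.2
        revert this
        cases b <;> cases η e' <;> simp
      rw [this]
    · rw [k.subdivV_midV_of_notMem_range η hr he b]

theorem joined_oldV_of_onV_eq {v w : G.V} (h : k.onV v = k.onV w) :
    (G.subdiv S).Joined (Set.range (k.subdivE S T η hT))ᶜ (G.oldV S v) (G.oldV S w) := by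
  rw [k.fiber] at h
  induction h with
  | refl => exact Relation.ReflTransGen.refl
  | @tail p q _ hpq ih =>
    refine ih.trans ?_
    obtain ⟨e, he, hes⟩ := hpq
    obtain ⟨c, rfl, rfl⟩ := G.exists_endp_of_ends_eq hes
    by_cases hS : e ∈ S
    · have h1 := fun b => k.halfE_notMem_range_subdivE η hT hS b he
      refine (Relation.ReflTransGen.single ⟨_, h1 (!c), G.ends_halfE e hS (!c)⟩).tail
        ⟨_, h1 c, (G.ends_halfE e hS c).trans Sym2.eq_swap⟩
    · refine Relation.ReflTransGen.single ⟨_, mt (k.oldE_mem_range_subdivE η hT hS).1 he, ?_⟩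
      rw [(G.subdiv S).ends_eq_endp _ (!c)]
      simp

/-- This reduces the fibres on the subdivision to those of `k`: a surviving exceptional vertex is
alone in its fibre, and any other vertex is connected to an old one through a contracted half. -/
theorem joined_oldV_or (a : (G.subdiv S).V) :
    (∃ (e : H.E) (he : e ∈ T), a = G.midV S (k.onE e) (hT e he)) ∨
    ∃ v, k.subdivV S T η a = H.oldV T (k.onV v) ∧
      (G.subdiv S).Joined (Set.range (k.subdivE S T η hT))ᶜ a (G.oldV S v) := by
  obtain ⟨w, rfl⟩ | ⟨e, he, rfl⟩ := G.subdiv_V_cases _ a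
  · exact Or.inr ⟨w, rfl, Relation.ReflTransGen.refl⟩
  · by_cases hr : e ∈ Set.range k.onE
    · obtain ⟨e', rfl⟩ := hr
      by_cases h' : e' ∈ T
      · exact Or.inl ⟨e', h', rfl⟩
      · refine Or.inr ⟨_, k.subdivV_midV_of_notMem η h' he, Relation.ReflTransGen.single
          ⟨G.halfE S _ he (!(η e')), ?_, (G.ends_halfE _ he _).trans Sym2.eq_swap⟩⟩
        rw [Set.mem_compl_iff, halfE_mem_range_subdivE]
        simp [h']
    · exact Or.inr ⟨_, k.subdivV_midV_of_notMem_range η hr he false, Relation.ReflTransGen.single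
          ⟨_, k.halfE_notMem_range_subdivE η hT he false hr,
            (G.ends_halfE _ he _).trans Sym2.eq_swap⟩⟩

theorem fiber_subdiv (a b : (G.subdiv S).V) : k.subdivV S T η a = k.subdivV S T η b ↔
    (G.subdiv S).Joined (Set.range (k.subdivE S T η hT))ᶜ a b := by
  constructor
  · intro h
    obtain ⟨e, he, rfl⟩ | ⟨v, hv, hj⟩ := k.joined_oldV_or η hT a <;>
    obtain ⟨e', he', rfl⟩ | ⟨v', hv', hj'⟩ := k.joined_oldV_or η hT b
    · rw [k.subdivV_midV_of_mem η he, k.subdivV_midV_of_mem η he', WGraph.midV_inj] at h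
      subst h
      exact Relation.ReflTransGen.refl
    · rw [k.subdivV_midV_of_mem η he, hv'] at h
      exact absurd h H.midV_ne_oldV
    · rw [k.subdivV_midV_of_mem η he', hv] at h
      exact absurd h H.oldV_ne_midV
    · rw [hv, hv', WGraph.oldV_inj] at h
      exact (hj.trans (k.joined_oldV_of_onV_eq η hT h)).trans (WGraph.joined_symm _ hj')
  · intro h
    induction h with
    | refl => rfl
    | tail _ h ih =>
      obtain ⟨e, he, hes⟩ := h
      have h1 := k.subdivV_eq_of_notMem_range η hT he
      rcases Sym2.eq_iff.1 hes with ⟨h2, h3⟩ | ⟨h2, h3⟩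
      · rw [ih, ← h2, ← h3, h1]
      · rw [ih, ← h2, ← h3, h1]

/-- Over an old vertex, each exceptional vertex merged into the fibre brings exactly one additional
contracted edge, so the difference of edges and vertices is the same as for `k`. Over an exceptional
vertex, the fibre is a single vertex of weight zero without contracted edges. -/
theorem weight_subdiv (y : (H.subdiv T).V) :
    (H.subdiv T).weight y + (Finset.univ.filter fun v => k.subdivV S T η v = y).card =
    ∑ v with k.subdivV S T η v = y, (G.subdiv S).weight v +
      (Finset.univ.filter fun h => (∀ h', k.subdivE S T η hT h' ≠ h) ∧
        k.subdivV S T η ((G.subdiv S).src h) = y).card + 1 := by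
  have hr : ∀ h, (∀ h', k.subdivE S T η hT h' ≠ h) ↔ h ∉ Set.range (k.subdivE S T η hT) := by
    intro h; simp
  rw [Finset.card_filter, Finset.card_filter, Finset.sum_filter, G.sum_subdiv_V, G.sum_subdiv_V,
    G.sum_subdiv_E]
  simp only [hr]
  obtain ⟨x, rfl⟩ | ⟨e₀, he₀, rfl⟩ := H.subdiv_V_cases _ y
  · have hw := k.weight_eq x
    rw [Finset.card_filter, Finset.card_filter, Finset.sum_filter] at hw
    have e1 : ∀ e h, (if k.subdivV S T η (G.midV S e h) = H.oldV T x then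
        (G.subdiv S).weight (G.midV S e h) else 0) = 0 := by
      intro e h; split_ifs <;> rfl
    simp only [subdivV_oldV, WGraph.oldV_inj, e1]
    have key : (∑ e, if h : e ∈ S then
          (if k.subdivV S T η (G.midV S e h) = H.oldV T x then 1 else 0) else 0) +
        (∑ e, if (∀ e', k.onE e' ≠ e) ∧ k.onV (G.src e) = x then 1 else 0) =
        ∑ e, if h : e ∈ S then
          (if G.halfE S e h false ∉ Set.range (k.subdivE S T η hT) ∧
            k.subdivV S T η ((G.subdiv S).src (G.halfE S e h false)) = H.oldV T x
            then 1 else 0) +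
          (if G.halfE S e h true ∉ Set.range (k.subdivE S T η hT) ∧
            k.subdivV S T η ((G.subdiv S).src (G.halfE S e h true)) = H.oldV T x
            then 1 else 0)
          else if G.oldE S e h ∉ Set.range (k.subdivE S T η hT) ∧
            k.subdivV S T η ((G.subdiv S).src (G.oldE S e h)) = H.oldV T x then 1 else 0 := by
      rw [← Finset.sum_add_distrib]
      refine Finset.sum_congr rfl fun e _ => ?_
      by_cases hr : e ∈ Set.range k.onE
      · have h1 : ¬ ((∀ e', k.onE e' ≠ e) ∧ k.onV (G.src e) = x) := by
          obtain ⟨e', h'⟩ := hr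
          exact fun h => h.1 e' h'
        rw [if_neg h1, add_zero]
        by_cases hS : e ∈ S
        · simp only [hS, dite_true]
          obtain ⟨e', rfl⟩ := hr
          simp only [halfE_mem_range_subdivE, WGraph.src_halfE, subdivV_oldV, WGraph.oldV_inj]
          by_cases h' : e' ∈ T
          · rw [k.subdivV_midV_of_mem η h' hS]
            simp [h']
          · rw [k.subdivV_midV_of_notMem η h' hS]
            cases η e' <;> simp [h']
        · simp only [hS, dite_false]
          rw [if_neg fun h => h.1 ((k.oldE_mem_range_subdivE η hT hS).2 hr)]
      · have h1 : (∀ e', k.onE e' ≠ e) := fun e' h' => hr ⟨e', h'⟩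
        by_cases hS : e ∈ S
        · simp only [hS, dite_true]
          rw [k.subdivV_midV_of_notMem_range η hr hS false]
          have h2 := k.onV_endp_of_notMem_range hr false true
          have h3 := fun b => k.halfE_notMem_range_subdivE η hT hS b hr
          simp only [WGraph.endp_false, WGraph.endp_true] at h2
          simp only [WGraph.src_halfE, subdivV_oldV, WGraph.oldV_inj, WGraph.endp_true,
            WGraph.endp_false, h2, h1, h3, ne_eq, not_false_eq_true, implies_true, true_and]
        · simp only [hS, dite_false, zero_add]
          have h3 := mt (k.oldE_mem_range_subdivE η hT hS).1 hr
          have h4 : k.subdivV S T η ((G.subdiv S).src (G.oldE S e hS)) = H.oldV T x ↔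
            k.onV (G.src e) = x := H.oldV_inj
          simp only [h3, h4, h1, ne_eq, not_false_eq_true, implies_true, true_and]
    rw [← key]
    have hz : (∑ e : G.E, if h : e ∈ S then 0 else 0) = 0 := by simp
    have e2 : (H.subdiv T).weight (H.oldV T x) = H.weight x := rfl
    have e3 : ∀ v, (G.subdiv S).weight (G.oldV S v) = G.weight v := fun _ => rfl
    simp only [e2, e3]
    rw [hz]
    omega
  · have h1 : ∀ h, k.subdivV S T η ((G.subdiv S).src h) ≠ H.midV T e₀ he₀ := by
      intro h
      obtain ⟨e, he, rfl⟩ | ⟨e, he, b, rfl⟩ := G.subdiv_E_cases _ h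
      · exact H.oldV_ne_midV
      · exact H.oldV_ne_midV
    have h2 : ∀ e h, (k.subdivV S T η (G.midV S e h) = H.midV T e₀ he₀ ↔ e = k.onE e₀) := by
      intro e h
      constructor
      · intro h'
        by_cases hr : e ∈ Set.range k.onE
        · obtain ⟨e', rfl⟩ := hr
          by_cases hT' : e' ∈ T
          · rw [k.subdivV_midV_of_mem η hT', WGraph.midV_inj] at h'
            rw [h']
          · rw [k.subdivV_midV_of_notMem η hT'] at h'
            exact absurd h' H.oldV_ne_midV
        · rw [k.subdivV_midV_of_notMem_range η hr h false] at h'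
          exact absurd h' H.oldV_ne_midV
      · rintro rfl
        exact k.subdivV_midV_of_mem η he₀ h
    have e1 : ∀ e h, (if e = k.onE e₀ then
        (G.subdiv S).weight (G.midV S e h) else 0) = 0 := by
      intro e h; split_ifs <;> rfl
    simp only [h1, h2, and_false, if_false, subdivV_oldV, H.oldV_ne_midV, e1]
    have e2 : (H.subdiv T).weight (H.midV T e₀ he₀) = 0 := rfl
    have e3 : ∀ e : G.E, (if h : e ∈ S then if e = k.onE e₀ then 1 else 0 else 0) =
        if e = k.onE e₀ then 1 else 0 := by
      intro e
      by_cases h : e = k.onE e₀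
      · subst h; simp [hT e₀ he₀]
      · simp [h]
    simp [e2, e3]

/-- The specialization of subdivisions over a specialization `k` of graphs: the set `T` of edges of
the target becomes exceptional, and of an exceptional edge `k.onE e` with `e ∉ T` the half at the
end `η e` is kept. -/
def subdiv (hη : ∀ e ∈ T, ∀ b, H.endp e b = k.onV (G.endp (k.onE e) (b ^^ η e))) :
    Spec (G.subdiv S) (H.subdiv T) where
  onV := k.subdivV S T η
  onE := k.subdivE S T η hT
  surjective_onV y := by
    obtain ⟨x, rfl⟩ | ⟨e, he, rfl⟩ := H.subdiv_V_cases _ y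
    · obtain ⟨v, rfl⟩ := k.surjective_onV x
      exact ⟨G.oldV S v, rfl⟩
    · exact ⟨_, k.subdivV_midV_of_mem η he (hT e he)⟩
  injective_onE := k.injective_subdivE η hT
  ends_eq := k.ends_subdivE η hT hη
  fiber := k.fiber_subdiv η hT
  weight_eq := k.weight_subdiv η hT
  leg_eq i := congrArg (H.oldV T) (k.leg_eq i)

end Spec

end TropJac

end

/-! ### Specializations of triples: invariants, and determination by the contracted edges. -/

noncomputable section

namespace TropJac

namespace Triple

variable {n : ℕ} {A B C : Triple n}

namespace Hom

variable (f : A ⟶ B)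

theorem onV_oldV (v : A.G.V) :
    f.hat.onV (A.G.oldV A.pd.exc v) = B.G.oldV B.pd.exc (f.base.onV v) := f.onV_comm v

/-- Compatibility with `base` places the image over an exceptional edge of the source. Since old
vertices go to old vertices, the end of the image that maps to the exceptional vertex must be
exceptional. -/
theorem onE_halfE {e : B.G.E} (he : e ∈ B.pd.exc) (b : Bool) :
    ∃ b', f.hat.onE (B.G.halfE B.pd.exc e he b) =
        A.G.halfE A.pd.exc (f.base.onE e) (f.exc_subset e he) b' ∧
      B.G.endp e b = f.base.onV (A.G.endp (f.base.onE e) b') ∧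
      f.hat.onV (A.G.midV A.pd.exc (f.base.onE e) (f.exc_subset e he)) =
        B.G.midV B.pd.exc e he := by
  have hc := f.onE_comm (B.G.halfE B.pd.exc e he b)
  have hs := f.hat.ends_eq (B.G.halfE B.pd.exc e he b)
  obtain ⟨e', he', h⟩ | ⟨e', he', b', h⟩ :=
    A.G.subdiv_E_cases _ (f.hat.onE (B.G.halfE B.pd.exc e he b))
  · rw [h, WGraph.under_oldE, WGraph.under_halfE] at hc
    exact absurd (hc ▸ f.exc_subset e he) he'
  · rw [h] at hc hs
    obtain rfl : e' = f.base.onE e := hc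
    rw [WGraph.ends_halfE, WGraph.ends_halfE, Sym2.map_mk, onV_oldV] at hs
    rcases Sym2.eq_iff.1 hs with ⟨h1, h2⟩ | ⟨h1, h2⟩
    · exact ⟨b', h, B.G.oldV_inj.1 h1, h2.symm⟩
    · exact absurd h2 B.G.midV_ne_oldV

theorem eq_oldE_of_under {e : B.G.E} (he : e ∉ B.pd.exc) {h : B.graph.E}
    (hh : B.G.under B.pd.exc h = e) : h = B.G.oldE B.pd.exc e he := by
  obtain ⟨e', he', rfl⟩ | ⟨e', he', b', rfl⟩ := B.G.subdiv_E_cases _ h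
  · exact B.G.oldE_inj.2 hh
  · exact absurd (hh ▸ he') he

theorem onV_midV_of_notMem_range {e : A.G.E} (he : e ∈ A.pd.exc) {b : Bool}
    (h : A.G.halfE A.pd.exc e he b ∉ Set.range f.hat.onE) :
    f.hat.onV (A.G.midV A.pd.exc e he) = B.G.oldV B.pd.exc (f.base.onV (A.G.endp e b)) := by
  have := f.hat.onV_src_eq_onV_tgt _ fun e' h' => h ⟨e', h'⟩
  rw [WGraph.src_halfE, WGraph.tgt_halfE, onV_oldV] at this
  exact this.symm

/-- Only one edge of the target lies over `e`, so exactly one of the two halves is kept. -/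
theorem onE_oldE_of_mem {e : B.G.E} (he : e ∉ B.pd.exc) (h : f.base.onE e ∈ A.pd.exc) :
    ∃ b, f.hat.onE (B.G.oldE B.pd.exc e he) = A.G.halfE A.pd.exc (f.base.onE e) h b ∧
      A.G.halfE A.pd.exc (f.base.onE e) h (!b) ∉ Set.range f.hat.onE := by
  have hc := f.onE_comm (B.G.oldE B.pd.exc e he)
  obtain ⟨e', he', h'⟩ | ⟨e', he', b', h'⟩ :=
    A.G.subdiv_E_cases _ (f.hat.onE (B.G.oldE B.pd.exc e he))
  · rw [h', WGraph.under_oldE, WGraph.under_oldE] at hc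
    exact absurd (hc ▸ h) he'
  · rw [h'] at hc
    obtain rfl : e' = f.base.onE e := hc
    refine ⟨b', h', ?_⟩
    rintro ⟨k, hk⟩
    have h1 := f.onE_comm k
    rw [hk] at h1
    have h2 := eq_oldE_of_under he (f.base.injective_onE h1.symm)
    rw [h2, h', WGraph.halfE_inj] at hk
    simp at hk

theorem onE_oldE_of_notMem {e : B.G.E} (he : e ∉ B.pd.exc) (h : f.base.onE e ∉ A.pd.exc) :
    f.hat.onE (B.G.oldE B.pd.exc e he) = A.G.oldE A.pd.exc (f.base.onE e) h :=
  eq_oldE_of_under h (f.onE_comm (B.G.oldE B.pd.exc e he))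

theorem under_mem_range {h : A.graph.E} (hh : h ∈ Set.range f.hat.onE) :
    A.G.under A.pd.exc h ∈ Set.range f.base.onE := by
  obtain ⟨k, rfl⟩ := hh
  exact ⟨_, (f.onE_comm k).symm⟩

theorem halfE_mem_range {e : B.G.E} (he : e ∈ B.pd.exc) (h : f.base.onE e ∈ A.pd.exc) (b : Bool) :
    A.G.halfE A.pd.exc (f.base.onE e) h b ∈ Set.range f.hat.onE := by
  obtain ⟨b₀, h0, -⟩ := f.onE_halfE he false
  obtain ⟨b₁, h1, -⟩ := f.onE_halfE he true
  have hne : b₀ ≠ b₁ := by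
    rintro rfl
    have := f.hat.injective_onE (h0.trans h1.symm)
    rw [WGraph.halfE_inj] at this
    simp at this
  have : b = b₀ ∨ b = b₁ := by
    revert hne
    cases b <;> cases b₀ <;> cases b₁ <;> simp
  rcases this with rfl | rfl
  exacts [⟨_, h0⟩, ⟨_, h1⟩]

theorem oldE_mem_range {e : A.G.E} (he : e ∉ A.pd.exc) :
    A.G.oldE A.pd.exc e he ∈ Set.range f.hat.onE ↔ e ∈ Set.range f.base.onE := by
  constructor
  · exact fun h => f.under_mem_range h
  · rintro ⟨e', rfl⟩
    exact ⟨_, f.onE_oldE_of_notMem (fun h => he (f.exc_subset _ h)) he⟩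

/-- An exceptional vertex either stays exceptional, or it is merged into an end-vertex along a
contracted half. -/
theorem midV_cases {e : A.G.E} (he : e ∈ A.pd.exc) :
    (∃ e' h', f.base.onE e' = e ∧
      f.hat.onV (A.G.midV A.pd.exc e he) = B.G.midV B.pd.exc e' h') ∨
    ∃ b, A.G.halfE A.pd.exc e he b ∉ Set.range f.hat.onE := by
  by_cases h : A.G.halfE A.pd.exc e he false ∈ Set.range f.hat.onE
  · obtain ⟨e', rfl⟩ : e ∈ Set.range f.base.onE := f.under_mem_range h
    by_cases h' : e' ∈ B.pd.exc
    · obtain ⟨b, -, -, h2⟩ := f.onE_halfE h' false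
      exact Or.inl ⟨e', h', rfl, h2⟩
    · obtain ⟨b, -, h2⟩ := f.onE_oldE_of_mem h' he
      exact Or.inr ⟨_, h2⟩
  · exact Or.inr ⟨_, h⟩

theorem midV_mem_hull {e : A.G.E} (he : e ∈ A.pd.exc) (W : Finset B.G.V) :
    f.hat.onV (A.G.midV A.pd.exc e he) ∈ B.G.hull B.pd.exc W ↔
      (∃ b, f.base.onV (A.G.endp e b) ∈ W) ∧
      ∀ b, A.G.halfE A.pd.exc e he b ∉ Set.range f.hat.onE → f.base.onV (A.G.endp e b) ∈ W := by
  obtain ⟨e', h', rfl, h⟩ | ⟨b, hb⟩ := f.midV_cases he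
  · rw [h, WGraph.midV_mem_hull]
    constructor
    · rintro ⟨b, hb⟩
      obtain ⟨b', -, h2, -⟩ := f.onE_halfE h' b
      exact ⟨⟨b', h2 ▸ hb⟩, fun c hc => absurd (f.halfE_mem_range h' he c) hc⟩
    · rintro ⟨⟨b, hb⟩, -⟩
      obtain ⟨ε, hε⟩ := f.base.exists_flip e'
      refine ⟨b ^^ ε, ?_⟩
      rw [hε]
      simpa using hb
  · rw [f.onV_midV_of_notMem_range he hb, WGraph.oldV_mem_hull]
    constructor
    · refine fun h => ⟨⟨b, h⟩, fun c hc => ?_⟩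
      have := (f.onV_midV_of_notMem_range he hb).symm.trans (f.onV_midV_of_notMem_range he hc)
      rw [WGraph.oldV_inj] at this
      rwa [← this]
    · exact fun h => h.2 b hb

theorem ext_of_onE {f f' : A ⟶ B} (h1 : f.base = f'.base) (h2 : f.hat.onE = f'.hat.onE) :
    f = f' := by
  refine Hom.ext h1 (Spec.ext (funext fun v => ?_) h2)
  obtain ⟨w, rfl⟩ | ⟨e, he, rfl⟩ := A.G.subdiv_V_cases _ v
  · rw [onV_oldV, onV_oldV, h1]
  · obtain ⟨e', h', rfl, h⟩ | ⟨b, hb⟩ := f.midV_cases he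
    · obtain ⟨-, -, -, h4⟩ := f'.onE_halfE h' false
      rw [h, ← h4]
      congr 1
      rw [WGraph.midV_inj, h1]
    · rw [f.onV_midV_of_notMem_range he hb, f'.onV_midV_of_notMem_range he (h2 ▸ hb), h1]

theorem push_extendV (μ : A.G.V → ℝ) : f.hat.push (A.G.extendV A.pd.exc μ) =
    B.G.extendV B.pd.exc (f.base.push μ) := by
  funext y
  unfold Spec.push
  rw [Finset.sum_filter, A.G.sum_subdiv_V]
  simp only [WGraph.extendV_oldV, WGraph.extendV_midV, ite_self, dite_eq_ite, Finset.sum_const_zero,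
    add_zero, onV_oldV]
  obtain ⟨x, rfl⟩ | ⟨e, he, rfl⟩ := B.G.subdiv_V_cases _ y
  · simp only [WGraph.oldV_inj, WGraph.extendV_oldV, Finset.sum_filter]
  · simp

theorem beta_eq (μ : A.G.V → ℝ) (Y : Finset B.graph.V) :
    B.graph.beta B.pd.div (B.G.extendV B.pd.exc (f.base.push μ)) Y =
      A.graph.beta A.pd.div (A.G.extendV A.pd.exc μ) (f.hat.pre Y) := by
  rw [f.div_eq, ← push_extendV, Spec.beta_push]

/-- The preimage of a hull need not be a hull: an exceptional vertex with one end over `W` is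
missing from it if it is merged into an end that is not over `W`. The defect counts this. As it is
nonnegative, specialization preserves semistability. -/
theorem betaExc_eq (μ : A.G.V → ℝ) (W : Finset B.G.V) :
    B.pd.betaExc (f.base.push μ) W = A.pd.betaExc μ (f.base.pre W) +
      A.pd.defect (f.hat.pre (B.G.hull B.pd.exc W)) := by
  rw [← PseudoDiv.beta_hull, beta_eq, PseudoDiv.beta_eq]
  congr 2
  ext v
  simp [onV_oldV]

theorem hasDegreeOf {μ : A.G.V → ℝ} (h : A.pd.HasDegreeOf μ) :
    B.pd.HasDegreeOf (f.base.push μ) := by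
  unfold PseudoDiv.HasDegreeOf at h ⊢
  rw [f.base.sum_push_univ, ← h, f.div_eq, ← f.hat.sum_push_univ]
  refine Finset.sum_congr rfl fun x _ => ?_
  simp [Spec.push]

theorem isSemistable {μ : A.G.V → ℝ} (h : A.pd.IsSemistable μ) :
    B.pd.IsSemistable (f.base.push μ) :=
  ⟨f.hasDegreeOf h.1, fun W => by
    rw [betaExc_eq]
    exact add_nonneg (h.2 _) (PseudoDiv.defect_nonneg _)⟩

theorem isQuasistable {μ : A.G.V → ℝ} {v₀ : A.G.V} (h : A.pd.IsQuasistable μ v₀) :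
    B.pd.IsQuasistable (f.base.push μ) (f.base.onV v₀) := by
  refine ⟨f.hasDegreeOf h.1, fun Y hY => ?_⟩
  have := h.2 (f.hat.pre Y) (by
    intro hu
    apply hY
    ext y
    obtain ⟨v, rfl⟩ := f.hat.surjective_onV y
    rw [← Spec.mem_pre, hu]
    simp)
  have h1 := f.beta_eq μ Y
  change 0 ≤ B.graph.beta B.pd.div (B.G.extendV B.pd.exc (f.base.push μ)) Y ∧
    (B.G.oldV B.pd.exc (f.base.onV v₀) ∈ Y →
      0 < B.graph.beta B.pd.div (B.G.extendV B.pd.exc (f.base.push μ)) Y)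
  rw [h1]
  refine ⟨this.1, fun hv => this.2 (f.hat.mem_pre.2 ?_)⟩
  rwa [← f.onV_oldV] at hv

/-- Where the invariant of the target of a specialization vanishes. -/
theorem betaExc_eq_zero_iff {μ : A.G.V → ℝ} (h : A.pd.IsSemistable μ) (W : Finset B.G.V) :
    B.pd.betaExc (f.base.push μ) W = 0 ↔ A.pd.betaExc μ (f.base.pre W) = 0 ∧
      ∀ e he b, A.G.endp e b ∈ f.base.pre W →
        ∀ c, A.G.halfE A.pd.exc e he c ∉ Set.range f.hat.onE →
          A.G.endp e c ∈ f.base.pre W := by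
  have h1 : A.pd.defect (f.hat.pre (B.G.hull B.pd.exc W)) = 0 ↔
      ∀ e he b, A.G.endp e b ∈ f.base.pre W →
        ∀ c, A.G.halfE A.pd.exc e he c ∉ Set.range f.hat.onE →
          A.G.endp e c ∈ f.base.pre W := by
    rw [PseudoDiv.defect_eq_zero_iff]
    simp only [Spec.mem_pre, onV_oldV, WGraph.oldV_mem_hull, midV_mem_hull]
    exact ⟨fun H e he b hb => (H e he b hb).2, fun H e he b hb => ⟨⟨b, hb⟩, H e he b hb⟩⟩
  rw [betaExc_eq, ← h1]
  have h2 := h.2 (f.base.pre W)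
  have h3 := A.pd.defect_nonneg (f.hat.pre (B.G.hull B.pd.exc W))
  constructor
  · intro h; constructor <;> linarith
  · rintro ⟨h4, h5⟩; rw [h4, h5, add_zero]

theorem isPolystable {μ : A.G.V → ℝ} (h : A.pd.IsPolystable μ)
    (hf : ∀ e, f.base.onE e ∈ A.pd.exc → e ∈ B.pd.exc) :
    B.pd.IsPolystable (f.base.push μ) := by
  refine (f.isSemistable h.isSemistable).isPolystable fun W hW e he => ?_
  have := ((f.betaExc_eq_zero_iff h.isSemistable W).1 hW).1
  exact hf e (h.cut_subset this (f.base.onE_mem_cut_pre.2 he))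

end Hom

end Triple

namespace Spec

variable {n : ℕ} {G H K : WGraph n}

/-- Two specializations of a graph that contract the same edges differ by an isomorphism. -/
theorem exists_comp_eq (p : Spec G H) (f : Spec G K) (h : Set.range p.onE = Set.range f.onE) :
    ∃ q : Spec H K, p.comp q = f := by
  have hV : ∀ a b, p.onV a = p.onV b ↔ f.onV a = f.onV b := by
    intro a b
    rw [p.fiber, f.fiber, h]
  let s := Function.surjInv p.surjective_onV
  have hs : ∀ v, f.onV (s (p.onV v)) = f.onV v := fun v =>
    (hV _ _).1 (Function.surjInv_eq p.surjective_onV _)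
  have hE : ∀ e, ∃ e', p.onE e' = f.onE e := fun e => by
    have : f.onE e ∈ Set.range p.onE := h ▸ ⟨e, rfl⟩
    exact this
  choose t ht using hE
  have htS : Function.Surjective t := by
    intro e'
    have : p.onE e' ∈ Set.range f.onE := h ▸ ⟨e', rfl⟩
    obtain ⟨e, he⟩ := this
    exact ⟨e, p.injective_onE ((ht e).trans he)⟩
  have hinj : Function.Injective fun x => f.onV (s x) := by
    intro x y hxy
    have := (hV _ _).2 hxy
    rwa [Function.surjInv_eq p.surjective_onV, Function.surjInv_eq p.surjective_onV] at this
  refine ⟨⟨fun x => f.onV (s x), t, ?_, ?_, ?_, ?_, ?_, ?_⟩, ?_⟩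
  · intro y
    obtain ⟨v, rfl⟩ := f.surjective_onV y
    exact ⟨p.onV v, hs v⟩
  · intro e e' hh
    apply f.injective_onE
    rw [← ht, ← ht, hh]
  · intro e
    rw [f.ends_eq, p.ends_eq, Sym2.map_map, ht]
    exact Sym2.map_congr fun v _ => (hs v).symm
  · intro x y
    rw [htS.range_eq, Set.compl_univ]
    constructor
    · intro h
      rw [hinj h]
      exact Relation.ReflTransGen.refl
    · intro h
      induction h with
      | refl => rfl
      | tail _ h _ => exact h.choose_spec.1.elim
  · intro y
    obtain ⟨v, rfl⟩ := f.surjective_onV y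
    have h1 : ∀ x, f.onV (s x) = f.onV v ↔ x = p.onV v := fun x => by
      rw [← hs v]; exact hinj.eq_iff
    have h2 : (Finset.univ.filter fun e => (∀ e', t e' ≠ e) ∧ H.src e = p.onV v) = ∅ := by
      refine Finset.filter_eq_empty_iff.2 fun e _ h => ?_
      obtain ⟨e', he'⟩ := htS e
      exact h.1 e' he'
    simp only [h1, h2, Finset.filter_eq', Finset.mem_univ, if_true, Finset.card_singleton,
      Finset.sum_singleton, Finset.card_empty]
    have w1 := f.weight_eq (f.onV v)
    have w2 := p.weight_eq (p.onV v)
    have h3 : ∀ e, (∀ e', p.onE e' ≠ e) ↔ ∀ e', f.onE e' ≠ e := by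
      intro e
      have := Set.ext_iff.1 h e
      simp only [Set.mem_range] at this
      simpa using not_congr this
    simp only [hV, h3] at w2
    omega
  · intro i
    rw [p.leg_eq, hs, f.leg_eq]
  · exact Spec.ext (funext hs) (funext ht)

theorem comp_left_cancel (p : Spec G H) {q q' : Spec H K} (h : p.comp q = p.comp q') : q = q' := by
  refine Spec.ext (funext fun x => ?_) (funext fun e => ?_)
  · obtain ⟨v, rfl⟩ := p.surjective_onV x
    exact congrFun (congrArg Spec.onV h) v
  · exact p.injective_onE (congrFun (congrArg Spec.onE h) e)

end Spec

namespace Triple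

variable {n : ℕ} {A B C : Triple n}

/-- The edges contracted by `hat` determine those contracted by `base`, so a specialization of
triples is governed by the range of `hat.onE` alone. -/
theorem Hom.range_base (f : A ⟶ B) :
    Set.range f.base.onE = A.G.under A.pd.exc '' Set.range f.hat.onE := by
  ext e
  constructor
  · rintro ⟨e', rfl⟩
    by_cases h : e' ∈ B.pd.exc
    · exact ⟨_, ⟨B.G.halfE _ e' h false, rfl⟩, f.onE_comm _⟩
    · exact ⟨_, ⟨B.G.oldE _ e' h, rfl⟩, f.onE_comm _⟩
  · rintro ⟨_, ⟨h, rfl⟩, rfl⟩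
    exact ⟨_, (f.onE_comm h).symm⟩

theorem exists_comp_eq (p : A ⟶ B) (f : A ⟶ C) (h : Set.range p.hat.onE = Set.range f.hat.onE) :
    ∃ q : B ⟶ C, p ≫ q = f := by
  obtain ⟨qb, hb⟩ := p.base.exists_comp_eq f.base (by rw [p.range_base, f.range_base, h])
  obtain ⟨qh, hh⟩ := p.hat.exists_comp_eq f.hat h
  have hbE : ∀ e, p.base.onE (qb.onE e) = f.base.onE e := fun e => congrFun (congrArg Spec.onE hb) e
  have hhE : ∀ e, p.hat.onE (qh.onE e) = f.hat.onE e := fun e => congrFun (congrArg Spec.onE hh) e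
  have hu : ∀ e, B.G.under B.pd.exc (qh.onE e) = qb.onE (C.G.under C.pd.exc e) := by
    intro e
    apply p.base.injective_onE
    rw [hbE, ← p.onE_comm, hhE, f.onE_comm]
  refine ⟨⟨qb, qh, ?_, ?_, hu, ?_⟩, Hom.ext hb hh⟩
  · intro e he
    by_contra h'
    have h0 := Hom.eq_oldE_of_under h' (hu (C.G.halfE _ e he false))
    have h1 := Hom.eq_oldE_of_under h' (hu (C.G.halfE _ e he true))
    have := qh.injective_onE (h0.trans h1.symm)
    rw [WGraph.halfE_inj] at this
    simp at this
  · intro x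
    obtain ⟨v, rfl⟩ := p.base.surjective_onV x
    have h1 : qb.onV (p.base.onV v) = f.base.onV v := congrFun (congrArg Spec.onV hb) v
    have h2 := congrFun (congrArg Spec.onV hh) (A.G.oldV _ v)
    rw [h1]
    change qh.onV (p.hat.onV _) = _ at h2
    rw [p.onV_oldV, f.onV_oldV] at h2
    exact h2
  · rw [f.div_eq, ← hh, Spec.push_comp, ← p.div_eq]

theorem comp_left_cancel (p : A ⟶ B) {q q' : B ⟶ C} (h : p ≫ q = p ≫ q') : q = q' :=
  Hom.ext (p.base.comp_left_cancel (congrArg Hom.base h))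
    (p.hat.comp_left_cancel (congrArg Hom.hat h))

/-- Two specializations of a triple that contract the same edges differ by an isomorphism. -/
theorem exists_iso_of_range_eq (p : A ⟶ B) (f : A ⟶ C)
    (h : Set.range p.hat.onE = Set.range f.hat.onE) : ∃ i : B ≅ C, p ≫ i.hom = f := by
  obtain ⟨q, hq⟩ := exists_comp_eq p f h
  obtain ⟨r, hr⟩ := exists_comp_eq f p h.symm
  refine ⟨⟨q, r, comp_left_cancel p ?_, comp_left_cancel f ?_⟩, hq⟩
  · rw [← Category.assoc, hq, hr, Category.comp_id]
  · rw [← Category.assoc, hr, hq, Category.comp_id]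

end Triple

end TropJac

end

/-! ### Contractions of graphs and triples, and preservation of stability. -/

noncomputable section

namespace TropJac

namespace WGraph

variable {n : ℕ} (G : WGraph n) (S : Finset G.E)

/-- The equivalence relation of being joined by edges in `S`. -/
def joinedSetoid : Setoid G.V where
  r := G.Joined (S : Set G.E)
  iseqv := ⟨fun _ => Relation.ReflTransGen.refl, G.joined_symm, fun h h' => h.trans h'⟩

/-- A connected graph has at most one vertex more than it has edges; this is applied to the simple
graph that `S` induces on a class. It guarantees that the natural-number subtraction in the weight
of `contract` is never truncated. -/
theorem card_joined_class_le [DecidableEq (Quotient (G.joinedSetoid S))]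
    (x : Quotient (G.joinedSetoid S)) :
    (Finset.univ.filter fun v => Quotient.mk _ v = x).card ≤
      (Finset.univ.filter fun e => e ∈ S ∧ Quotient.mk (G.joinedSetoid S) (G.src e) = x).card
        + 1 := by
  classical
  let F := {v : G.V // Quotient.mk (G.joinedSetoid S) v = x}
  let K : SimpleGraph F :=
    { Adj := fun a b => a ≠ b ∧ ∃ e ∈ S, G.ends e = s(a.1, b.1)
      symm := ⟨fun a b h => ⟨h.1.symm, by
        obtain ⟨e, he, h⟩ := h.2
        exact ⟨e, he, h.trans Sym2.eq_swap⟩⟩⟩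
      loopless := ⟨fun a h => h.1 rfl⟩ }
  obtain ⟨v₀, hv₀⟩ := Quotient.exists_rep x
  have hmk : ∀ a b, G.Joined (S : Set G.E) a b →
      Quotient.mk (G.joinedSetoid S) a = Quotient.mk (G.joinedSetoid S) b :=
    fun a b h => Quotient.sound h
  have hreach : ∀ v (hv : Quotient.mk (G.joinedSetoid S) v = x), K.Reachable ⟨v₀, hv₀⟩ ⟨v, hv⟩ := by
    intro v hv
    have hj : G.Joined (S : Set G.E) v₀ v := Quotient.exact (hv₀.trans hv.symm)
    induction hj with
    | refl => exact SimpleGraph.Reachable.refl _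
    | @tail b c h1 h2 ih =>
      have hb : Quotient.mk (G.joinedSetoid S) b = x := (hmk _ _ h1).symm.trans hv₀
      refine (ih hb).trans ?_
      by_cases hbc : b = c
      · subst hbc; exact SimpleGraph.Reachable.refl _
      · refine SimpleGraph.Adj.reachable ⟨fun h => hbc (congrArg Subtype.val h), ?_⟩
        obtain ⟨e, he, h⟩ := h2
        exact ⟨e, he, h⟩
  have hconn : K.Connected := by
    have : Nonempty F := ⟨⟨v₀, hv₀⟩⟩
    exact ⟨fun a b => (hreach a.1 a.2).symm.trans (hreach b.1 b.2)⟩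
  have h1 := hconn.card_vert_le_card_edgeSet_add_one
  have h2 : Nat.card F = (Finset.univ.filter fun v => Quotient.mk (G.joinedSetoid S) v = x).card := by
    rw [Nat.card_eq_fintype_card, Fintype.card_subtype]
  have h3 : ∀ z : K.edgeSet, ∃ e ∈ S, G.ends e = z.1.map Subtype.val := by
    rintro ⟨z, hz⟩
    induction z with
    | _ a b =>
      exact hz.2
  choose c hcS hc using h3
  have h4 : Nat.card K.edgeSet ≤
      Nat.card {e // e ∈ S ∧ Quotient.mk (G.joinedSetoid S) (G.src e) = x} := by
    refine Nat.card_le_card_of_injective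
      (fun z => ⟨c z, hcS z, ?_⟩) ?_
    · have h5 := hc z
      obtain ⟨⟨z, hz⟩, hzz⟩ : ∃ w, w = z := ⟨z, rfl⟩
      rw [← hzz] at h5 ⊢
      have h6 : G.src (c ⟨z, hz⟩) ∈ z.map Subtype.val := by
        rw [← h5]; exact Sym2.mem_mk_left _ _
      obtain ⟨w, -, hw⟩ := Sym2.mem_map.1 h6
      rw [← hw]
      exact w.2
    · intro z z' h
      have h5 : c z = c z' := congrArg Subtype.val h
      have h6 := (hc z).symm.trans ((congrArg G.ends h5).trans (hc z'))
      exact Subtype.ext (Sym2.map.injective Subtype.val_injective h6)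
  have h5 : Nat.card {e // e ∈ S ∧ Quotient.mk (G.joinedSetoid S) (G.src e) = x} =
      (Finset.univ.filter fun e =>
        e ∈ S ∧ Quotient.mk (G.joinedSetoid S) (G.src e) = x).card := by
    rw [Nat.card_eq_fintype_card, Fintype.card_subtype]
  omega

open Classical in
/-- The contraction of the edges in `S`. -/
def contract : WGraph n where
  V := Quotient (G.joinedSetoid S)
  E := {e // e ∉ S}
  src e := Quotient.mk _ (G.src e)
  tgt e := Quotient.mk _ (G.tgt e)
  weight x := ∑ v with Quotient.mk (G.joinedSetoid S) v = x, G.weight v +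
    (Finset.univ.filter fun e => e ∈ S ∧ Quotient.mk (G.joinedSetoid S) (G.src e) = x).card + 1 -
    (Finset.univ.filter fun v => Quotient.mk (G.joinedSetoid S) v = x).card
  leg i := Quotient.mk _ (G.leg i)

/-- The specialization to the contraction of the edges in `S`. -/
def contractSpec : Spec G (G.contract S) where
  onV := Quotient.mk (G.joinedSetoid S)
  onE e := e.1
  surjective_onV := Quotient.mk_surjective
  injective_onE := Subtype.val_injective
  ends_eq _ := rfl
  fiber a b := by
    have : (Set.range fun e : (G.contract S).E => e.1)ᶜ = (S : Set G.E) := by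
      ext e
      simp only [Set.mem_compl_iff, Set.mem_range, not_exists, SetLike.mem_coe]
      constructor
      · intro h
        by_contra he
        exact h ⟨e, he⟩ rfl
      · rintro h ⟨e', he'⟩ rfl
        exact he' h
    rw [this]
    exact ⟨Quotient.exact, fun h => Quotient.sound h⟩
  weight_eq x := by
    classical
    have h1 : ∀ e, (∀ e' : (G.contract S).E, e'.1 ≠ e) ↔ e ∈ S := by
      intro e
      constructor
      · intro h
        by_contra he
        exact h ⟨e, he⟩ rfl
      · rintro h ⟨e', he'⟩ rfl
        exact he' h
    have h2 : (Finset.univ.filter fun v => Quotient.mk (G.joinedSetoid S) v = x).card ≤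
        (Finset.univ.filter fun e => e ∈ S ∧ Quotient.mk (G.joinedSetoid S) (G.src e) = x).card
          + 1 := by
      convert G.card_joined_class_le S x
    have h3 : (G.contract S).weight x = ∑ v with Quotient.mk (G.joinedSetoid S) v = x, G.weight v +
      (Finset.univ.filter fun e =>
        e ∈ S ∧ Quotient.mk (G.joinedSetoid S) (G.src e) = x).card + 1 -
      (Finset.univ.filter fun v => Quotient.mk (G.joinedSetoid S) v = x).card := by
      unfold contract
      congr!
    have e1 : (Finset.univ.filter fun e => (∀ e' : (G.contract S).E, e'.1 ≠ e) ∧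
        Quotient.mk (G.joinedSetoid S) (G.src e) = x).card = (Finset.univ.filter fun e =>
        e ∈ S ∧ Quotient.mk (G.joinedSetoid S) (G.src e) = x).card := by
      congr 1
      ext e
      simp only [h1, Finset.mem_filter]
    have e2 : (G.contract S).weight x +
        (Finset.univ.filter fun v => Quotient.mk (G.joinedSetoid S) v = x).card =
        ∑ v with Quotient.mk (G.joinedSetoid S) v = x, G.weight v +
        (Finset.univ.filter fun e => (∀ e' : (G.contract S).E, e'.1 ≠ e) ∧
          Quotient.mk (G.joinedSetoid S) (G.src e) = x).card + 1 := by
      omega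
    convert e2 <;> exact Iff.rfl
  leg_eq _ := rfl

theorem range_contractSpec : Set.range (G.contractSpec S).onE = (S : Set G.E)ᶜ := by
  ext e
  constructor
  · rintro ⟨e', rfl⟩; exact e'.2
  · intro h; exact ⟨⟨e, h⟩, rfl⟩

theorem endp_contract (e : (G.contract S).E) (b : Bool) :
    (G.contract S).endp e b = (G.contractSpec S).onV (G.endp ((G.contractSpec S).onE e) b) := by
  cases b <;> rfl

end WGraph

/-! ### Stability of specializations -/

namespace WGraph

variable {n : ℕ} (G : WGraph n)

theorem IsConnected.b0_eq {G : WGraph n} (h : G.IsConnected) : G.b0 = 1 := by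
  unfold b0
  rw [Nat.card_eq_one_iff_unique]
  obtain ⟨⟨v⟩, hj⟩ := h
  refine ⟨⟨fun a b => ?_⟩, ⟨Quot.mk _ v⟩⟩
  induction a using Quot.ind with | _ a =>
  induction b using Quot.ind with | _ b =>
  have := hj a b
  induction this with
  | refl => rfl
  | tail _ h ih =>
    obtain ⟨e, -, he⟩ := h
    exact ih.trans (Quot.sound ⟨e, he⟩)

end WGraph

namespace Spec

variable {n : ℕ} {G H : WGraph n} (f : Spec G H)

theorem isConnected (f : Spec G H) (h : G.IsConnected) : H.IsConnected := by
  refine ⟨h.1.map f.onV, fun a b => ?_⟩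
  obtain ⟨v, rfl⟩ := f.surjective_onV a
  obtain ⟨w, rfl⟩ := f.surjective_onV b
  exact f.joined_map _ (h.2 v w)

theorem sum_E {M : Type} [AddCommMonoid M] (F : G.E → M) :
    ∑ e, F e = ∑ e, F (f.onE e) + ∑ e with ∀ e', f.onE e' ≠ e, F e := by
  rw [← Finset.sum_filter_add_sum_filter_not Finset.univ (fun e => ∀ e', f.onE e' ≠ e), add_comm]
  congr 1
  rw [← Finset.sum_image (g := f.onE) (f := F) fun a _ b _ h => f.injective_onE h]
  refine Finset.sum_congr ?_ fun _ _ => rfl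
  ext e
  simp

/-- The weight formula, summed over all vertices of `H`, balances the change of the weights against
the change in the numbers of edges and vertices. Connectedness fixes the number of components to be
one on both sides. -/
theorem genus_eq (f : Spec G H) (hG : G.IsConnected) : H.genus = G.genus := by
  have h1 : ∑ x, (H.weight x + (Finset.univ.filter fun v => f.onV v = x).card) =
      ∑ x, (∑ v with f.onV v = x, G.weight v +
      (Finset.univ.filter fun e => (∀ e', f.onE e' ≠ e) ∧ f.onV (G.src e) = x).card + 1) :=
    Finset.sum_congr rfl fun x _ => f.weight_eq x
  rw [Finset.sum_add_distrib, Finset.sum_add_distrib, Finset.sum_add_distrib] at h1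
  have h2 : ∑ x, (Finset.univ.filter fun v => f.onV v = x).card = Fintype.card G.V :=
    (Finset.card_eq_sum_card_fiberwise (fun _ _ => Finset.mem_univ _)).symm
  have h3 : ∑ x, ∑ v with f.onV v = x, G.weight v = ∑ v, G.weight v :=
    Finset.sum_fiberwise _ _ _
  have h4 : ∑ x, (Finset.univ.filter fun e => (∀ e', f.onE e' ≠ e) ∧ f.onV (G.src e) = x).card =
      (Finset.univ.filter fun e => ∀ e', f.onE e' ≠ e).card := by
    rw [Finset.card_eq_sum_card_fiberwise (f := fun e => f.onV (G.src e)) (t := Finset.univ)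
      fun _ _ => Finset.mem_coe.2 (Finset.mem_univ _)]
    simp only [Finset.filter_filter]
  have h5 := f.sum_E (fun _ => 1)
  simp only [Finset.sum_const, Finset.card_univ, smul_eq_mul, mul_one] at h5 h1
  rw [h2, h3, h4] at h1
  unfold WGraph.genus WGraph.b1
  rw [hG.b0_eq, (f.isConnected hG).b0_eq, ← Nat.cast_sum, ← Nat.cast_sum]
  omega

/-- By the weight formula, the number 2w - 2 + deg + legs at a vertex of `H` is the sum of these
numbers over its fibre: a contracted edge adds two to the sum of the degrees and one to the weight.
A nonempty sum of positive numbers is positive. -/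
theorem isStable (f : Spec G H) {g : ℕ} (hG : G.IsStable g) : H.IsStable g := by
  refine ⟨f.isConnected hG.1, (f.genus_eq hG.1).trans hG.2.1, fun x => ?_⟩
  obtain ⟨v₀, hv₀⟩ := f.surjective_onV x
  have hpos : 0 < ∑ v with f.onV v = x,
      (2 * (G.weight v : ℤ) - 2 + G.degIn Finset.univ v + G.legs v) :=
    Finset.sum_pos (fun v _ => hG.2.2 v) ⟨v₀, by simpa using hv₀⟩
  refine lt_of_lt_of_eq hpos ?_
  have hw := f.weight_eq x
  have hlegs : H.legs x = ∑ v with f.onV v = x, G.legs v := by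
    unfold WGraph.legs
    rw [Finset.card_eq_sum_card_fiberwise (f := G.leg)
      (t := Finset.univ.filter fun v => f.onV v = x)]
    · refine Finset.sum_congr rfl fun v hv => ?_
      congr 1
      ext i
      simp only [Finset.mem_filter, Finset.mem_univ, true_and, f.leg_eq] at hv ⊢
      constructor
      · exact fun h => h.2
      · rintro rfl; exact ⟨hv, rfl⟩
    · intro i hi
      simpa [f.leg_eq] using hi
  have hdeg : ∑ v with f.onV v = x, G.degIn Finset.univ v = H.degIn Finset.univ x +
      2 * (Finset.univ.filter fun e => (∀ e', f.onE e' ≠ e) ∧ f.onV (G.src e) = x).card := by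
    have e1 : ∑ v with f.onV v = x, G.degIn Finset.univ v =
        ∑ e, ((if f.onV (G.src e) = x then 1 else 0) + if f.onV (G.tgt e) = x then 1 else 0) := by
      have := G.sum_degIn Finset.univ (Finset.univ.filter fun v => f.onV v = x)
      simp only [Finset.mem_filter, Finset.mem_univ, true_and] at this
      exact_mod_cast this
    rw [e1, f.sum_E]
    congr 1
    · unfold WGraph.degIn
      rw [Finset.card_filter, Finset.card_filter, ← Finset.sum_add_distrib]
      refine Finset.sum_congr rfl fun e _ => ?_
      rcases f.src_eq_or e with ⟨h1, h2⟩ | ⟨h1, h2⟩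
      · rw [h1, h2]
      · rw [h1, h2, add_comm]
    · rw [← Finset.filter_filter, Finset.card_filter, Finset.mul_sum]
      refine Finset.sum_congr rfl fun e he => ?_
      rw [← f.onV_src_eq_onV_tgt e (Finset.mem_filter.1 he).2]
      split_ifs <;> rfl
  rw [hlegs, Finset.sum_add_distrib, Finset.sum_add_distrib, Finset.sum_sub_distrib,
    ← Finset.mul_sum, Finset.sum_const, nsmul_eq_mul, ← Nat.cast_sum, ← Nat.cast_sum,
    ← Nat.cast_sum, hdeg]
  push_cast
  have : ((H.weight x : ℤ)) + (Finset.univ.filter fun v => f.onV v = x).card =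
    ∑ v with f.onV v = x, (G.weight v : ℤ) +
      (Finset.univ.filter fun e => (∀ e', f.onE e' ≠ e) ∧ f.onV (G.src e) = x).card + 1 := by
    exact_mod_cast hw
  linarith

end Spec

/-! ### Contractions of triples -/

namespace Triple

variable {n : ℕ} {A B : Triple n}

/-- The specialization of triples given by a specialization of subdivisions. -/
def Hom.ofSubdiv (k : Spec A.G B.G) (η : B.G.E → Bool) (hT : ∀ e ∈ B.pd.exc, k.onE e ∈ A.pd.exc)
    (hη : ∀ e ∈ B.pd.exc, ∀ b, B.G.endp e b = k.onV (A.G.endp (k.onE e) (b ^^ η e)))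
    (hdiv : B.pd.div = (k.subdiv η hT hη).push A.pd.div) : A ⟶ B where
  base := k
  hat := k.subdiv η hT hη
  exc_subset := hT
  onV_comm _ := rfl
  onE_comm := k.under_subdivE η hT
  div_eq := hdiv

end Triple

namespace Spec

variable {n : ℕ} {G H : WGraph n} (k : Spec G H) (P : PseudoDiv G) (T : Finset H.E)
  (η : H.E → Bool) (hT : ∀ e ∈ T, k.onE e ∈ P.exc)
  (hη : ∀ e ∈ T, ∀ b, H.endp e b = k.onV (G.endp (k.onE e) (b ^^ η e)))

theorem push_subdiv_midV (e : H.E) (he : e ∈ T) :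
    (k.subdiv η hT hη).push P.div (H.midV T e he) = -1 := by
  have : (Finset.univ.filter fun v => (k.subdiv η hT hη).onV v = H.midV T e he) =
      {G.midV P.exc (k.onE e) (hT e he)} := by
    ext v
    simp only [Finset.mem_filter, Finset.mem_univ, true_and, Finset.mem_singleton]
    constructor
    · intro h
      obtain ⟨e', he', rfl⟩ | ⟨v, hv, -⟩ := k.joined_oldV_or η hT v
      · have := (k.subdivV_midV_of_mem η he' (hT _ he')).symm.trans h
        rw [WGraph.midV_inj] at this
        subst this; rfl
      · exact absurd (hv.symm.trans h) H.oldV_ne_midV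
    · rintro rfl
      exact k.subdivV_midV_of_mem η he (hT e he)
  unfold push
  rw [this, Finset.sum_singleton, PseudoDiv.div_midV]

/-- The pushforward of a pseudo-divisor along a specialization of subdivisions. -/
def pushPD : PseudoDiv H where
  exc := T
  div := (k.subdiv η hT hη).push P.div
  div_exc e := k.push_subdiv_midV P T η hT hη e.1 e.2

end Spec

namespace Triple

variable {n : ℕ} {A B : Triple n}

/-- A specialization over an orientation preserving specialization `k` of graphs, with a given set
of contracted edges. -/
theorem exists_hom_of_range (A : Triple n) {H : WGraph n} (k : Spec A.G H)
    (hk : ∀ e b, H.endp e b = k.onV (A.G.endp (k.onE e) b)) (Z : Set A.graph.E)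
    (hZ : ∀ e, e ∈ Set.range k.onE ↔ ∃ h, A.G.under A.pd.exc h = e ∧ h ∉ Z) :
    ∃ (P : PseudoDiv H) (f : A ⟶ ⟨H, P⟩), f.base = k ∧ Set.range f.hat.onE = Zᶜ ∧
      ∀ e (he : e ∈ P.exc), ∃ he' : k.onE e ∈ A.pd.exc, ∀ b,
        f.hat.onE (H.halfE P.exc e he b) = A.G.halfE A.pd.exc (k.onE e) he' b := by
  classical
  -- An edge stays exceptional if neither of its halves is in `Z`. Otherwise `η` names the half to
  -- be kept: the `true` half if the `false` half is in `Z`, and the `false` half if not. By `hZ`,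
  -- at least one half of a surviving edge is outside `Z`.
  let T : Finset H.E := Finset.univ.filter fun e =>
    ∃ he : k.onE e ∈ A.pd.exc, ∀ b, A.G.halfE A.pd.exc _ he b ∉ Z
  let η : H.E → Bool := fun e =>
    decide (∃ he : k.onE e ∈ A.pd.exc, A.G.halfE A.pd.exc _ he false ∈ Z)
  have hTmem : ∀ e, e ∈ T ↔ ∃ he : k.onE e ∈ A.pd.exc, ∀ b, A.G.halfE A.pd.exc _ he b ∉ Z := by
    intro e; simp [T]
  have hT : ∀ e ∈ T, k.onE e ∈ A.pd.exc := fun e he => ((hTmem e).1 he).1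
  have hη0 : ∀ e ∈ T, η e = false := by
    intro e he
    obtain ⟨h1, h2⟩ := (hTmem e).1 he
    simp only [η, decide_eq_false_iff_not, not_exists]
    exact fun _ => h2 false
  have hη : ∀ e ∈ T, ∀ b, H.endp e b = k.onV (A.G.endp (k.onE e) (b ^^ η e)) := by
    intro e he b
    rw [hη0 e he, hk]
    simp
  refine ⟨k.pushPD A.pd T η hT hη, Hom.ofSubdiv (B := ⟨H, k.pushPD A.pd T η hT hη⟩) k η hT hη rfl,
    rfl, ?_, ?_⟩
  · ext h
    rw [Set.mem_compl_iff]
    obtain ⟨e, he, rfl⟩ | ⟨e, he, b, rfl⟩ := A.G.subdiv_E_cases _ h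
    · refine (k.oldE_mem_range_subdivE η hT he).trans ((hZ e).trans ⟨?_, fun h => ⟨_, rfl, h⟩⟩)
      rintro ⟨h, hu, hh⟩
      rwa [Hom.eq_oldE_of_under he hu] at hh
    · by_cases hr : e ∈ Set.range k.onE
      · obtain ⟨e', rfl⟩ := hr
        refine (k.halfE_mem_range_subdivE η hT he b).trans ?_
        have h1 : ∃ c, A.G.halfE A.pd.exc _ he c ∉ Z := by
          obtain ⟨h, hu, hh⟩ := (hZ _).1 ⟨e', rfl⟩
          obtain ⟨e₁, he₁, rfl⟩ | ⟨e₁, he₁, c, rfl⟩ := A.G.subdiv_E_cases _ h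
          · exact absurd (show e₁ = _ from hu) fun h => he₁ (h ▸ he)
          · obtain rfl : e₁ = _ := hu
            exact ⟨c, hh⟩
        have h2 : η e' = true ↔ A.G.halfE A.pd.exc _ he false ∈ Z := by
          simp [η, he]
        have h3 : e' ∈ T ↔ ∀ b, A.G.halfE A.pd.exc _ he b ∉ Z := by
          rw [hTmem]; simp [he]
        rw [h3]
        rw [Bool.exists_bool] at h1
        rw [Bool.forall_bool]
        cases hh : η e' <;> rw [hh] at h2 <;> cases b <;> simp at h2 ⊢ <;> tauto
      · refine iff_of_false (k.halfE_notMem_range_subdivE η hT he b hr) fun h => hr ?_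
        exact (hZ e).2 ⟨_, rfl, h⟩
  · intro e he
    refine ⟨hT e he, fun b => (k.subdivE_halfE η hT he b).trans ?_⟩
    rw [hη0 e he]
    simp

/-- The contraction of an arbitrary set of edges of the graph of a triple. -/
theorem exists_contract (A : Triple n) (Z : Set A.graph.E) :
    ∃ (B : Triple n) (f : A ⟶ B), Set.range f.hat.onE = Zᶜ := by
  classical
  let S : Finset A.G.E := Finset.univ.filter fun e => ∀ h, A.G.under A.pd.exc h = e → h ∈ Z
  obtain ⟨P, f, -, h, -⟩ := A.exists_hom_of_range (A.G.contractSpec S) (A.G.endp_contract S) Z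
    (by
      intro e
      rw [WGraph.range_contractSpec]
      simp [S])
  exact ⟨_, f, h⟩

end Triple

end TropJac

end

/-! ### Potentials modulo the cut space, reachability, and its relation to quasistability. -/

noncomputable section

namespace TropJac

namespace WGraph

variable {n : ℕ} (G : WGraph n) (S : Finset G.E)

/-- The vector in `ℝ^{E(Γ^S)}` defined by a function on the vertices. -/
def delta : (G.V → ℝ) →ₗ[ℝ] ((G.subdiv S).E → ℝ) where
  toFun φ := Sum.elim (fun _ => 0) fun h => φ (G.endp h.1 h.2) - φ (G.endp h.1 !h.2)
  map_add' φ ψ := by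
    funext h
    obtain h | h := h
    · exact (add_zero _).symm
    · exact add_sub_add_comm _ _ _ _
  map_smul' c φ := by
    funext h
    obtain h | h := h
    · exact (mul_zero _).symm
    · exact (mul_sub _ _ _).symm

@[simp] theorem delta_oldE (φ : G.V → ℝ) (e : G.E) (h : e ∉ S) :
    G.delta S φ (G.oldE S e h) = 0 := rfl

@[simp] theorem delta_halfE (φ : G.V → ℝ) (e : G.E) (h : e ∈ S) (b : Bool) :
    G.delta S φ (G.halfE S e h b) = φ (G.endp e b) - φ (G.endp e !b) := rfl

theorem cutVector_eq_delta (W : Finset G.V) :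
    G.cutVector S W = G.delta S fun v => if v ∈ W then 1 else 0 := by
  funext h
  obtain ⟨e, he, rfl⟩ | ⟨e, he, b, rfl⟩ := G.subdiv_E_cases _ h
  · rfl
  · rw [delta_halfE]
    change (if e ∈ G.cut W then (if G.endp e b ∈ W then (1 : ℝ) else -1) else 0) = _
    have := G.mem_cut_iff W e b
    by_cases h1 : G.endp e b ∈ W <;> by_cases h2 : (G.endp e !b) ∈ W <;> simp [this, h1, h2]

/-- The vector `u_W` is the coboundary of the indicator function of `W`, and the condition on the
cut says that this function does not jump along edges outside `S`. Conversely, a potential is the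
combination of the indicators of its level sets, weighted by its values. -/
theorem mem_cutSpace_iff (x : (G.subdiv S).E → ℝ) : x ∈ G.cutSpace S ↔
    ∃ φ : G.V → ℝ, (∀ e ∉ S, φ (G.src e) = φ (G.tgt e)) ∧ x = G.delta S φ := by
  constructor
  · intro h
    induction h using Submodule.span_induction with
    | mem x hx =>
      obtain ⟨W, hW, rfl⟩ := hx
      refine ⟨_, fun e he => ?_, G.cutVector_eq_delta S W⟩
      have := G.mem_cut_iff W e false
      refine if_congr ?_ rfl rfl
      have h1 := mt (@hW e) he
      rw [this, endp_false, Bool.not_false, endp_true] at h1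
      tauto
    | zero => exact ⟨0, fun _ _ => rfl, (map_zero _).symm⟩
    | add x y _ _ hx hy =>
      obtain ⟨φ, hφ, rfl⟩ := hx
      obtain ⟨ψ, hψ, rfl⟩ := hy
      exact ⟨φ + ψ, fun e he => congrArg₂ (· + ·) (hφ e he) (hψ e he), (map_add _ _ _).symm⟩
    | smul c x _ hx =>
      obtain ⟨φ, hφ, rfl⟩ := hx
      exact ⟨c • φ, fun e he => congrArg (c * ·) (hφ e he), (map_smul _ _ _).symm⟩
  · rintro ⟨φ, hφ, rfl⟩
    classical
    have h1 : φ = ∑ t ∈ Finset.univ.image φ, t • fun v =>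
        if v ∈ Finset.univ.filter fun w => φ w = t then (1 : ℝ) else 0 := by
      funext v
      rw [Finset.sum_apply]
      simp
    rw [h1, map_sum]
    refine Submodule.sum_mem _ fun t _ => ?_
    rw [map_smul]
    refine Submodule.smul_mem _ _ (Submodule.subset_span ⟨_, ?_, (G.cutVector_eq_delta S _).symm⟩)
    intro e he
    by_contra hS
    rw [G.mem_cut_iff _ e false] at he
    simp [hφ e hS] at he

variable {S}

/-- A step from `a` to `b`: along an edge outside `S`, or along an edge in `S` of which the half at
`b` belongs to `Z`. -/
def Step (Z : Set (G.subdiv S).E) (a b : G.V) : Prop :=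
  (∃ e ∉ S, G.ends e = s(a, b)) ∨
    ∃ e he c, G.endp e c = b ∧ (G.endp e !c) = a ∧ G.halfE S e he c ∈ Z

/-- Reachability by steps. -/
def Reach (Z : Set (G.subdiv S).E) : G.V → G.V → Prop := Relation.ReflTransGen (G.Step Z)

variable {G}

theorem Reach.mono {Z Z' : Set (G.subdiv S).E} (hZ : Z ⊆ Z') {a b : G.V} (h : G.Reach Z a b) :
    G.Reach Z' a b := by
  refine Relation.ReflTransGen.mono ?_ _ _ h
  rintro p q (h | ⟨e, he, c, h1, h2, h3⟩)
  exacts [Or.inl h, Or.inr ⟨e, he, c, h1, h2, hZ h3⟩]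

theorem eq_of_ends_eq {φ : G.V → ℝ} (hφ : ∀ e ∉ S, φ (G.src e) = φ (G.tgt e)) {e : G.E}
    (he : e ∉ S) {a b : G.V} (h : G.ends e = s(a, b)) : φ a = φ b := by
  rcases Sym2.eq_iff.1 h with ⟨rfl, rfl⟩ | ⟨rfl, rfl⟩
  exacts [hφ e he, (hφ e he).symm]

/-- The coordinate of `delta φ` at the half next to the final vertex of a step is the increment of
`φ` along this step. -/
theorem le_of_reach {φ : G.V → ℝ} (hφ : ∀ e ∉ S, φ (G.src e) = φ (G.tgt e))
    {Z : Set (G.subdiv S).E} (hZ : ∀ h ∈ Z, G.delta S φ h ≤ 0) {a b : G.V} (h : G.Reach Z a b) :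
    φ b ≤ φ a := by
  induction h with
  | refl => exact le_rfl
  | tail _ h ih =>
    rcases h with ⟨e, he, h⟩ | ⟨e, he, c, rfl, rfl, h⟩
    · exact (eq_of_ends_eq hφ he h).symm.le.trans ih
    · have := hZ _ h
      rw [delta_halfE] at this
      linarith

/-- A class modulo the cut space has at most one representative in the orthant which vanishes on
enough halves of edges for all vertices to be reachable. -/
theorem eq_of_reach {x y : (G.subdiv S).E → ℝ} (hx : x ∈ orthant _) (hy : y ∈ orthant _)
    (h : x - y ∈ G.cutSpace S) {v₀ : G.V} (rx : ∀ v, G.Reach {h | x h = 0} v₀ v)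
    (ry : ∀ v, G.Reach {h | y h = 0} v₀ v) : x = y := by
  obtain ⟨φ, hφ, hxy⟩ := (G.mem_cutSpace_iff S _).1 h
  -- With `delta φ = x - y`: where `x` vanishes the coboundary equals `-y ≤ 0`, so `φ` cannot
  -- increase along the paths available for `x`. The paths available for `y` give the same for `-φ`,
  -- and `φ` is constant.
  have h1 : ∀ v, φ v ≤ φ v₀ := fun v => le_of_reach hφ (fun h hh => by
    rw [← hxy, Pi.sub_apply, hh]
    linarith [hy h]) (rx v)
  have h2 : ∀ v, φ v₀ ≤ φ v := fun v => by
    have := le_of_reach (φ := -φ) (fun e he => congrArg Neg.neg (hφ e he)) (fun h hh => by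
      rw [map_neg, ← hxy, Pi.neg_apply, Pi.sub_apply, hh]
      linarith [hx h]) (ry v)
    simpa using this
  have h3 : ∀ v, φ v = φ v₀ := fun v => le_antisymm (h1 v) (h2 v)
  rw [← sub_eq_zero, hxy]
  funext h
  obtain ⟨e, he, rfl⟩ | ⟨e, he, b, rfl⟩ := G.subdiv_E_cases _ h
  · rfl
  · rw [delta_halfE, h3, h3 (G.endp e !b), sub_self]; rfl

theorem exists_pos_le {ι : Type} [Fintype ι] (x : ι → ℝ) : ∃ ε > 0, ∀ i, 0 < x i → ε ≤ x i := by
  classical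
  by_cases h : (Finset.univ.filter fun i => 0 < x i).Nonempty
  · refine ⟨(Finset.univ.filter fun i => 0 < x i).inf' h x, ?_, fun i hi =>
      Finset.inf'_le _ (by simpa using hi)⟩
    rw [gt_iff_lt, Finset.lt_inf'_iff]
    intro i hi
    simpa using hi
  · refine ⟨1, one_pos, fun i hi => absurd ⟨i, ?_⟩ h⟩
    simpa using hi

/-- The potentials `φ` with `φ v₀ = 0` for which `x + delta φ` lies in the orthant. -/
def Feasible (x : (G.subdiv S).E → ℝ) (v₀ : G.V) (φ : G.V → ℝ) : Prop :=
  (∀ e ∉ S, φ (G.src e) = φ (G.tgt e)) ∧ φ v₀ = 0 ∧ x + G.delta S φ ∈ orthant _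

/-- Nonnegativity at the half next to the second vertex bounds the drop of `φ` along an exceptional
edge by the length of that half. The bounds add up along a path from `v₀`. -/
theorem Feasible.bddBelow (hG : G.IsConnected) (x : (G.subdiv S).E → ℝ) (v₀ v : G.V) :
    ∃ c, ∀ φ, Feasible x v₀ φ → c ≤ φ v := by
  have hj := hG.2 v₀ v
  induction hj with
  | refl => exact ⟨0, fun φ h => h.2.1.ge⟩
  | tail _ h ih =>
    obtain ⟨c, hc⟩ := ih
    obtain ⟨e, -, h⟩ := h
    by_cases he : e ∈ S
    · obtain ⟨b, rfl, rfl⟩ := G.exists_endp_of_ends_eq h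
      refine ⟨c - x (G.halfE S e he b), fun φ hφ => ?_⟩
      have h1 := hφ.2.2 (G.halfE S e he b)
      rw [Pi.add_apply, delta_halfE] at h1
      linarith [hc φ hφ]
    · exact ⟨c, fun φ hφ => (hc φ hφ).trans (eq_of_ends_eq hφ.1 he h).le⟩

/-- Every class in the image of the orthant has a representative in the orthant for which all
vertices are reachable. -/
theorem exists_reach (hG : G.IsConnected) {x : (G.subdiv S).E → ℝ} (hx : x ∈ orthant _)
    (v₀ : G.V) : ∃ φ : G.V → ℝ, (∀ e ∉ S, φ (G.src e) = φ (G.tgt e)) ∧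
      x + G.delta S φ ∈ orthant _ ∧ ∀ v, G.Reach {h | (x + G.delta S φ) h = 0} v₀ v := by
  classical
  let F := {φ // Feasible x v₀ φ}
  have h0 : Feasible x v₀ 0 := ⟨fun _ _ => rfl, rfl, by rwa [map_zero, add_zero]⟩
  have : Nonempty F := ⟨⟨0, h0⟩⟩
  -- The constraints bound `φ` at one end of an edge below by its value at the other end plus a
  -- constant, or equate the two. They are stable under pointwise infima, so there is a least
  -- feasible potential.
  let φ : G.V → ℝ := fun v => ⨅ ψ : F, ψ.1 v
  have hbdd : ∀ v, BddBelow (Set.range fun ψ : F => ψ.1 v) := by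
    intro v
    obtain ⟨c, hc⟩ := Feasible.bddBelow hG x v₀ v
    exact ⟨c, by rintro _ ⟨ψ, rfl⟩; exact hc _ ψ.2⟩
  have hle : ∀ (ψ : F) v, φ v ≤ ψ.1 v := fun ψ v => ciInf_le (hbdd v) ψ
  have hφ : Feasible x v₀ φ := by
    refine ⟨fun e he => ?_, ?_, fun h => ?_⟩
    · exact iInf_congr fun ψ => ψ.2.1 e he
    · exact (iInf_congr fun ψ : F => ψ.2.2.1).trans ciInf_const
    · obtain ⟨e, he, rfl⟩ | ⟨e, he, b, rfl⟩ := G.subdiv_E_cases _ h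
      · rw [Pi.add_apply, delta_oldE, add_zero]
        exact hx _
      · rw [Pi.add_apply, delta_halfE]
        have : φ (G.endp e !b) - x (G.halfE S e he b) ≤ φ (G.endp e b) := by
          refine le_ciInf fun ψ => ?_
          have h1 := ψ.2.2.2 (G.halfE S e he b)
          rw [Pi.add_apply, delta_halfE] at h1
          linarith [hle ψ (G.endp e !b)]
        linarith
  refine ⟨φ, hφ.1, hφ.2.2, ?_⟩
  by_contra hreach
  push Not at hreach
  obtain ⟨v, hv⟩ := hreach
  let Z := {h | (x + G.delta S φ) h = 0}
  obtain ⟨ε, hε, hmin⟩ := exists_pos_le (x + G.delta S φ)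
  -- Lowering the potential by `ε` on the unreachable vertices decreases only coordinates at the
  -- unreachable ends of edges whose other end is reachable. Such a coordinate is nonzero, since
  -- otherwise it would allow a step, hence is at least `ε`. Thus `ψ` is feasible and contradicts
  -- minimality.
  let ψ : G.V → ℝ := fun w => if G.Reach Z v₀ w then φ w else φ w - ε
  have hstep : ∀ {a b}, G.Reach Z v₀ a → G.Step Z a b → G.Reach Z v₀ b := fun h h' => h.tail h'
  have hψ : Feasible x v₀ ψ := by
    refine ⟨fun e he => ?_, ?_, fun h => ?_⟩
    · have : G.Reach Z v₀ (G.src e) ↔ G.Reach Z v₀ (G.tgt e) :=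
        ⟨fun h => hstep h (Or.inl ⟨e, he, rfl⟩), fun h => hstep h (Or.inl ⟨e, he, Sym2.eq_swap⟩)⟩
      simp only [ψ, this, hφ.1 e he]
    · simp only [ψ, hφ.2.1]
      exact if_pos Relation.ReflTransGen.refl
    · obtain ⟨e, he, rfl⟩ | ⟨e, he, b, rfl⟩ := G.subdiv_E_cases _ h
      · rw [Pi.add_apply, delta_oldE, add_zero]
        exact hx _
      · have h1 := hφ.2.2 (G.halfE S e he b)
        have h2 := hmin (G.halfE S e he b)
        have h3 : (x + G.delta S φ) (G.halfE S e he b) = 0 → G.Reach Z v₀ (G.endp e !b) →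
            G.Reach Z v₀ (G.endp e b) := fun h h' => hstep h' (Or.inr ⟨e, he, b, rfl, rfl, h⟩)
        rw [Pi.add_apply, delta_halfE] at h1 h2 h3 ⊢
        by_cases hb : G.Reach Z v₀ (G.endp e b) <;> by_cases hb' : G.Reach Z v₀ (G.endp e !b) <;>
          simp only [ψ, hb, hb', if_true, if_false] at h3 ⊢
        · exact h1
        · linarith
        · have h4 := h2 (lt_of_le_of_ne h1 fun h => h3 h.symm trivial)
          linarith
        · linarith
  have h1 := hle ⟨ψ, hψ⟩ v
  have h2 : ψ v = φ v - ε := if_neg hv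
  have h3 : φ v ≤ ψ v := h1
  linarith

end WGraph

namespace Triple

variable {n : ℕ} {A B : Triple n}

namespace Hom

variable (f : A ⟶ B) {μ : A.G.V → ℝ}

/-- A set of vertices which no step along a contracted half leaves. -/
theorem exists_pre_of_closed (hA : A.pd.IsSemistable μ) (W : Finset A.G.V)
    (hW : ∀ a ∈ W, ∀ b, A.G.Step (Set.range f.hat.onE)ᶜ a b → b ∈ W) :
    ∃ W', W = f.base.pre W' ∧ B.pd.betaExc (f.base.push μ) W' = 0 ∧ A.G.cut W ⊆ A.pd.exc := by
  classical
  have hcut : A.G.cut W ⊆ A.pd.exc := by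
    intro e he
    by_contra hS
    rw [A.G.mem_cut_iff W e false] at he
    have h1 : A.G.src e ∈ W → A.G.tgt e ∈ W := fun h => hW _ h _ (Or.inl ⟨e, hS, rfl⟩)
    have h2 : A.G.tgt e ∈ W → A.G.src e ∈ W := fun h => hW _ h _ (Or.inl ⟨e, hS, Sym2.eq_swap⟩)
    rw [WGraph.endp_false, Bool.not_false, WGraph.endp_true] at he
    tauto
  have hpre : W = f.base.pre (W.image f.base.onV) := by
    ext v
    rw [Spec.mem_pre, Finset.mem_image]
    constructor
    · exact fun h => ⟨v, h, rfl⟩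
    · rintro ⟨w, hw, h⟩
      rw [f.base.fiber] at h
      induction h with
      | refl => exact hw
      | tail _ h ih =>
        obtain ⟨e, he, h⟩ := h
        refine hW _ ih _ ?_
        by_cases hS : e ∈ A.pd.exc
        · obtain ⟨c, h1, h2⟩ := A.G.exists_endp_of_ends_eq h
          exact Or.inr ⟨e, hS, c, h1, h2, fun h => he (f.under_mem_range h)⟩
        · exact Or.inl ⟨e, hS, h⟩
  refine ⟨_, hpre, (f.betaExc_eq_zero_iff hA _).2 ?_, hcut⟩
  rw [← hpre]
  refine ⟨hA.betaExc_eq_zero hcut, fun e he b hb c hc => ?_⟩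
  by_cases h : c = b
  · rwa [h]
  · have h1 : b = !c := by
      revert h
      cases b <;> cases c <;> simp
    subst h1
    exact hW _ hb _ (Or.inr ⟨e, he, c, rfl, rfl, hc⟩)

/-- The set of reachable vertices is closed under steps, so it is the preimage of a set with
invariant zero that contains the image of `v₀`. Quasistability leaves only the set of all vertices.
-/
theorem reach_of_isQuasistable (hA : A.pd.IsSemistable μ) {v₀ : A.G.V}
    (hB : B.pd.IsQuasistable (f.base.push μ) (f.base.onV v₀)) (v : A.G.V) :
    A.G.Reach (Set.range f.hat.onE)ᶜ v₀ v := by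
  classical
  let W := Finset.univ.filter fun v => A.G.Reach (Set.range f.hat.onE)ᶜ v₀ v
  have hmem : ∀ v, v ∈ W ↔ A.G.Reach (Set.range f.hat.onE)ᶜ v₀ v := by simp [W]
  obtain ⟨W', h1, h2, -⟩ := f.exists_pre_of_closed hA W fun a ha b hb =>
    (hmem b).2 (((hmem a).1 ha).tail hb)
  have h3 : f.base.onV v₀ ∈ W' := by
    rw [← Spec.mem_pre, ← h1, hmem]
    exact Relation.ReflTransGen.refl
  have h4 : W' = Finset.univ := by
    by_contra h
    exact (hB.betaExc_pos h h3).ne' h2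
  rw [← hmem, h1, h4]
  simp

/-- No step leaves the preimage of a set with invariant zero: polystability makes its cut
exceptional, which excludes ordinary edges, and the vanishing of the defect excludes contracted
halves. If the preimage contains `v₀`, it therefore contains every vertex. -/
theorem isQuasistable_of_reach (hA : A.pd.IsPolystable μ) {v₀ : A.G.V}
    (h : ∀ v, A.G.Reach (Set.range f.hat.onE)ᶜ v₀ v) :
    B.pd.IsQuasistable (f.base.push μ) (f.base.onV v₀) := by
  refine (f.isSemistable hA.isSemistable).isQuasistable fun W hW hv hβ => hW ?_
  obtain ⟨h1, h2⟩ := (f.betaExc_eq_zero_iff hA.isSemistable W).1 hβ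
  have hcut := hA.cut_subset h1
  have h3 : ∀ v, v ∈ f.base.pre W := by
    intro v
    have := h v
    induction this with
    | refl => exact f.base.mem_pre.2 hv
    | @tail p q _ hpq ih =>
      rcases hpq with ⟨e, he, h⟩ | ⟨e, he, c, rfl, rfl, h⟩
      · by_contra hq
        obtain ⟨c, rfl, rfl⟩ := A.G.exists_endp_of_ends_eq h
        refine he (hcut ((A.G.mem_cut_iff _ e c).2 ?_))
        tauto
      · exact h2 e he _ ih c h
  ext x
  obtain ⟨v, rfl⟩ := f.base.surjective_onV x
  simpa using f.base.mem_pre.1 (h3 v)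

end Hom

end Triple

end TropJac

end

/-! ### The universal polystable blowup of a semistable pseudo-divisor. -/

noncomputable section

namespace TropJac

namespace PseudoDiv

variable {n : ℕ} {G : WGraph n}

theorem ext_of_old {S : Finset G.E} {D D' : (G.subdiv S).V → ℤ}
    (hD : ∀ e h, D (G.midV S e h) = -1) (hD' : ∀ e h, D' (G.midV S e h) = -1)
    (h : ∀ v, D (G.oldV S v) = D' (G.oldV S v)) : D = D' := by
  funext v
  obtain ⟨w, rfl⟩ | ⟨e, he, rfl⟩ := G.subdiv_V_cases _ v
  · exact h w
  · rw [hD, hD']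

end PseudoDiv

namespace Triple

variable {n : ℕ} {A : Triple n} {Γ : WGraph n} {P Q R : PseudoDiv Γ} {μ : Γ.V → ℝ}

/-- A specialization over the identity that respects the labelling of the halves of the
exceptional edges. -/
def Hom.IsStandard (g : Triple.mk Γ P ⟶ Triple.mk Γ Q) : Prop :=
  g.base = Spec.id Γ ∧ ∀ e (he : e ∈ Q.exc), ∃ he' : e ∈ P.exc, ∀ b,
    g.hat.onE (Γ.halfE Q.exc e he b) = Γ.halfE P.exc e he' b

theorem Hom.IsStandard.comp {g : Triple.mk Γ P ⟶ Triple.mk Γ Q}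
    {h : Triple.mk Γ Q ⟶ Triple.mk Γ R} (hg : Hom.IsStandard g) (hh : Hom.IsStandard h) :
    Hom.IsStandard (g ≫ h) := by
  constructor
  · change Spec.comp g.base h.base = _
    rw [hg.1, hh.1]; rfl
  · intro e he
    obtain ⟨h1, h2⟩ := hh.2 e he
    obtain ⟨h3, h4⟩ := hg.2 e h1
    refine ⟨h3, fun b => ?_⟩
    rw [← h4, ← h2]; rfl

/-- A specialization with target `Q` factors through `g` if its source is polystable. -/
def Hom.IsUniversal (μ : Γ.V → ℝ) (g : Triple.mk Γ P ⟶ Triple.mk Γ Q) : Prop :=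
  ∀ (A : Triple n) (f : A ⟶ Triple.mk Γ Q) (ν : A.G.V → ℝ), A.pd.IsPolystable ν →
    f.base.push ν = μ → ∃ f₁ : A ⟶ Triple.mk Γ P, f₁ ≫ g = f

/-- Points in the interior of the cone `τ` of `Q` are mapped into the image of the open orthant
of `P`. -/
def Hom.IsInterior (g : Triple.mk Γ P ⟶ Triple.mk Γ Q) : Prop :=
  ∀ y ∈ openOrthant Q.graph.E, ∃ x ∈ openOrthant P.graph.E,
    Hom.extend g y - x ∈ Γ.cutSpace P.exc

/-- Blowing up the edges of a cut on which the invariant vanishes. -/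
theorem exists_blowup (hQ : Q.IsSemistable μ) {W : Finset Γ.V} (hW : Q.betaExc μ W = 0) :
    ∃ (Q₁ : PseudoDiv Γ) (g : Triple.mk Γ Q₁ ⟶ Triple.mk Γ Q), Q₁.exc = Q.exc ∪ Γ.cut W ∧
      Q₁.IsSemistable μ ∧ Hom.IsStandard g ∧ Hom.IsUniversal μ g ∧ Hom.IsInterior g := by
  classical
  let S := Q.exc ∪ Γ.cut W
  -- The new exceptional vertices are to be merged into the ends in `W`, so the half that is kept is
  -- the one at the end outside `W`.
  let η : Γ.E → Bool := fun e => if e ∈ Γ.cut W ∧ e ∉ Q.exc then decide (Γ.src e ∈ W) else false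
  have hη0 : ∀ e ∈ Q.exc, η e = false := fun e he => if_neg fun h => h.2 he
  have hη1 : ∀ e ∉ S, η e = false := fun e he =>
    if_neg fun h => he (Finset.mem_union_right _ h.1)
  have hin : ∀ e ∈ Γ.cut W, e ∉ Q.exc → (Γ.endp e !(η e)) ∈ W ∧ Γ.endp e (η e) ∉ W := by
    intro e he he'
    have h1 : η e = decide (Γ.src e ∈ W) := if_pos ⟨he, he'⟩
    rw [Γ.mem_cut_iff W e false] at he
    rw [h1]
    by_cases h : Γ.src e ∈ W <;> simp [h] at he ⊢ <;> exact he
  have hSQ : ∀ e, e ∈ S → e ∉ Q.exc → e ∈ Γ.cut W := fun e h h' =>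
    (Finset.mem_union.1 h).resolve_left h'
  -- The number of new exceptional vertices that are merged into `v`; adding it offsets their values
  -- -1.
  let d : Γ.V → ℤ := fun v =>
    ∑ e, if e ∈ S then (if e ∉ Q.exc ∧ (Γ.endp e !(η e)) = v then 1 else 0) else 0
  let Q₁ : PseudoDiv Γ :=
    { exc := S
      div := Sum.elim (fun v => Q.div (Γ.oldV Q.exc v) + d v) fun _ => -1
      div_exc := fun _ => rfl }
  have hT : ∀ e ∈ Q.exc, (Spec.id Γ).onE e ∈ Q₁.exc := fun e he => Finset.mem_union_left _ he
  have hη : ∀ e ∈ Q.exc, ∀ b, Γ.endp e b =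
      (Spec.id Γ).onV (Γ.endp ((Spec.id Γ).onE e) (b ^^ η e)) := by
    intro e he b
    rw [hη0 e he, Bool.xor_false]; rfl
  let gh := (Spec.id Γ).subdiv (S := S) η hT hη
  have hg1 : ∀ e (h : e ∈ S) (h' : e ∈ Q.exc), gh.onV (Γ.midV S e h) = Γ.midV Q.exc e h' :=
    fun e h h' => (Spec.id Γ).subdivV_midV_of_mem η h' h
  have hg2 : ∀ e (h : e ∈ S) (_ : e ∉ Q.exc), gh.onV (Γ.midV S e h) =
      Γ.oldV Q.exc (Γ.endp e !(η e)) :=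
    fun e h h' => (Spec.id Γ).subdivV_midV_of_notMem η h' h
  have hg3 : ∀ v, gh.onV (Γ.oldV S v) = Γ.oldV Q.exc v := fun v => rfl
  have hpush : ∀ D : (Γ.subdiv S).V → ℤ, (∀ e h, D (Γ.midV S e h) = -1) → ∀ v,
      gh.push D (Γ.oldV Q.exc v) = D (Γ.oldV S v) - d v := by
    intro D hD v
    unfold Spec.push
    rw [Finset.sum_filter, Γ.sum_subdiv_V, sub_eq_add_neg, ← Finset.sum_neg_distrib]
    congr 1
    · simp only [hg3, WGraph.oldV_inj]
      rw [Finset.sum_ite_eq' Finset.univ v fun v => D (Γ.oldV S v)]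
      simp
    · refine Finset.sum_congr rfl fun e _ => ?_
      by_cases h : e ∈ S
      · simp only [h, dite_true, if_true, hD]
        by_cases h' : e ∈ Q.exc
        · rw [hg1 e h h']; simp [h']
        · rw [hg2 e h h']
          simp only [WGraph.oldV_inj, h', not_false_eq_true, true_and]
          split_ifs <;> rfl
      · simp [h]
  have hdiv : Q.div = gh.push Q₁.div := by
    refine PseudoDiv.ext_of_old Q.div_midV
      ((Spec.id Γ).push_subdiv_midV Q₁ Q.exc η hT hη) fun v => ?_
    rw [hpush _ Q₁.div_midV]
    exact (add_sub_cancel_right _ _).symm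
  let g : Triple.mk Γ Q₁ ⟶ Triple.mk Γ Q := Hom.ofSubdiv (A := ⟨Γ, Q₁⟩) (B := ⟨Γ, Q⟩)
    (Spec.id Γ) η hT hη hdiv
  refine ⟨Q₁, g, rfl, ?_, ⟨rfl, fun e he => ⟨hT e he, fun b => ?_⟩⟩, ?_, ?_⟩
  · -- semistability
    refine ⟨?_, fun Y => ?_⟩
    · have h1 : ∑ x, Q.div x = ∑ v, Q₁.div v := by rw [hdiv, gh.sum_push_univ]
      have h2 : ∑ x, (Q.div x : ℝ) = ∑ v, (Q₁.div v : ℝ) := by exact_mod_cast h1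
      exact h2.symm.trans hQ.1
    · have h1 := g.betaExc_eq μ Y
      have h2 : g.base.push μ = μ := Spec.push_id μ
      have h3 : g.base.pre Y = Y := by ext v; exact g.base.mem_pre
      rw [h2, h3] at h1
      have h1 : Q.betaExc μ Y = Q₁.betaExc μ Y + Q₁.defect (g.hat.pre (Γ.hull Q.exc Y)) := h1
      -- Passing from `Q` to `Q₁` lowers the invariant of `Y` by the defect, which is at most the
      -- number of edges crossing between `W` and `Y`. As the invariant of `W` is zero, modularity
      -- shows that the invariant of `Y` for `Q` is at least this number.
      have h4 := Q.betaExc_modular μ W Y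
      have h5 : Q₁.defect (g.hat.pre (Γ.hull Q.exc Y)) ≤ Q.crossing W Y := by
        refine Finset.sum_le_sum fun e _ => ?_
        by_cases hS : e ∈ S
        · have hS' : e ∈ Q₁.exc := hS
          simp only [hS', dite_true]
          have h6 : ∀ v, Γ.oldV Q₁.exc v ∈ g.hat.pre (Γ.hull Q.exc Y) ↔ v ∈ Y := fun v =>
            g.hat.mem_pre.trans Γ.oldV_mem_hull
          have h7 : Γ.midV Q₁.exc e hS' ∈ g.hat.pre (Γ.hull Q.exc Y) ↔
            gh.onV (Γ.midV S e hS) ∈ Γ.hull Q.exc Y := g.hat.mem_pre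
          simp only [h6, h7]
          by_cases hQe : e ∈ Q.exc
          · rw [if_pos hQe, hg1 e hS hQe]
            simp only [WGraph.midV_mem_hull, Bool.exists_bool, WGraph.endp_false, WGraph.endp_true]
            by_cases h8 : Γ.src e ∈ Y <;> by_cases h9 : Γ.tgt e ∈ Y <;> simp [h8, h9]
          · rw [if_neg hQe, hg2 e hS hQe]
            simp only [WGraph.oldV_mem_hull]
            obtain ⟨h8, h9⟩ := hin e (hSQ e hS hQe) hQe
            have h10 : (if Γ.src e ∈ Y then (1 : ℝ) else 0) + (if Γ.tgt e ∈ Y then 1 else 0) =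
                (if (Γ.endp e !(η e)) ∈ Y then (1 : ℝ) else 0) +
                  (if Γ.endp e (η e) ∈ Y then 1 else 0) := by
              cases η e
              · exact add_comm _ _
              · rfl
            rw [h10]
            by_cases h11 : (Γ.endp e !(η e)) ∈ Y
            · rw [if_pos h11]
              split_ifs <;> norm_num
            · rw [if_neg h11, if_neg h11]
              by_cases h12 : Γ.endp e (η e) ∈ Y
              · rw [if_pos h12, if_pos ⟨!(η e), ⟨h8, h11⟩, by simpa using h9, by simpa using h12⟩]
                norm_num
              · rw [if_neg h12]
                split_ifs <;> norm_num
        · have hS' : e ∉ Q₁.exc := hS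
          simp only [hS', dite_false]
          split_ifs <;> norm_num
      linarith [hQ.2 (W ∩ Y), hQ.2 (W ∪ Y)]
  · refine ((Spec.id Γ).subdivE_halfE η hT he b).trans ?_
    rw [hη0 e he, Bool.xor_false]; rfl
  · -- the universal property
    intro A f ν hA hν
    have hW' := hW
    rw [← hν] at hW'
    obtain ⟨h1, h2⟩ := (f.betaExc_eq_zero_iff hA.isSemistable W).1 hW'
    have hcut := hA.cut_subset h1
    have hcutA : ∀ e ∈ Γ.cut W, f.base.onE e ∈ A.pd.exc := fun e he =>
      hcut (f.base.onE_mem_cut_pre.2 he)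
    -- Here `ε e` matches the halves of `f.base.onE e` with those of `e`. On exceptional edges of
    -- `Q` it is read off from `f`. On a new edge it is the flip of `f.base`; the zero of the
    -- invariant on `W` forces `f` to contract the half at the end in `W`, as the blowup does. On
    -- the other edges it names the half kept by `f`, if there is a choice.
    have hε : ∀ e, ∃ ε : Bool,
        (∀ he : e ∈ Q.exc, ∀ b, f.hat.onE (Γ.halfE Q.exc e he b) =
          A.G.halfE A.pd.exc (f.base.onE e) (f.exc_subset e he) (b ^^ ε)) ∧
        (∀ he : e ∉ Q.exc, ∀ h : f.base.onE e ∈ A.pd.exc, f.hat.onE (Γ.oldE Q.exc e he) =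
          A.G.halfE A.pd.exc (f.base.onE e) h (η e ^^ ε) ∧
          A.G.halfE A.pd.exc (f.base.onE e) h (!(η e ^^ ε)) ∉ Set.range f.hat.onE) ∧
        (e ∈ S → ∀ b, Γ.endp e b = f.base.onV (A.G.endp (f.base.onE e) (b ^^ ε))) := by
      intro e
      by_cases he : e ∈ Q.exc
      · obtain ⟨b₀, h3, h4, -⟩ := f.onE_halfE he false
        obtain ⟨b₁, h5, h6, -⟩ := f.onE_halfE he true
        have hne : b₀ ≠ b₁ := by
          rintro rfl
          have := f.hat.injective_onE (h3.trans h5.symm)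
          rw [WGraph.halfE_inj] at this
          simp at this
        have hb : b₁ = !b₀ := by
          revert hne
          cases b₀ <;> cases b₁ <;> simp
        subst hb
        refine ⟨b₀, fun _ b => ?_, fun h => absurd he h, fun _ b => ?_⟩
        · cases b
          · rw [h3, Bool.false_xor]
          · rw [h5, Bool.true_xor]
        · cases b
          · rw [Bool.false_xor]; exact h4
          · rw [Bool.true_xor]; exact h6
      · by_cases hS : e ∈ S
        · have hc := hSQ e hS he
          obtain ⟨ε, hε⟩ := f.base.exists_flip e
          have hA' := hcutA e hc
          obtain ⟨b₀, h3, h4⟩ := f.onE_oldE_of_mem he hA'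
          obtain ⟨h5, h6⟩ := hin e hc he
          have hb : b₀ = (η e ^^ ε) := by
            by_contra hne
            have h7 : (!b₀) = (η e ^^ ε) := by
              revert hne
              cases b₀ <;> cases (η e ^^ ε) <;> simp
            have h8 := h2 _ hA' (!(η e) ^^ ε) (f.base.mem_pre.2 (by rw [← hε]; exact h5)) _ h4
            rw [h7, f.base.mem_pre, ← hε] at h8
            exact h6 h8
          subst hb
          exact ⟨ε, fun h => absurd h he, fun _ _ => ⟨h3, h4⟩, fun _ => hε⟩
        · by_cases hA' : f.base.onE e ∈ A.pd.exc
          · obtain ⟨b₀, h3, h4⟩ := f.onE_oldE_of_mem he hA'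
            refine ⟨b₀, fun h => absurd h he, fun _ _ => ?_, fun h => absurd h hS⟩
            rw [hη1 e hS, Bool.false_xor]
            exact ⟨h3, h4⟩
          · exact ⟨false, fun h => absurd h he, fun _ h => absurd h hA', fun h => absurd h hS⟩
    choose ε hε1 hε2 hε3 using hε
    have hT₁ : ∀ e ∈ S, f.base.onE e ∈ A.pd.exc := fun e he => by
      by_cases h : e ∈ Q.exc
      · exact f.exc_subset e h
      · exact hcutA e (hSQ e he h)
    let fh := f.base.subdiv (S := A.pd.exc) (T := S) ε hT₁ hε3
    have hcomp : fh.comp gh = f.hat := by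
      refine Spec.ext (funext fun v => ?_) (funext fun h => ?_)
      · change gh.onV (fh.onV v) = _
        obtain ⟨w, rfl⟩ | ⟨e, he, rfl⟩ := A.G.subdiv_V_cases _ v
        · exact (f.onV_oldV w).symm
        · by_cases hr : e ∈ Set.range f.base.onE
          · obtain ⟨e', rfl⟩ := hr
            by_cases hQe : e' ∈ Q.exc
            · obtain ⟨-, -, -, h4⟩ := f.onE_halfE hQe false
              have h5 : fh.onV (A.G.midV A.pd.exc _ he) = Γ.midV S e' (Finset.mem_union_left _ hQe) :=
                f.base.subdivV_midV_of_mem ε _ he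
              rw [h5, hg1 e' _ hQe]
              exact h4.symm
            · have h3 := (hε2 e' hQe he).2
              have h4 : f.hat.onV (A.G.midV A.pd.exc _ he) = Γ.oldV Q.exc _ :=
                f.onV_midV_of_notMem_range he h3
              rw [h4]
              by_cases hS : e' ∈ S
              · have h5 : fh.onV (A.G.midV A.pd.exc _ he) = Γ.midV S e' hS :=
                  f.base.subdivV_midV_of_mem ε _ he
                rw [h5, hg2 e' _ hQe, hε3 e' hS, ← Bool.not_xor]
              · have h5 : fh.onV (A.G.midV A.pd.exc _ he) = Γ.oldV S _ :=
                  f.base.subdivV_midV_of_notMem ε hS he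
                rw [h5, hg3, hη1 e' hS, Bool.false_xor]
          · have h3 : fh.onV (A.G.midV A.pd.exc e he) = Γ.oldV S _ :=
              f.base.subdivV_midV_of_notMem_range ε hr he false
            rw [h3, hg3]
            exact (f.onV_midV_of_notMem_range he fun h => hr (f.under_mem_range h)).symm
      · change fh.onE (gh.onE h) = _
        obtain ⟨e, he, rfl⟩ | ⟨e, he, b, rfl⟩ := Γ.subdiv_E_cases _ h
        · by_cases hS : e ∈ S
          · have h3 : gh.onE (Γ.oldE Q.exc e he) = Γ.halfE S e hS (η e) :=
              (Spec.id Γ).subdivE_oldE_of_mem η hT he hS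
            rw [h3]
            exact (f.base.subdivE_halfE ε hT₁ hS _).trans (hε2 e he (hT₁ e hS)).1.symm
          · have h3 : gh.onE (Γ.oldE Q.exc e he) = Γ.oldE S e hS :=
              (Spec.id Γ).subdivE_oldE_of_notMem η hT he hS
            rw [h3]
            by_cases hA' : f.base.onE e ∈ A.pd.exc
            · refine (f.base.subdivE_oldE_of_mem ε hT₁ hS hA').trans ?_
              have := (hε2 e he hA').1
              rw [hη1 e hS, Bool.false_xor] at this
              exact this.symm
            · exact (f.base.subdivE_oldE_of_notMem ε hT₁ hS hA').trans
                (f.onE_oldE_of_notMem he hA').symm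
        · have h3 : gh.onE (Γ.halfE Q.exc e he b) = Γ.halfE S e (hT e he) (b ^^ η e) := rfl
          rw [h3, hη0 e he, Bool.xor_false]
          exact (f.base.subdivE_halfE ε hT₁ (hT e he) b).trans (hε1 e he b).symm
    have hdiv₁ : Q₁.div = fh.push A.pd.div := by
      have hm := f.base.push_subdiv_midV A.pd S ε hT₁ hε3
      refine PseudoDiv.ext_of_old Q₁.div_midV hm fun v => ?_
      have h3 := hpush _ hm v
      have h4 : gh.push (fh.push A.pd.div) = Q.div := by
        rw [← Spec.push_comp, hcomp]
        exact f.div_eq.symm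
      change gh.push (fh.push A.pd.div) _ = _ at h3
      rw [h4] at h3
      change Q.div (Γ.oldV Q.exc v) + d v = fh.push A.pd.div (Γ.oldV S v)
      rw [h3]
      exact sub_add_cancel _ _
    exact ⟨Hom.ofSubdiv (A := A) (B := ⟨Γ, Q₁⟩) f.base ε hT₁ hε3 hdiv₁, Hom.ext rfl hcomp⟩
  · -- interior points
    intro y hy
    obtain ⟨m, hm, hmin⟩ := WGraph.exists_pos_le (Hom.extend g y)
    -- The contracted halves have length zero and lie at ends in `W`, where `u_W` has coordinate 1.
    -- All other coordinates are at least `m`, and there `u_W` is at least -1, so half of `m` leaves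
    -- them positive.
    refine ⟨Hom.extend g y + (m / 2) • Γ.cutVector S W, fun h => ?_, ?_⟩
    · rw [Pi.add_apply, Pi.smul_apply, smul_eq_mul]
      by_cases hr : h ∈ Set.range g.hat.onE
      · have h1 : 0 < Hom.extend g y h := by
          obtain ⟨h', rfl⟩ := hr
          rw [Hom.extend_apply]
          exact hy h'
        have h2 := hmin h h1
        have h3 : -1 ≤ Γ.cutVector S W h := by
          obtain ⟨e, he, rfl⟩ | ⟨e, he, b, rfl⟩ := Γ.subdiv_E_cases _ h
          · change (-1 : ℝ) ≤ 0
            norm_num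
          · rw [Γ.cutVector_eq_delta, WGraph.delta_halfE]
            split_ifs <;> norm_num
        nlinarith
      · have h1 : Γ.cutVector S W h = 1 := by
          obtain ⟨e, he, rfl⟩ | ⟨e, he, b, rfl⟩ := Γ.subdiv_E_cases _ h
          · exact absurd ((Hom.oldE_mem_range g he).2 ⟨e, rfl⟩) hr
          · have h2 : ¬ (e ∈ Q.exc ∨ b = η e) := fun h =>
              hr (((Spec.id Γ).halfE_mem_range_subdivE η hT he b).2 h)
            rw [not_or] at h2
            obtain ⟨h3, h4⟩ := hin e (hSQ e he h2.1) h2.1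
            have h5 : b = !(η e) := by
              have := h2.2
              revert this
              cases b <;> cases η e <;> simp
            rw [Γ.cutVector_eq_delta, WGraph.delta_halfE, h5, Bool.not_not, if_pos h3, if_neg h4,
              sub_zero]
        rw [Hom.extend_apply' g _ _ hr, h1]
        linarith
    · rw [sub_add_cancel_left]
      exact Submodule.neg_mem _ (Submodule.smul_mem _ _ (Submodule.subset_span
        ⟨W, Finset.subset_union_right, rfl⟩))

/-- Every semistable pseudo-divisor has a universal polystable blowup. -/
theorem exists_polystable (hQ : Q.IsSemistable μ) :
    ∃ (R : PseudoDiv Γ) (g : Triple.mk Γ R ⟶ Triple.mk Γ Q), R.IsPolystable μ ∧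
      Hom.IsStandard g ∧ Hom.IsUniversal μ g ∧ Hom.IsInterior g := by
  -- Each blowup at a zero whose cut is not yet exceptional strictly decreases the number of
  -- non-exceptional edges.
  induction hk : (Q.excᶜ).card using Nat.strong_induction_on generalizing Q with
  | _ k ih =>
    by_cases h : ∀ W, Q.betaExc μ W = 0 → Γ.cut W ⊆ Q.exc
    · refine ⟨Q, 𝟙 _, hQ.isPolystable h, ⟨rfl, fun e he => ⟨he, fun b => rfl⟩⟩,
        fun A f ν _ _ => ⟨f, Category.comp_id f⟩, fun y hy => ⟨y, hy, ?_⟩⟩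
      rw [Hom.extend_id, sub_self]
      exact Submodule.zero_mem _
    · push Not at h
      obtain ⟨W, hW, hcut⟩ := h
      obtain ⟨Q₁, g, hexc, hss, hst, huniv, hint⟩ := exists_blowup hQ hW
      have hlt : (Q₁.excᶜ).card < k := by
        rw [← hk]
        refine Finset.card_lt_card (Finset.compl_ssubset_compl.2 ?_)
        rw [hexc]
        exact ⟨Finset.subset_union_left, fun h => hcut (Finset.subset_union_right.trans h)⟩
      obtain ⟨R, g', hR, hst', huniv', hint'⟩ := ih _ hlt hss rfl
      refine ⟨R, g' ≫ g, hR, hst'.comp hst, fun A f ν hA hν => ?_, fun y hy => ?_⟩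
      · obtain ⟨f₁, rfl⟩ := huniv A f ν hA hν
        have hb : f₁.base = (f₁ ≫ g).base := by
          change _ = f₁.base.comp g.base
          rw [hst.1]; rfl
        obtain ⟨f₂, rfl⟩ := huniv' A f₁ ν hA (by rw [hb]; exact hν)
        exact ⟨f₂, (Category.assoc _ _ _).symm⟩
      · obtain ⟨x, hx, h1⟩ := hint y hy
        obtain ⟨z, hz, h2⟩ := hint' x hx
        refine ⟨z, hz, ?_⟩
        rw [Hom.extend_comp]
        have h3 := Hom.extend_cutSpace g' h1
        rw [Submodule.mem_comap, map_sub] at h3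
        have := Submodule.add_mem _ h3 h2
        rwa [sub_add_sub_cancel] at this

end Triple

end TropJac

end

/-! ### Relative interiors, uniqueness of `pol`, and cells over the identity. -/

noncomputable section

namespace TropJac

section RelativeInterior

variable {ι : Type} [Finite ι]

/-- A point of the relative interior can be moved slightly away from the class of the all-ones
vector without leaving the cone. It is then a convex combination of a point of the cone and that
class, so it has a positive representative. Conversely, the quotient map is open. -/
theorem intrinsicInterior_mkQ_orthant (L : Submodule ℝ (ι → ℝ)) :
    intrinsicInterior ℝ (L.mkQ '' orthant ι) = L.mkQ '' openOrthant ι := by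
  apply Set.Subset.antisymm
  · intro z hz
    set C := L.mkQ '' orthant ι with hC
    obtain ⟨y, hy, rfl⟩ := mem_intrinsicInterior.1 hz
    let p : (ι → ℝ) ⧸ L := L.mkQ fun _ => 1
    have hp : p ∈ affineSpan ℝ C :=
      subset_affineSpan _ _ ⟨fun _ => 1, fun _ => zero_le_one, rfl⟩
    let γ : ℝ → affineSpan ℝ C := fun t =>
      ⟨AffineMap.lineMap (y : (ι → ℝ) ⧸ L) p (-t), AffineMap.lineMap_mem _ y.2 hp⟩
    have hγ : Continuous γ := by
      refine Continuous.subtype_mk ?_ _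
      simp only [AffineMap.lineMap_apply_module]
      fun_prop
    have hγ0 : γ 0 = y := by
      apply Subtype.ext
      simp [γ]
    have hev : ∀ᶠ t in nhds (0 : ℝ), γ t ∈ ((↑) ⁻¹' C : Set (affineSpan ℝ C)) := by
      have : ((↑) ⁻¹' C : Set (affineSpan ℝ C)) ∈ nhds (γ 0) := by
        rw [hγ0]
        exact mem_interior_iff_mem_nhds.1 hy
      exact hγ.continuousAt.eventually this
    obtain ⟨ε, hε, hball⟩ := Metric.eventually_nhds_iff.1 hev
    have h1 := hball (y := ε / 2) (by
      rw [Real.dist_eq, sub_zero, abs_of_pos (half_pos hε)]; exact half_lt_self hε)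
    obtain ⟨x, hx, hxy⟩ := h1
    have hxy : L.mkQ x = AffineMap.lineMap (y : (ι → ℝ) ⧸ L) p (-(ε / 2)) := hxy
    rw [AffineMap.lineMap_apply_module] at hxy
    -- This solves the line equation for `y`: the class of `x` is `(1 + ε/2) y - (ε/2) p`, where `p`
    -- is the class of the all-ones vector.
    refine ⟨(1 + ε / 2)⁻¹ • (x + (ε / 2) • fun _ => 1), fun i => ?_, ?_⟩
    · have := hx i
      simp only [Pi.smul_apply, Pi.add_apply, smul_eq_mul, mul_one]
      positivity
    · rw [map_smul, map_add, map_smul, hxy, neg_smul, neg_add_cancel_right, smul_smul,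
        sub_neg_eq_add, inv_mul_cancel₀ (by positivity), one_smul]
  · refine Set.Subset.trans ?_ interior_subset_intrinsicInterior
    refine interior_maximal (Set.image_mono fun x hx i => (hx i).le) ?_
    refine L.isOpenMap_mkQ _ ?_
    have : openOrthant ι = Set.univ.pi fun _ => Set.Ioi (0 : ℝ) := by
      ext x; simp [openOrthant]
    rw [this]
    exact isOpen_set_pi Set.finite_univ fun _ _ => isOpen_Ioi

end RelativeInterior

namespace Triple

variable {n : ℕ}

theorem relint_sigma (A : Triple n) : (sigma A).relint =
    (A.G.cutSpace A.pd.exc).mkQ '' openOrthant A.graph.E :=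
  intrinsicInterior_mkQ_orthant _

theorem mkQ_eq_iff (A : Triple n) {x y : A.graph.E → ℝ} :
    (A.G.cutSpace A.pd.exc).mkQ x = (A.G.cutSpace A.pd.exc).mkQ y ↔
      x - y ∈ A.G.cutSpace A.pd.exc := by
  rw [Submodule.mkQ_apply, Submodule.mkQ_apply, Submodule.Quotient.eq]

variable {Γ : WGraph n} {P Q R : PseudoDiv Γ} {μ : Γ.V → ℝ}

namespace Hom

theorem onE_halfE_of_base_eq_id (f : Triple.mk Γ P ⟶ Triple.mk Γ Q) (hf : f.base = Spec.id Γ)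
    {e : Γ.E} (he : e ∈ Q.exc) (b : Bool) : ∃ (he' : e ∈ P.exc) (b' : Bool),
      f.hat.onE (Γ.halfE Q.exc e he b) = Γ.halfE P.exc e he' b' ∧
      Γ.endp e b = Γ.endp e b' ∧ f.hat.onV (Γ.midV P.exc e he') = Γ.midV Q.exc e he := by
  obtain ⟨base, hat, h1, h2, h3, h4⟩ := f
  obtain rfl : base = Spec.id Γ := hf
  obtain ⟨b', h⟩ := onE_halfE
    (Hom.mk (Spec.id Γ) hat h1 h2 h3 h4 : Triple.mk Γ P ⟶ Triple.mk Γ Q) he b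
  exact ⟨h1 e he, b', h⟩

theorem exc_subset_of_base_eq_id (f : Triple.mk Γ P ⟶ Triple.mk Γ Q)
    (hf : f.base = Spec.id Γ) : Q.exc ⊆ P.exc := fun _ he =>
  (onE_halfE_of_base_eq_id f hf he false).1

theorem base_push_of_base_eq_id (f : Triple.mk Γ P ⟶ Triple.mk Γ Q)
    (hf : f.base = Spec.id Γ) : f.base.push μ = μ := by
  rw [hf]; exact Spec.push_id μ

theorem base_comp {A B C : Triple n} (f : A ⟶ B) (g : B ⟶ C) :
    (f ≫ g).base = f.base.comp g.base := rfl

/-- A specialization over the identity which does not remove exceptional edges is trivial. -/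
theorem eq_of_base_eq_id (f : Triple.mk Γ P ⟶ Triple.mk Γ Q) (hf : f.base = Spec.id Γ)
    (h : P.exc ⊆ Q.exc) : P = Q := by
  have hdiv : ∀ v, Q.div (Γ.oldV Q.exc v) = P.div (Γ.oldV P.exc v) := by
    intro v
    have h1 : Q.div = f.hat.push P.div := f.div_eq
    have h2 : ∀ w, f.hat.onV (Γ.oldV P.exc w) = Γ.oldV Q.exc w := fun w => by
      refine (f.onV_oldV w).trans ?_
      rw [hf]; rfl
    rw [h1]
    unfold Spec.push
    rw [Finset.sum_filter, Γ.sum_subdiv_V]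
    have h3 : ∀ e : Γ.E, (if he : e ∈ P.exc then
        if f.hat.onV (Γ.midV P.exc e he) = Γ.oldV Q.exc v then
          P.div (Γ.midV P.exc e he) else 0 else 0) = 0 := by
      intro e
      split_ifs with he h4
      · obtain ⟨_, _, -, -, h5⟩ := onE_halfE_of_base_eq_id f hf (h he) false
        rw [h5] at h4
        exact absurd h4 Γ.midV_ne_oldV
      · rfl
      · rfl
    rw [Finset.sum_congr rfl fun e _ => h3 e]
    simp only [h2, WGraph.oldV_inj, Finset.sum_const_zero, add_zero]
    rw [Finset.sum_ite_eq' Finset.univ v fun v => P.div (Γ.oldV P.exc v)]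
    simp
  have hexc := h.antisymm (exc_subset_of_base_eq_id f hf)
  obtain ⟨S, D, hD⟩ := P
  obtain ⟨T, D', hD'⟩ := Q
  obtain rfl : S = T := hexc
  obtain rfl : D = D' := PseudoDiv.ext_of_old (fun e h => hD ⟨e, h⟩) (fun e h => hD' ⟨e, h⟩)
    fun v => (hdiv v).symm
  rfl

theorem extend_comp_onE {A B : Triple n} (f : A ⟶ B) {x : A.graph.E → ℝ}
    (hx : ∀ h ∉ Set.range f.hat.onE, x h = 0) : extend f (x ∘ f.hat.onE) = x := by
  funext h
  by_cases hr : h ∈ Set.range f.hat.onE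
  · obtain ⟨h', rfl⟩ := hr
    rw [extend_apply]; rfl
  · rw [extend_apply' f _ _ hr, hx h hr]

/-- The cell of a specialization depends only on the set of edges that are not contracted. -/
theorem cell_eq_of_range_eq {A B C : Triple n} (f : A ⟶ B) (f' : A ⟶ C)
    (h : Set.range f.hat.onE = Set.range f'.hat.onE) : cell f = cell f' := by
  have key : ∀ {B C : Triple n} (f : A ⟶ B) (f' : A ⟶ C),
      Set.range f.hat.onE = Set.range f'.hat.onE → cell f ⊆ cell f' := by
    rintro B C f f' h _ ⟨y, hy, rfl⟩
    refine ⟨extend f y ∘ f'.hat.onE, fun k => ?_, ?_⟩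
    · obtain ⟨k', hk⟩ : f'.hat.onE k ∈ Set.range f.hat.onE := h ▸ ⟨k, rfl⟩
      change 0 < extend f y (f'.hat.onE k)
      rw [← hk, extend_apply]
      exact hy k'
    · change Submodule.mkQ _ (extend f' _) = Submodule.mkQ _ (extend f y)
      rw [extend_comp_onE]
      intro k hk
      rw [← h] at hk
      exact extend_apply' f _ _ hk
  exact (key f f' h).antisymm (key f' f h.symm)

end Hom

theorem _root_.TropJac.PseudoDiv.Ge.antisymm (h : P.Ge Q) (h' : Q.Ge P) : P = Q := by
  obtain ⟨f, hf⟩ := h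
  obtain ⟨f', hf'⟩ := h'
  exact f.eq_of_base_eq_id hf (f'.exc_subset_of_base_eq_id hf')

/-- Being least is the universal property restricted to sources on the same graph and
specializations over the identity. -/
theorem isPol_of_isUniversal (hR : R.IsPolystable μ) {g : Triple.mk Γ R ⟶ Triple.mk Γ Q}
    (hg : Hom.IsStandard g) (hu : Hom.IsUniversal μ g) : PseudoDiv.IsPol μ R Q := by
  refine ⟨hR, ⟨g, hg.1⟩, fun P hP ⟨f, hf⟩ => ?_⟩
  obtain ⟨f₁, rfl⟩ := hu _ f μ hP (f.base_push_of_base_eq_id hf)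
  refine ⟨f₁, ?_⟩
  rw [Hom.base_comp, hg.1] at hf
  exact hf

theorem _root_.TropJac.PseudoDiv.IsPol.exists_hom (hQ : Q.IsSemistable μ)
    (h : PseudoDiv.IsPol μ R Q) : ∃ g : Triple.mk Γ R ⟶ Triple.mk Γ Q,
      Hom.IsStandard g ∧ Hom.IsUniversal μ g ∧ Hom.IsInterior g := by
  obtain ⟨R₀, g, h1, h2, h3, h4⟩ := exists_polystable hQ
  have h5 := isPol_of_isUniversal h1 h2 h3
  obtain rfl : R = R₀ := (h5.2.2 R h.1 h.2.1).antisymm (h.2.2 R₀ h1 h5.2.1)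
  exact ⟨g, h2, h3, h4⟩

/-- Specializations over the identity from `pol(Q)` to `Q` differ by an automorphism. -/
theorem _root_.TropJac.PseudoDiv.IsPol.exists_comp_eq (h : PseudoDiv.IsPol μ R Q)
    {g : Triple.mk Γ R ⟶ Triple.mk Γ Q} (hg : g.base = Spec.id Γ) (hu : Hom.IsUniversal μ g)
    (f : Triple.mk Γ R ⟶ Triple.mk Γ Q) (hf : f.base = Spec.id Γ) :
    ∃ f₁ : Triple.mk Γ R ⟶ Triple.mk Γ R, f₁ ≫ g = f ∧ f₁.base = Spec.id Γ ∧
      Function.Surjective f₁.hat.onE := by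
  obtain ⟨f₁, rfl⟩ := hu _ f μ h.1 (f.base_push_of_base_eq_id hf)
  refine ⟨f₁, rfl, ?_, Finite.surjective_of_injective f₁.hat.injective_onE⟩
  rw [Hom.base_comp, hg] at hf
  exact hf

/-- For the universal specialization this is the interior property. Any other one over the identity
differs by an endomorphism of `R` that permutes the coordinates and preserves the cut space. -/
theorem cell_subset_relint (hQ : Q.IsSemistable μ) (h : PseudoDiv.IsPol μ R Q)
    (f : Triple.mk Γ R ⟶ Triple.mk Γ Q) (hf : f.base = Spec.id Γ) :
    cell f ⊆ (sigma ⟨Γ, R⟩).relint := by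
  obtain ⟨g, h1, h2, h3⟩ := h.exists_hom hQ
  obtain ⟨f₁, rfl, hf₁, hs⟩ := h.exists_comp_eq h1.1 h2 f hf
  rw [relint_sigma]
  rintro _ ⟨y, hy, rfl⟩
  obtain ⟨x, hx, hxy⟩ := h3 y hy
  refine ⟨Hom.extend f₁ x, fun k => ?_, ?_⟩
  · obtain ⟨k', rfl⟩ := hs k
    rw [Hom.extend_apply]
    exact hx k'
  · change _ = Submodule.mkQ _ (Hom.extend (f₁ ≫ g) y)
    rw [Hom.extend_comp, eq_comm, mkQ_eq_iff, ← map_sub]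
    exact Hom.extend_cutSpace f₁ hxy

/-- The universal specialization contracts no half of a loop: coboundaries vanish on loops, so a
zero coordinate there could not be moved into the open orthant. An endomorphism of `R` over the
identity fixes the halves of exceptional edges that are not loops, hence does not change the set of
contracted halves, on which alone the cell depends. -/
theorem cell_eq_cell (hQ : Q.IsSemistable μ) (h : PseudoDiv.IsPol μ R Q)
    (f f' : Triple.mk Γ R ⟶ Triple.mk Γ Q) (hf : f.base = Spec.id Γ)
    (hf' : f'.base = Spec.id Γ) : cell f = cell f' := by
  obtain ⟨g, h1, h2, h3⟩ := h.exists_hom hQ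
  have hloop : ∀ k ∉ Set.range g.hat.onE, ∃ e he b, k = Γ.halfE R.exc e he b ∧
      Γ.endp e b ≠ Γ.endp e !b := by
    intro k hk
    obtain ⟨e, he, rfl⟩ | ⟨e, he, b, rfl⟩ := Γ.subdiv_E_cases _ k
    · refine absurd ((Hom.oldE_mem_range g he).2 ⟨e, ?_⟩) hk
      rw [h1.1]; rfl
    · refine ⟨e, he, b, rfl, fun hb => ?_⟩
      obtain ⟨x, hx, hxy⟩ := h3 (fun _ => 1) fun _ => one_pos
      obtain ⟨φ, -, hφ⟩ := (Γ.mem_cutSpace_iff _ _).1 hxy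
      have h4 := congrFun hφ (Γ.halfE R.exc e he b)
      rw [WGraph.delta_halfE, hb, sub_self, Pi.sub_apply, Hom.extend_apply' g _ _ hk] at h4
      have := hx (Γ.halfE R.exc e he b)
      linarith
  have key : ∀ f : Triple.mk Γ R ⟶ Triple.mk Γ Q, f.base = Spec.id Γ →
      Set.range f.hat.onE = Set.range g.hat.onE := by
    intro f hf
    obtain ⟨f₁, rfl, hf₁, hs⟩ := h.exists_comp_eq h1.1 h2 f hf
    have hfix : ∀ k ∉ Set.range g.hat.onE, f₁.hat.onE k = k := by
      intro k hk
      obtain ⟨e, he, b, rfl, hb⟩ := hloop k hk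
      obtain ⟨_, b', h5, h6, -⟩ := f₁.onE_halfE_of_base_eq_id hf₁ he b
      rw [h5]
      by_cases hbb : b' = b
      · rw [hbb]
      · have : b' = !b := by revert hbb; cases b <;> cases b' <;> simp
        rw [this] at h6
        exact absurd h6 hb
    have hr : Set.range (f₁ ≫ g).hat.onE = f₁.hat.onE '' Set.range g.hat.onE :=
      Set.range_comp f₁.hat.onE g.hat.onE
    rw [hr]
    ext k
    constructor
    · rintro ⟨k', hk', rfl⟩
      by_contra hn
      have := f₁.hat.injective_onE (hfix _ hn)
      exact hn (this.symm ▸ hk')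
    · intro hk
      obtain ⟨k', rfl⟩ := hs k
      refine ⟨k', ?_, rfl⟩
      by_contra hn
      rw [hfix _ hn] at hk
      exact hn hk
  exact Hom.cell_eq_of_range_eq f f' ((key f hf).trans (key f' hf').symm)

end Triple

end TropJac

end

/-! ### The two decompositions of σ into cells. -/

noncomputable section

namespace TropJac

namespace Triple

variable {n : ℕ}

section

variable {A B B' : Triple n} {μ : A.G.V → ℝ} {v₀ : A.G.V}

theorem Hom.zero_of_notMem_range (f : A ⟶ B) (y : B.graph.E → ℝ) :
    (Set.range f.hat.onE)ᶜ ⊆ {h | Hom.extend f y h = 0} :=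
  fun _ hh => Hom.extend_apply' f _ _ hh

/-- Different points of the closed cells of quasistable specializations represent different points
of `σ`. -/
theorem extend_eq_of_cellMap_eq (hA : A.pd.IsSemistable μ) (f : A ⟶ B) (f' : A ⟶ B')
    (hB : B.pd.IsQuasistable (f.base.push μ) (f.base.onV v₀))
    (hB' : B'.pd.IsQuasistable (f'.base.push μ) (f'.base.onV v₀))
    {y : B.graph.E → ℝ} {y' : B'.graph.E → ℝ} (hy : y ∈ orthant _) (hy' : y' ∈ orthant _)
    (h : cellMap f y = cellMap f' y') : Hom.extend f y = Hom.extend f' y' := by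
  refine WGraph.eq_of_reach (Hom.extend_orthant f hy) (Hom.extend_orthant f' hy')
    ((mkQ_eq_iff A).1 h) (v₀ := v₀) (fun v => ?_) fun v => ?_
  · exact (f.reach_of_isQuasistable hA hB v).mono (f.zero_of_notMem_range y)
  · exact (f'.reach_of_isQuasistable hA hB' v).mono (f'.zero_of_notMem_range y')

theorem Hom.range_eq_of_pos (f : A ⟶ B) {y : B.graph.E → ℝ} (hy : y ∈ openOrthant _) :
    Set.range f.hat.onE = {h | Hom.extend f y h ≠ 0} := by
  ext h
  constructor
  · rintro ⟨h', rfl⟩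
    rw [Set.mem_ofPred_eq, Hom.extend_apply]
    exact (hy h').ne'
  · intro h1
    by_contra h2
    exact h1 (Hom.extend_apply' f _ _ h2)

/-- The support of the extension of a positive point is the set of edges that are kept, and this set
determines the specialization up to isomorphism of the target. -/
theorem exists_iso_of_extend_eq (f : A ⟶ B) (f' : A ⟶ B')
    {y : B.graph.E → ℝ} {y' : B'.graph.E → ℝ} (hy : y ∈ openOrthant _) (hy' : y' ∈ openOrthant _)
    (h : Hom.extend f y = Hom.extend f' y') :
    ∃ i : B ≅ B', f ≫ i.hom = f' ∧ Hom.extend i.hom y' = y := by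
  obtain ⟨i, hi⟩ := exists_iso_of_range_eq f f' (by
    rw [f.range_eq_of_pos hy, f'.range_eq_of_pos hy', h])
  refine ⟨i, hi, ?_⟩
  rw [← hi, Hom.extend_comp] at h
  funext k
  have := congrFun h (f.hat.onE k)
  rwa [Hom.extend_apply, Hom.extend_apply, eq_comm] at this

/-- Every point of `σ` lies in the cell of a quasistable specialization. -/
theorem exists_cell (hG : A.G.IsConnected) (hA : A.pd.IsPolystable μ) (v₀ : A.G.V)
    {x : A.graph.E → ℝ} (hx : x ∈ orthant _) :
    ∃ (B : Triple n) (f : A ⟶ B) (y : B.graph.E → ℝ), y ∈ openOrthant B.graph.E ∧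
      B.pd.IsQuasistable (f.base.push μ) (f.base.onV v₀) ∧
      (A.G.cutSpace A.pd.exc).mkQ x = cellMap f y := by
  -- The cell is found by contracting the zeros of the normalized representative; reachability of
  -- all vertices is what makes the target quasistable.
  obtain ⟨φ, hφ, hx', hr⟩ := WGraph.exists_reach hG hx v₀
  set x' := x + A.G.delta A.pd.exc φ with hxdef
  obtain ⟨B, f, hf⟩ := exists_contract A {h | x' h = 0}
  have hz : ∀ h ∉ Set.range f.hat.onE, x' h = 0 := fun h hh => by
    rw [hf] at hh
    exact not_not.1 hh
  refine ⟨B, f, x' ∘ f.hat.onE, fun h => ?_, ?_, ?_⟩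
  · have : f.hat.onE h ∈ Set.range f.hat.onE := ⟨h, rfl⟩
    rw [hf] at this
    exact lt_of_le_of_ne (hx' _) (Ne.symm this)
  · refine f.isQuasistable_of_reach hA fun v => ?_
    rw [hf, compl_compl]
    exact hr v
  · refine (mkQ_eq_iff A).2 ?_
    rw [Hom.extend_comp_onE f hz, hxdef, sub_add_cancel_left]
    exact Submodule.neg_mem _ ((A.G.mem_cutSpace_iff _ _).2 ⟨φ, hφ, rfl⟩)

end

variable {Γ : WGraph n} {R : PseudoDiv Γ} {μ : Γ.V → ℝ}

/-- Every point in the interior of `σ` lies in the cell of a quasistable pseudo-divisor on the same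
graph. -/
theorem exists_cell_of_pos (hG : Γ.IsConnected) (hR : R.IsPolystable μ) (v₀ : Γ.V)
    {x : (Triple.mk Γ R).graph.E → ℝ} (hx : x ∈ openOrthant _) :
    ∃ (Q : PseudoDiv Γ) (f : Triple.mk Γ R ⟶ Triple.mk Γ Q) (y : Q.graph.E → ℝ),
      y ∈ openOrthant Q.graph.E ∧ Q.IsQuasistable μ v₀ ∧ PseudoDiv.IsPol μ R Q ∧
      Hom.IsStandard f ∧ (Γ.cutSpace R.exc).mkQ x = cellMap f y := by
  obtain ⟨φ, hφ, hx', hr⟩ := WGraph.exists_reach hG (fun h => (hx h).le) v₀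
  set x' := x + Γ.delta R.exc φ with hxdef
  obtain ⟨Q, f, hbase, hf, hstd⟩ := exists_hom_of_range ⟨Γ, R⟩ (Spec.id Γ) (fun _ _ => rfl)
    {h | x' h = 0} (by
      intro e
      refine ⟨fun _ => ?_, fun _ => ⟨e, rfl⟩⟩
      -- A coboundary preserves the sum of the two halves of an exceptional edge. This sum is
      -- positive for `x`, so the halves cannot both vanish for `x'`, and no edge of the base is
      -- contracted.
      by_cases he : e ∈ R.exc
      · by_contra hne
        push Not at hne
        have h0 : x' (Γ.halfE R.exc e he false) = 0 := hne _ rfl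
        have h1 : x' (Γ.halfE R.exc e he true) = 0 := hne _ rfl
        rw [hxdef, Pi.add_apply, WGraph.delta_halfE] at h0 h1
        have h2 := hx (Γ.halfE R.exc e he false)
        have h3 := hx (Γ.halfE R.exc e he true)
        simp only [Bool.not_false, Bool.not_true] at h0 h1
        linarith
      · refine ⟨Γ.oldE R.exc e he, rfl, fun h0 => ?_⟩
        have h0 : x' (Γ.oldE R.exc e he) = 0 := h0
        rw [hxdef, Pi.add_apply, WGraph.delta_oldE, add_zero] at h0
        exact (hx (Γ.oldE R.exc e he)).ne' h0)
  have hst : Hom.IsStandard f := ⟨hbase, hstd⟩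
  have hz : ∀ h ∉ Set.range f.hat.onE, x' h = 0 := fun h hh => by
    rw [hf] at hh
    exact not_not.1 hh
  have hQ : Q.IsQuasistable μ v₀ := by
    have := f.isQuasistable_of_reach hR (v₀ := v₀) fun v => by
      rw [hf, compl_compl]
      exact hr v
    rw [f.base_push_of_base_eq_id hbase, hbase] at this
    exact this
  refine ⟨Q, f, x' ∘ f.hat.onE, fun h => ?_, hQ, ?_, hst, ?_⟩
  · have : f.hat.onE h ∈ Set.range f.hat.onE := ⟨h, rfl⟩
    rw [hf] at this
    exact lt_of_le_of_ne (hx' _) (Ne.symm this)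
  · obtain ⟨R₀, g, hR₀, hg, hu, -⟩ := exists_polystable hQ.isSemistable
    have hpol := isPol_of_isUniversal hR₀ hg hu
    obtain ⟨g₁, hg₁⟩ := hpol.2.2 R hR ⟨f, hbase⟩
    suffices h : R.exc ⊆ R₀.exc by
      rw [g₁.eq_of_base_eq_id hg₁ h]
      exact hpol
    intro e he
    have hpre : ∀ {P : PseudoDiv Γ} (k : Triple.mk Γ P ⟶ Triple.mk Γ Q),
        k.base = Spec.id Γ → ∀ W : Finset Γ.V, k.base.pre W = W := by
      intro P k hk W
      ext v
      rw [Spec.mem_pre, hk]; rfl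
    by_cases heQ : e ∈ Q.exc
    · exact g.exc_subset_of_base_eq_id hg.1 heQ
    · obtain ⟨c, hc⟩ : ∃ c, Γ.halfE R.exc e he c ∉ Set.range f.hat.onE := by
        have hb : f.base.onE e = e := by rw [hbase]; rfl
        obtain ⟨b, -, hb'⟩ := f.onE_oldE_of_mem heQ (hb.symm ▸ he : f.base.onE e ∈ R.exc)
        refine ⟨!b, ?_⟩
        convert hb' using 3
        exact hb.symm
      have hlt : ∀ e he c, Γ.halfE R.exc e he c ∉ Set.range f.hat.onE →
          φ (Γ.endp e c) < φ (Γ.endp e !c) := by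
        intro e he c hc
        have h1 := hz _ hc
        rw [hxdef, Pi.add_apply, WGraph.delta_halfE] at h1
        have := hx (Γ.halfE R.exc e he c)
        linarith
      classical
      -- At a contracted half the potential is strictly smaller on the end of that half. Hence no
      -- contracted half leads out of this sublevel set, and its cut is exceptional for `R`, so the
      -- invariant of `Q` vanishes on it. It then vanishes for `R₀` as well, and polystability of
      -- `R₀` makes `e`, which is in the cut, exceptional.
      let W : Finset Γ.V := Finset.univ.filter fun v => φ v ≤ φ (Γ.endp e c)
      have hW : ∀ v, v ∈ W ↔ φ v ≤ φ (Γ.endp e c) := fun v => by simp [W]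
      have hcut : Γ.cut W ⊆ R.exc := by
        intro e' he'
        by_contra hn
        rw [Γ.mem_cut_iff W e' false, hW, hW] at he'
        have := hφ e' hn
        simp only [WGraph.endp_false, Bool.not_false, WGraph.endp_true, this] at he'
        tauto
      have h1 : R.betaExc μ W = 0 := hR.isSemistable.betaExc_eq_zero hcut
      have h2 : Q.betaExc μ W = 0 := by
        have h3 := f.betaExc_eq_zero_iff (μ := μ) hR.isSemistable W
        rw [hpre f hbase, f.base_push_of_base_eq_id hbase] at h3
        refine h3.2 ⟨h1, fun e' he' b hb c' hc' => ?_⟩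
        have hb := (hW _).1 hb
        have h4 := hlt e' he' c' hc'
        refine (hW _).2 ?_
        rcases Bool.eq_or_eq_not b c' with rfl | rfl
        · exact hb
        · exact h4.le.trans hb
      have h3 := g.betaExc_eq_zero_iff (μ := μ) hR₀.isSemistable W
      rw [hpre g hg.1, g.base_push_of_base_eq_id hg.1] at h3
      refine hR₀.cut_subset (h3.1 h2).1 ?_
      rw [Γ.mem_cut_iff W e c, hW, hW]
      have := hlt e he c hc
      simp [this]
  · refine (mkQ_eq_iff _).2 ?_
    rw [Hom.extend_comp_onE f hz, hxdef, sub_add_cancel_left]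
    exact Submodule.neg_mem _ ((Γ.mem_cutSpace_iff _ _).2 ⟨φ, hφ, rfl⟩)

end Triple

namespace UnivPolarization

variable {g n : ℕ} [NeZero n] {d : ℤ} (μ : UnivPolarization g n d)

theorem isQuasistable_of_hom {A B : Triple n} (hA : A.G.IsStable g) (hB : μ.isQD B) (f : A ⟶ B) :
    B.pd.IsQuasistable (f.base.push (μ.val A.G hA)) (f.base.onV (A.G.leg 0)) := by
  obtain ⟨h, hB⟩ := hB
  rw [μ.push_eq _ _ hA h, ← f.base.leg_eq]
  exact hB

theorem isQD_of_hom {A B : Triple n} (hA : A.G.IsStable g) (f : A ⟶ B)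
    (h : B.pd.IsQuasistable (f.base.push (μ.val A.G hA)) (f.base.onV (A.G.leg 0))) :
    μ.isQD B := by
  refine ⟨f.base.isStable hA, ?_⟩
  rw [← μ.push_eq _ _ hA _ f.base, f.base.leg_eq]
  exact h

theorem cell_decomposition (Γ : WGraph n) (hΓ : Γ.IsStable g) (R : PseudoDiv Γ)
    (hR : R.IsPolystable (μ.val Γ hΓ)) :
    (∀ (B : μ.QD) (f : Triple.mk Γ R ⟶ B.obj),
        Set.InjOn (Triple.cellMap f) (orthant B.obj.graph.E)) ∧
      ((Triple.sigma ⟨Γ, R⟩).relint =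
        ⋃ (Q : PseudoDiv Γ) (_ : Q.IsQuasistable (μ.val Γ hΓ) (Γ.leg 0))
          (_ : PseudoDiv.IsPol (μ.val Γ hΓ) R Q) (f : Triple.mk Γ R ⟶ Triple.mk Γ Q)
          (_ : f.base = Spec.id Γ), Triple.cell f) ∧
      (∀ Q : PseudoDiv Γ, Q.IsQuasistable (μ.val Γ hΓ) (Γ.leg 0) →
        PseudoDiv.IsPol (μ.val Γ hΓ) R Q → ∀ f f' : Triple.mk Γ R ⟶ Triple.mk Γ Q,
          f.base = Spec.id Γ → f'.base = Spec.id Γ → Triple.cell f = Triple.cell f') ∧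
      (∀ Q Q' : PseudoDiv Γ, Q.IsQuasistable (μ.val Γ hΓ) (Γ.leg 0) →
        Q'.IsQuasistable (μ.val Γ hΓ) (Γ.leg 0) → PseudoDiv.IsPol (μ.val Γ hΓ) R Q →
        PseudoDiv.IsPol (μ.val Γ hΓ) R Q' → Q ≠ Q' →
        ∀ (f : Triple.mk Γ R ⟶ Triple.mk Γ Q) (f' : Triple.mk Γ R ⟶ Triple.mk Γ Q'),
          f.base = Spec.id Γ → f'.base = Spec.id Γ →
          Disjoint (Triple.cell f) (Triple.cell f')) ∧
      ((Triple.sigma ⟨Γ, R⟩).carrier =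
        ⋃ (B : μ.QD) (f : Triple.mk Γ R ⟶ B.obj), Triple.cell f) ∧
      (∀ (B B' : μ.QD) (f : Triple.mk Γ R ⟶ B.obj) (f' : Triple.mk Γ R ⟶ B'.obj),
        (∃ i : B.obj ≅ B'.obj, f ≫ i.hom = f') ∨
          Disjoint (Triple.cell f) (Triple.cell f')) := by
  have hS := hR.isSemistable
  have hdisj : ∀ (B B' : μ.QD) (f : Triple.mk Γ R ⟶ B.obj) (f' : Triple.mk Γ R ⟶ B'.obj),
        (∃ i : B.obj ≅ B'.obj, f ≫ i.hom = f') ∨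
          Disjoint (Triple.cell f) (Triple.cell f') := by
    intro B B' f f'
    by_cases h : Disjoint (Triple.cell f) (Triple.cell f')
    · exact Or.inr h
    · left
      rw [Set.not_disjoint_iff] at h
      obtain ⟨_, ⟨y, hy, rfl⟩, ⟨y', hy', h⟩⟩ := h
      obtain ⟨i, hi, -⟩ := Triple.exists_iso_of_extend_eq f f' hy hy'
        (Triple.extend_eq_of_cellMap_eq hS f f' (μ.isQuasistable_of_hom hΓ B.2 f)
          (μ.isQuasistable_of_hom hΓ B'.2 f') (fun k => (hy k).le) (fun k => (hy' k).le) h.symm)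
      exact ⟨i, hi⟩
  refine ⟨fun B f y hy y' hy' h => ?_, ?_, fun Q hQ hpol f f' hf hf' =>
    Triple.cell_eq_cell hQ.isSemistable hpol f f' hf hf', ?_, ?_, hdisj⟩
  · have hB := μ.isQuasistable_of_hom hΓ B.2 f
    have h1 := Triple.extend_eq_of_cellMap_eq hS f f hB hB hy hy' h
    funext k
    have := congrFun h1 (f.hat.onE k)
    rwa [Triple.Hom.extend_apply, Triple.Hom.extend_apply] at this
  · apply Set.Subset.antisymm
    · rw [Triple.relint_sigma]
      rintro _ ⟨x, hx, rfl⟩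
      obtain ⟨Q, f, y, hy, hQ, hpol, hst, h⟩ :=
        Triple.exists_cell_of_pos hΓ.1 hR (Γ.leg 0) hx
      exact Set.mem_iUnion₂.2 ⟨Q, hQ, Set.mem_iUnion₂.2 ⟨hpol, f,
        Set.mem_iUnion.2 ⟨hst.1, y, hy, h.symm⟩⟩⟩
    · simp only [Set.iUnion_subset_iff]
      exact fun Q hQ hpol f hf => Triple.cell_subset_relint hQ.isSemistable hpol f hf
  · intro Q Q' hQ hQ' hpol hpol' hne f f' hf hf'
    rcases hdisj ⟨⟨Γ, Q⟩, hΓ, hQ⟩ ⟨⟨Γ, Q'⟩, hΓ, hQ'⟩ f f' with ⟨i, hi⟩ | h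
    · have hi' : f' ≫ i.inv = f := by rw [← hi, Category.assoc, i.hom_inv_id, Category.comp_id]
      refine absurd (PseudoDiv.Ge.antisymm ⟨i.hom, ?_⟩ ⟨i.inv, ?_⟩) hne
      · rw [← hi, Triple.Hom.base_comp, hf] at hf'
        exact hf'
      · rw [← hi', Triple.Hom.base_comp, hf'] at hf
        exact hf
    · exact h
  · apply Set.Subset.antisymm
    · rintro _ ⟨x, hx, rfl⟩
      obtain ⟨B, f, y, hy, hB, h⟩ := Triple.exists_cell (A := ⟨Γ, R⟩) hΓ.1 hR (Γ.leg 0) hx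
      exact Set.mem_iUnion₂.2 ⟨⟨B, μ.isQD_of_hom hΓ f hB⟩, f, y, hy, h.symm⟩
    · simp only [Set.iUnion_subset_iff]
      rintro B f _ ⟨y, hy, rfl⟩
      exact ⟨Triple.Hom.extend f y, Triple.Hom.extend_orthant f fun k => (hy k).le, rfl⟩

end UnivPolarization

end TropJac

end

/-! ### Face morphisms between the cones. -/

noncomputable section

namespace TropJac

namespace Triple

variable {n : ℕ} {A B : Triple n}

theorem isFaceMorphism_tau (f : A ⟶ B) : RPCone.IsFaceMorphism ((tauFunctor n).map f.op) := by
  classical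
  constructor
  · let l : (A.graph.E → ℝ) →ₗ[ℝ] ℝ := ∑ h with h ∉ Set.range f.hat.onE, LinearMap.proj h
    have hl : ∀ x, l x = ∑ h with h ∉ Set.range f.hat.onE, x h := fun x => by
      simp [l, LinearMap.sum_apply]
    refine ⟨l, fun x hx => (Finset.sum_nonneg fun h _ => hx h).trans_eq (hl x).symm, ?_⟩
    ext x
    constructor
    · rintro ⟨hx, h0⟩
      have hx : x ∈ orthant A.graph.E := hx
      have h0 : ∑ h with h ∉ Set.range f.hat.onE, (show A.graph.E → ℝ from x) h = 0 :=
        (hl x).symm.trans h0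
      rw [Finset.sum_eq_zero_iff_of_nonneg fun h _ => hx h] at h0
      refine ⟨⟨x ∘ f.hat.onE, fun h => hx _⟩, ?_⟩
      refine Hom.extend_comp_onE f fun h hh => h0 h ?_
      simpa using hh
    · rintro ⟨y, rfl⟩
      refine ⟨Hom.extend_orthant f y.2, ?_⟩
      change l (Hom.extend f y.1) = 0
      rw [hl]
      refine Finset.sum_eq_zero fun h hh => ?_
      exact Hom.extend_apply' f _ _ (Finset.mem_filter.1 hh).2
  · refine ⟨LinearMap.funLeft ℝ ℝ f.hat.onE, fun z hz h => hz _, fun y => ?_⟩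
    funext h
    exact Hom.extend_apply f _ _

/-- The vertices reachable from the end `c` form the preimage of a set with invariant zero. As the
target is polystable, the cut of that set is exceptional there, while an edge with a contracted half
cannot come from an exceptional edge. So `e` is not in the cut. Together with the step along `e`
itself, the path found here closes up to a directed cycle. -/
theorem Hom.reach_of_notMem_range (f : A ⟶ B) {μ : A.G.V → ℝ} (hA : A.pd.IsSemistable μ)
    (hB : B.pd.IsPolystable (f.base.push μ)) {e : A.G.E} (he : e ∈ A.pd.exc) {c : Bool}
    (hc : A.G.halfE A.pd.exc e he c ∉ Set.range f.hat.onE) :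
    A.G.Reach (Set.range f.hat.onE)ᶜ (A.G.endp e c) (A.G.endp e !c) := by
  classical
  let U : Finset A.G.V :=
    Finset.univ.filter fun v => A.G.Reach (Set.range f.hat.onE)ᶜ (A.G.endp e c) v
  have hU : ∀ v, v ∈ U ↔ A.G.Reach (Set.range f.hat.onE)ᶜ (A.G.endp e c) v := by simp [U]
  obtain ⟨W', hW, h0, -⟩ := f.exists_pre_of_closed hA U fun a ha b hab =>
    (hU b).2 (((hU a).1 ha).tail hab)
  have hcut := hB.cut_subset h0
  by_contra hn
  have h1 : e ∈ A.G.cut U := by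
    rw [A.G.mem_cut_iff U e c, hU, hU]
    exact ⟨fun _ => hn, fun _ => Relation.ReflTransGen.refl⟩
  rw [hW] at h1
  obtain ⟨e', he', rfl⟩ := f.base.mem_cut_pre.1 h1
  exact hc (f.halfE_mem_range (hcut he') he c)

/-- The functional is the sum of the coordinates at the contracted halves used by the path; on
coboundaries it telescopes. -/
theorem Hom.exists_linear_of_reach (f : A ⟶ B) {a b : A.G.V}
    (h : A.G.Reach (Set.range f.hat.onE)ᶜ a b) :
    ∃ Φ : (A.graph.E → ℝ) →ₗ[ℝ] ℝ, (∀ x ∈ orthant _, 0 ≤ Φ x) ∧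
      (∀ y, Φ (Hom.extend f y) = 0) ∧
      ∀ ψ : A.G.V → ℝ, (∀ e ∉ A.pd.exc, ψ (A.G.src e) = ψ (A.G.tgt e)) →
        Φ (A.G.delta A.pd.exc ψ) = ψ b - ψ a := by
  induction h with
  | refl => exact ⟨0, fun _ _ => le_rfl, fun _ => rfl, fun ψ _ => (sub_self _).symm⟩
  | @tail b c _ hbc ih =>
    obtain ⟨Φ, h1, h2, h3⟩ := ih
    rcases hbc with ⟨e, he, hes⟩ | ⟨e, he, b', rfl, rfl, hr⟩
    · refine ⟨Φ, h1, h2, fun ψ hψ => ?_⟩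
      rw [h3 ψ hψ, WGraph.eq_of_ends_eq hψ he hes]
    · refine ⟨Φ + LinearMap.proj (R := ℝ) (A.G.halfE A.pd.exc e he b'),
        fun x hx => add_nonneg (h1 x hx) (hx _), fun y => ?_, fun ψ hψ => ?_⟩
      · rw [LinearMap.add_apply, h2, zero_add]
        exact Hom.extend_apply' f _ _ hr
      · rw [LinearMap.add_apply, h3 ψ hψ]
        change _ + (ψ _ - ψ _) = _
        ring

/-- The edges that are not exceptional or have a contracted half. -/
def Hom.looseEdges (f : A ⟶ B) : Set A.G.E :=
  {e | ∀ he : e ∈ A.pd.exc, ∃ c, A.G.halfE A.pd.exc e he c ∉ Set.range f.hat.onE}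

/-- The same telescoping along an undirected path. Signs replace positivity, and integrality is what
the lattices require. -/
theorem Hom.exists_linear_of_joined (f : A ⟶ B) {a b : A.G.V}
    (h : A.G.Joined f.looseEdges a b) :
    ∃ Φ : (A.graph.E → ℝ) →ₗ[ℝ] ℝ, (∀ x ∈ intLattice _, ∃ k : ℤ, Φ x = k) ∧
      (∀ y, Φ (Hom.extend f y) = 0) ∧
      ∀ ψ : A.G.V → ℝ, (∀ e ∉ A.pd.exc, ψ (A.G.src e) = ψ (A.G.tgt e)) →
        Φ (A.G.delta A.pd.exc ψ) = ψ b - ψ a := by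
  induction h with
  | refl => exact ⟨0, fun _ _ => ⟨0, by simp⟩, fun _ => rfl, fun ψ _ => (sub_self _).symm⟩
  | @tail b c _ hbc ih =>
    obtain ⟨Φ, h1, h2, h3⟩ := ih
    obtain ⟨e, hloose, hes⟩ := hbc
    by_cases he : e ∈ A.pd.exc
    · obtain ⟨b', hb'⟩ := hloose he
      obtain ⟨s, hs⟩ : ∃ s : ℤ, ∀ ψ : A.G.V → ℝ,
          s * (ψ (A.G.endp e b') - ψ (A.G.endp e !b')) = ψ c - ψ b := by
        obtain ⟨c', rfl, rfl⟩ := A.G.exists_endp_of_ends_eq hes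
        rcases Bool.eq_or_eq_not b' c' with rfl | rfl
        · exact ⟨1, fun ψ => by simp⟩
        · exact ⟨-1, fun ψ => by simp⟩
      refine ⟨Φ + (s : ℝ) • LinearMap.proj (R := ℝ) (A.G.halfE A.pd.exc e he b'),
        fun x hx => ?_, fun y => ?_, fun ψ hψ => ?_⟩
      · obtain ⟨k, hk⟩ := h1 x hx
        obtain ⟨m, hm⟩ := hx (A.G.halfE A.pd.exc e he b')
        refine ⟨k + s * m, ?_⟩
        rw [LinearMap.add_apply, LinearMap.smul_apply, LinearMap.proj_apply, hk, hm, smul_eq_mul]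
        push_cast
        rfl
      · rw [LinearMap.add_apply, h2, zero_add, LinearMap.smul_apply, LinearMap.proj_apply,
          Hom.extend_apply' f _ _ hb', smul_zero]
      · rw [LinearMap.add_apply, h3 ψ hψ, LinearMap.smul_apply, LinearMap.proj_apply, smul_eq_mul,
          WGraph.delta_halfE, hs ψ]
        ring
    · refine ⟨Φ, h1, h2, fun ψ hψ => ?_⟩
      rw [h3 ψ hψ, WGraph.eq_of_ends_eq hψ he hes]

theorem Hom.onE_mem_looseEdges (f : A ⟶ B) {e : B.G.E} (he : e ∉ B.pd.exc) :
    f.base.onE e ∈ f.looseEdges := fun h => by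
  obtain ⟨b, -, hb⟩ := f.onE_oldE_of_mem he h
  exact ⟨_, hb⟩

theorem Hom.joined_looseEdges_of_onV_eq (f : A ⟶ B) {a b : A.G.V}
    (h : f.base.onV a = f.base.onV b) : A.G.Joined f.looseEdges a b := by
  refine Spec.joined_mono (fun e he hexc => ⟨false, fun hr => he ?_⟩) ((f.base.fiber a b).1 h)
  exact f.under_mem_range hr

/-- A left inverse on the ambient spaces of `σ` which preserves the lattices. -/
theorem Hom.exists_leftInverse (f : A ⟶ B) :
    ∃ U : ((A.graph.E → ℝ) ⧸ A.G.cutSpace A.pd.exc) →ₗ[ℝ]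
        ((B.graph.E → ℝ) ⧸ B.G.cutSpace B.pd.exc),
      (∀ x ∈ intLattice A.graph.E, ∃ y ∈ intLattice B.graph.E,
        U (Submodule.mkQ _ x) = Submodule.mkQ _ y) ∧
      ∀ y, U (Submodule.mkQ _ (Hom.extend f y)) = Submodule.mkQ _ y := by
  classical
  let T : Finset A.G.E := f.looseEdges.toFinset
  have hT : (T : Set A.G.E) = f.looseEdges := Set.coe_toFinset _
  let root : A.G.V → A.G.V := fun v => (Quotient.mk (A.G.joinedSetoid T) v).out
  have hroot : ∀ v, A.G.Joined f.looseEdges (root v) v := fun v => by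
    have : A.G.Joined (T : Set A.G.E) (root v) v := Quotient.mk_out (s := A.G.joinedSetoid T) v
    rwa [hT] at this
  have hroot' : ∀ v w, A.G.Joined f.looseEdges v w → root v = root w := fun v w h => by
    rw [← hT] at h
    have : Quotient.mk (A.G.joinedSetoid T) v = Quotient.mk (A.G.joinedSetoid T) w :=
      Quotient.sound h
    simp only [root, this]
  choose Φ hΦ1 hΦ2 hΦ3 using fun v => f.exists_linear_of_joined (hroot v)
  -- Here `Φ v` integrates contracted coordinates from the root of the component of `v` under loose
  -- edges. It vanishes on extensions from `B`, so `u` undoes `extend`. It sends `delta ψ` to `ψ v -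
  -- ψ (root v)`; what remains after the subtraction is the coboundary of `ψ ∘ root`, which is
  -- constant along loose edges and so descends to a potential on `B`.
  let u : (A.graph.E → ℝ) →ₗ[ℝ] (B.graph.E → ℝ) :=
    LinearMap.funLeft ℝ ℝ f.hat.onE ∘ₗ
      (LinearMap.id - A.G.delta A.pd.exc ∘ₗ LinearMap.pi Φ)
  have hu : ∀ x h, u x h = x (f.hat.onE h) - A.G.delta A.pd.exc (fun v => Φ v x) (f.hat.onE h) :=
    fun x h => rfl
  have hle : A.G.cutSpace A.pd.exc ≤ (B.G.cutSpace B.pd.exc).comap u := by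
    intro x hx
    obtain ⟨ψ, hψ, rfl⟩ := (A.G.mem_cutSpace_iff _ _).1 hx
    rw [Submodule.mem_comap, WGraph.mem_cutSpace_iff]
    have hux : ∀ h, u (A.G.delta A.pd.exc ψ) h =
        A.G.delta A.pd.exc (fun v => ψ (root v)) (f.hat.onE h) := by
      intro h
      rw [hu]
      have : (fun v => Φ v (A.G.delta A.pd.exc ψ)) = ψ - fun v => ψ (root v) := by
        funext v
        exact hΦ3 v ψ hψ
      rw [this, map_sub, Pi.sub_apply, sub_sub_cancel]
    choose sec hsec using f.base.surjective_onV
    have hχ : ∀ v, ψ (root (sec (f.base.onV v))) = ψ (root v) := fun v => by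
      rw [hroot' _ _ (f.joined_looseEdges_of_onV_eq (hsec (f.base.onV v)))]
    have hloose : ∀ e ∉ B.pd.exc, ∀ b c, ψ (root (A.G.endp (f.base.onE e) b)) =
        ψ (root (A.G.endp (f.base.onE e) c)) := by
      have h1 : ∀ e ∉ B.pd.exc, root (A.G.src (f.base.onE e)) = root (A.G.tgt (f.base.onE e)) :=
        fun e he => hroot' _ _ (Relation.ReflTransGen.single ⟨_, f.onE_mem_looseEdges he, rfl⟩)
      intro e he b c
      have := h1 e he
      cases b <;> cases c <;> simp [this]
    refine ⟨fun w => ψ (root (sec w)), fun e he => ?_, funext fun h => ?_⟩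
    · obtain ⟨ε, hε⟩ := f.base.exists_flip e
      have h0 := hε false
      have h1 := hε true
      rw [WGraph.endp_false] at h0
      rw [WGraph.endp_true] at h1
      beta_reduce
      rw [h0, h1, hχ, hχ]
      exact hloose e he _ _
    · rw [hux]
      obtain ⟨e, he, rfl⟩ | ⟨e, he, b, rfl⟩ := B.G.subdiv_E_cases _ h
      · rw [WGraph.delta_oldE]
        by_cases hA : f.base.onE e ∈ A.pd.exc
        · obtain ⟨b, hb, -⟩ := f.onE_oldE_of_mem he hA
          rw [hb, WGraph.delta_halfE, hloose e he _ (!b), sub_self]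
        · rw [f.onE_oldE_of_notMem he hA, WGraph.delta_oldE]
      · obtain ⟨b₁, h1, h2, -⟩ := f.onE_halfE he b
        obtain ⟨b₂, h3, h4, -⟩ := f.onE_halfE he !b
        have hne : b₁ ≠ b₂ := by
          rintro rfl
          have := f.hat.injective_onE (h1.trans h3.symm)
          rw [WGraph.halfE_inj] at this
          simp at this
        have hb : b₂ = !b₁ := by revert hne; cases b₁ <;> cases b₂ <;> simp
        subst hb
        rw [h1, WGraph.delta_halfE, WGraph.delta_halfE, h2, h4, hχ, hχ]
  refine ⟨Submodule.mapQ _ _ u hle, fun x hx => ⟨u x, fun h => ?_, rfl⟩, fun y => ?_⟩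
  · rw [hu]
    obtain ⟨k, hk⟩ := hx (f.hat.onE h)
    obtain ⟨e, he, h1⟩ | ⟨e, he, b, h1⟩ := A.G.subdiv_E_cases _ (f.hat.onE h)
    · rw [hk, h1, WGraph.delta_oldE]
      exact ⟨k, by simp⟩
    · rw [hk, h1, WGraph.delta_halfE]
      obtain ⟨a, ha⟩ := hΦ1 (A.G.endp e b) x hx
      obtain ⟨a', ha'⟩ := hΦ1 (A.G.endp e !b) x hx
      rw [ha, ha']
      exact ⟨k - (a - a'), by push_cast; rfl⟩
  · change Submodule.mkQ _ (u _) = _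
    congr 1
    funext h
    rw [hu, Hom.extend_apply]
    have : (fun v => Φ v (Hom.extend f y)) = 0 := funext fun v => hΦ2 v y
    rw [this, map_zero, Pi.zero_apply, sub_zero]

/-- Each contracted coordinate is dominated on the orthant by a functional that vanishes on the cut
space and on the image of `f`: the coordinate itself for an ordinary edge, and the sum along a
directed cycle of steps through it for a half. The sum of these functionals cuts out the face,
because its vanishing forces all contracted coordinates to vanish. -/
theorem isFaceMorphism_sigma (f : A ⟶ B) {μ : A.G.V → ℝ} (hA : A.pd.IsSemistable μ)
    (hB : B.pd.IsPolystable (f.base.push μ)) :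
    RPCone.IsFaceMorphism ((sigmaFunctor n).map f.op) := by
  classical
  constructor
  · have hl : ∀ h : A.graph.E, h ∉ Set.range f.hat.onE →
        ∃ l : (A.graph.E → ℝ) →ₗ[ℝ] ℝ, (∀ x ∈ orthant _, x h ≤ l x) ∧
          (∀ y, l (Hom.extend f y) = 0) ∧ A.G.cutSpace A.pd.exc ≤ LinearMap.ker l := by
      intro h hh
      obtain ⟨e, he, rfl⟩ | ⟨e, he, c, rfl⟩ := A.G.subdiv_E_cases _ h
      · refine ⟨LinearMap.proj (R := ℝ) _, fun x _ => le_rfl,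
          fun y => Hom.extend_apply' f _ _ hh, fun x hx => ?_⟩
        obtain ⟨ψ, hψ, rfl⟩ := (A.G.mem_cutSpace_iff _ _).1 hx
        rfl
      · obtain ⟨Φ, h1, h2, h3⟩ :=
          f.exists_linear_of_reach (f.reach_of_notMem_range hA hB he hh)
        refine ⟨Φ + LinearMap.proj (R := ℝ) (A.G.halfE A.pd.exc e he c), fun x hx => ?_,
          fun y => ?_, fun x hx => ?_⟩
        · rw [LinearMap.add_apply, LinearMap.proj_apply]
          linarith [h1 x hx]
        · rw [LinearMap.add_apply, h2, LinearMap.proj_apply, Hom.extend_apply' f _ _ hh, add_zero]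
        · obtain ⟨ψ, hψ, rfl⟩ := (A.G.mem_cutSpace_iff _ _).1 hx
          rw [LinearMap.mem_ker, LinearMap.add_apply, h3 ψ hψ, LinearMap.proj_apply,
            WGraph.delta_halfE]
          ring
    choose l hl1 hl2 hl3 using hl
    let L : (A.graph.E → ℝ) →ₗ[ℝ] ℝ :=
      ∑ h : A.graph.E, if hh : h ∈ Set.range f.hat.onE then 0 else l h hh
    have hL : ∀ x, L x = ∑ h : A.graph.E,
        if hh : h ∈ Set.range f.hat.onE then 0 else l h hh x := by
      intro x
      rw [LinearMap.sum_apply]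
      refine Finset.sum_congr rfl fun h _ => ?_
      split_ifs <;> rfl
    have hker : A.G.cutSpace A.pd.exc ≤ LinearMap.ker L := by
      intro x hx
      rw [LinearMap.mem_ker, hL]
      refine Finset.sum_eq_zero fun h _ => ?_
      split_ifs with hh
      exacts [rfl, hl3 h hh hx]
    have hnn : ∀ x ∈ orthant A.graph.E, ∀ h, 0 ≤
        if hh : h ∈ Set.range f.hat.onE then 0 else l h hh x := by
      intro x hx h
      split_ifs with hh
      exacts [le_rfl, (hx h).trans (hl1 h hh x hx)]
    refine ⟨(A.G.cutSpace A.pd.exc).liftQ L hker, ?_, ?_⟩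
    · rintro _ ⟨x, hx, rfl⟩
      change 0 ≤ L x
      rw [hL]
      exact Finset.sum_nonneg fun h _ => hnn x hx h
    · ext z
      constructor
      · rintro ⟨⟨x, hx, rfl⟩, h0⟩
        have h0 : L x = 0 := h0
        rw [hL, Finset.sum_eq_zero_iff_of_nonneg fun h _ => hnn x hx h] at h0
        refine ⟨⟨Submodule.mkQ _ (x ∘ f.hat.onE), x ∘ f.hat.onE, fun h => hx _, rfl⟩, ?_⟩
        change Submodule.mkQ _ (Hom.extend f (x ∘ f.hat.onE)) = Submodule.mkQ _ x
        rw [Hom.extend_comp_onE f]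
        intro h hh
        have := h0 h (Finset.mem_univ h)
        rw [dif_neg hh] at this
        exact le_antisymm ((hl1 h hh x hx).trans this.le) (hx h)
      · rintro ⟨⟨_, y, hy, rfl⟩, rfl⟩
        refine ⟨⟨Hom.extend f y, Hom.extend_orthant f hy, rfl⟩, ?_⟩
        change L (Hom.extend f y) = 0
        rw [hL]
        refine Finset.sum_eq_zero fun h _ => ?_
        split_ifs with hh
        exacts [rfl, hl2 h hh y]
  · obtain ⟨U, h1, h2⟩ := f.exists_leftInverse
    refine ⟨U, ?_, ?_⟩
    · rintro _ ⟨x, hx, rfl⟩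
      obtain ⟨y, hy, h⟩ := h1 x hx
      exact ⟨y, hy, h.symm⟩
    · rintro ⟨_, y, hy, rfl⟩
      exact h2 y

end Triple

namespace UnivPolarization

variable {g n : ℕ} {d : ℤ} (μ : UnivPolarization g n d)

theorem isFaceMorphism_diagramJ [NeZero n] {A B : μ.QD} (f : A ⟶ B) :
    RPCone.IsFaceMorphism (μ.diagramJ.map f.op) :=
  Triple.isFaceMorphism_tau (μ.isQD.ι.map f)

theorem isPolystable_of_hom {A B : Triple n} (hA : A.G.IsStable g) (hB : μ.isPSD B) (f : A ⟶ B) :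
    B.pd.IsPolystable (f.base.push (μ.val A.G hA)) := by
  obtain ⟨h, hB⟩ := hB
  rw [μ.push_eq _ _ hA h]
  exact hB

theorem isFaceMorphism_diagramP {A B : μ.PSD} (f : A ⟶ B) :
    RPCone.IsFaceMorphism (μ.diagramP.map f.op) := by
  obtain ⟨hA, hA'⟩ := A.2
  exact Triple.isFaceMorphism_sigma (μ.isPSD.ι.map f) hA'.isSemistable
    (μ.isPolystable_of_hom hA B.2 _)

end UnivPolarization

end TropJac

end

/-! ### Finiteness of the diagrams up to isomorphism. -/

noncomputable section

namespace TropJac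

namespace Spec

variable {n : ℕ} {G H : WGraph n}

/-- An isomorphism of graphs which preserves the reference orientations, as a specialization. -/
def ofEquiv (a : G.V ≃ H.V) (b : H.E ≃ G.E) (hsrc : ∀ e, H.src e = a (G.src (b e)))
    (htgt : ∀ e, H.tgt e = a (G.tgt (b e))) (hw : ∀ v, H.weight (a v) = G.weight v)
    (hl : ∀ i, H.leg i = a (G.leg i)) : Spec G H where
  onV := a
  onE := b
  surjective_onV := a.surjective
  injective_onE := b.injective
  ends_eq e := by rw [WGraph.ends, hsrc, htgt]; rfl
  fiber v w := by
    rw [b.surjective.range_eq, Set.compl_univ]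
    constructor
    · intro h
      rw [a.injective h]
      exact Relation.ReflTransGen.refl
    · intro h
      induction h with
      | refl => rfl
      | tail _ h _ => obtain ⟨e, he, _⟩ := h; exact absurd he (Set.notMem_empty e)
  weight_eq x := by
    obtain ⟨v, rfl⟩ := a.surjective x
    have h : ∀ e : G.E, ¬ ∀ e', b e' ≠ e := fun e he => he (b.symm e) (b.apply_symm_apply e)
    simp [hw, h, Finset.filter_eq', Finset.sum_singleton]
  leg_eq := hl

end Spec

namespace WGraph

variable {n : ℕ}

theorem IsStable.sum_eq {G : WGraph n} {g : ℕ} (h : G.IsStable g) :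
    ∑ v, (2 * (G.weight v : ℤ) - 2 + G.degIn Finset.univ v + G.legs v) = 2 * g - 2 + n := by
  have h1 := h.2.1
  rw [genus, b1, h.1.b0_eq] at h1
  have h2 : ∑ v, (G.degIn Finset.univ v : ℤ) = 2 * Fintype.card G.E := by
    have h3 := G.sum_degIn Finset.univ Finset.univ
    have h4 : ∑ v, (G.degIn Finset.univ v : ℝ) = 2 * Fintype.card G.E := by
      rw [h3]
      simp only [Finset.mem_univ, if_true, Finset.sum_const, Finset.card_univ, nsmul_eq_mul]
      ring
    exact_mod_cast h4
  have h3 : ∑ v, (G.legs v : ℤ) = n := by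
    have h4 : ∑ v, G.legs v = n := by
      have := Finset.card_eq_sum_card_fiberwise (f := G.leg) (s := Finset.univ)
        (t := Finset.univ) fun _ _ => Finset.mem_univ _
      rw [Finset.card_univ, Fintype.card_fin] at this
      exact this.symm
    exact_mod_cast h4
  rw [Finset.sum_add_distrib, Finset.sum_add_distrib, Finset.sum_sub_distrib, ← Finset.mul_sum, h2,
    h3]
  simp only [Finset.sum_const, Finset.card_univ, nsmul_eq_mul]
  push_cast at h1
  linarith

/-- The positive integers 2w - 2 + deg + legs have sum 2g - 2 + n, which bounds the number of
vertices. The genus formula then bounds edges and weights. The common bound is generous. -/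
theorem IsStable.card_le {G : WGraph n} {g : ℕ} (h : G.IsStable g) :
    Fintype.card G.V ≤ 3 * g + n ∧ Fintype.card G.E ≤ 3 * g + n ∧
      ∀ v, G.weight v ≤ 3 * g + n := by
  have h0 := h.sum_eq
  have h1 : (Fintype.card G.V : ℤ) ≤ 2 * g - 2 + n := by
    rw [← h0]
    have : (Fintype.card G.V : ℤ) = ∑ _v : G.V, 1 := by simp
    rw [this]
    exact Finset.sum_le_sum fun v _ => h.2.2 v
  have h2 := h.2.1
  rw [genus, b1, h.1.b0_eq] at h2
  push_cast at h2
  have h3 : 0 ≤ ∑ v, (G.weight v : ℤ) := Finset.sum_nonneg fun v _ => by positivity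
  refine ⟨by omega, by omega, fun v => ?_⟩
  have h4 : (G.weight v : ℤ) ≤ ∑ v, (G.weight v : ℤ) :=
    Finset.single_le_sum (f := fun v => (G.weight v : ℤ)) (fun v _ => by positivity)
      (Finset.mem_univ v)
  omega

/-- The data of a graph with at most `N` vertices and edges and with weights at most `N`. -/
abbrev Code (n N : ℕ) : Type := Σ k m : Fin (N + 1),
  (Fin m → Fin k) × (Fin m → Fin k) × (Fin k → Fin (N + 1)) × (Fin n → Fin k)

/-- The graph with the given data. -/
def ofCode {N : ℕ} (c : Code n N) : WGraph n where
  V := Fin c.1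
  E := Fin c.2.1
  src := c.2.2.1
  tgt := c.2.2.2.1
  weight v := c.2.2.2.2.1 v
  leg := c.2.2.2.2.2

/-- Up to isomorphism, there are finitely many stable graphs. -/
theorem IsStable.exists_code {G : WGraph n} {g : ℕ} (h : G.IsStable g) :
    ∃ (c : Code n (3 * g + n)) (k : Spec G (ofCode c)), Function.Surjective k.onE ∧
      ∀ e b, (ofCode c).endp e b = k.onV (G.endp (k.onE e) b) := by
  obtain ⟨h1, h2, h3⟩ := h.card_le
  let a := Fintype.equivFin G.V
  let b := (Fintype.equivFin G.E).symm
  let c : Code n (3 * g + n) := ⟨⟨_, Nat.lt_succ_of_le h1⟩, ⟨_, Nat.lt_succ_of_le h2⟩,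
    fun e => a (G.src (b e)), fun e => a (G.tgt (b e)),
    fun v => ⟨G.weight (a.symm v), Nat.lt_succ_of_le (h3 _)⟩, fun i => a (G.leg i)⟩
  refine ⟨c, Spec.ofEquiv (H := ofCode c) a b (fun _ => rfl) (fun _ => rfl) (fun v => ?_)
    fun _ => rfl, b.surjective, fun e c => ?_⟩
  · change G.weight (a.symm (a v)) = _
    rw [a.symm_apply_apply]
  · cases c <;> rfl

end WGraph

namespace PseudoDiv

variable {n : ℕ} {G : WGraph n}

/-- The invariant of `{v}` bounds the value at `v` from below, and the invariant of the complement,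
together with the total degree, bounds it from above. -/
theorem IsSemistable.abs_div_le {P : PseudoDiv G} {μ : G.V → ℝ} (h : P.IsSemistable μ) (v : G.V) :
    |(P.div (G.oldV P.exc v) : ℝ) - μ v| ≤ 2 * Fintype.card G.E := by
  have hb : ∀ W, P.betaExc μ W ≤ ∑ v ∈ W, ((P.div (G.oldV P.exc v) : ℝ) - μ v) +
      Fintype.card G.E / 2 := by
    intro W
    rw [betaExc_formula]
    refine add_le_add le_rfl ?_
    have : (Fintype.card G.E / 2 : ℝ) = ∑ _e : G.E, (1 / 2 : ℝ) := by simp [div_eq_mul_inv]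
    rw [this]
    refine Finset.sum_le_sum fun e _ => ?_
    split_ifs <;> norm_num
  have hdeg := (P.hasDegreeOf_iff μ).1 h.1
  have hexc : (P.exc.card : ℝ) ≤ Fintype.card G.E := by exact_mod_cast P.exc.card_le_univ
  have h1 := (h.2 {v}).trans (hb {v})
  have h2 := (h.2 {v}ᶜ).trans (hb {v}ᶜ)
  rw [Finset.sum_singleton] at h1
  have h3 := Finset.sum_add_sum_compl {v} fun v => (P.div (G.oldV P.exc v) : ℝ) - μ v
  have h5 : ∑ v, ((P.div (G.oldV P.exc v) : ℝ) - μ v) = P.exc.card := by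
    rw [Finset.sum_sub_distrib, hdeg, add_sub_cancel_left]
  rw [Finset.sum_singleton, h5] at h3
  have h4 : (0 : ℝ) ≤ Fintype.card G.E := by positivity
  rw [abs_le]
  constructor <;> linarith

theorem finite_isSemistable (μ : G.V → ℝ) : {P : PseudoDiv G | P.IsSemistable μ}.Finite := by
  let F : PseudoDiv G → Finset G.E × (G.V → ℤ) := fun P => (P.exc, fun v => P.div (G.oldV P.exc v))
  have hF : Function.Injective F := by
    rintro ⟨S, D, hD⟩ ⟨T, D', hD'⟩ h
    obtain rfl : S = T := congrArg Prod.fst h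
    obtain rfl : D = D' := ext_of_old (fun e h => hD ⟨e, h⟩) (fun e h => hD' ⟨e, h⟩)
      fun v => congrFun (congrArg Prod.snd h) v
    rfl
  refine Set.Finite.of_finite_image ?_ hF.injOn
  refine Set.Finite.subset (Set.Finite.prod (Set.toFinite Set.univ)
    (Set.Finite.pi fun v => Set.finite_Icc ⌈μ v - 2 * Fintype.card G.E⌉
      ⌊μ v + 2 * Fintype.card G.E⌋)) ?_
  rintro _ ⟨P, hP, rfl⟩
  refine ⟨trivial, fun v _ => ?_⟩
  have := abs_le.1 (IsSemistable.abs_div_le hP v)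
  rw [Set.mem_Icc, Int.ceil_le, Int.le_floor]
  constructor <;> linarith

end PseudoDiv

namespace Triple

variable {n : ℕ}

theorem finite_hom (A B : Triple n) : Finite (A ⟶ B) := by
  let F : (A ⟶ B) → (A.G.V → B.G.V) × (B.G.E → A.G.E) × (B.graph.E → A.graph.E) :=
    fun f => (f.base.onV, f.base.onE, f.hat.onE)
  refine Finite.of_injective F fun f f' h => ?_
  exact Hom.ext_of_onE (Spec.ext (congrArg Prod.fst h) (congrArg (fun p => p.2.1) h))
    (congrArg (fun p => p.2.2) h)

theorem exists_iso_of_spec (A : Triple n) {H : WGraph n} (k : Spec A.G H)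
    (hs : Function.Surjective k.onE)
    (hk : ∀ e b, H.endp e b = k.onV (A.G.endp (k.onE e) b)) :
    ∃ P : PseudoDiv H, Nonempty (A ≅ ⟨H, P⟩) := by
  obtain ⟨P, f, -, hf, -⟩ := exists_hom_of_range A k hk ∅ fun e => by
    refine ⟨fun _ => ?_, fun _ => hs e⟩
    by_cases he : e ∈ A.pd.exc
    · exact ⟨A.G.halfE A.pd.exc e he false, rfl, Set.notMem_empty _⟩
    · exact ⟨A.G.oldE A.pd.exc e he, rfl, Set.notMem_empty _⟩
  obtain ⟨i, -⟩ := exists_iso_of_range_eq (𝟙 A) f (by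
    rw [hf, Set.compl_empty]
    exact Set.range_id)
  exact ⟨P, ⟨i⟩⟩

end Triple

namespace UnivPolarization

variable {g n : ℕ} {d : ℤ} (μ : UnivPolarization g n d)

theorem isQD_of_iso [NeZero n] {A B : Triple n} (i : A ≅ B) (h : μ.isQD A) : μ.isQD B := by
  obtain ⟨hA, h⟩ := h
  exact μ.isQD_of_hom hA i.hom (i.hom.isQuasistable h)

theorem isPSD_of_iso {A B : Triple n} (i : A ≅ B) (h : μ.isPSD A) : μ.isPSD B := by
  obtain ⟨hA, h⟩ := h
  refine ⟨i.hom.base.isStable hA, ?_⟩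
  rw [← μ.push_eq _ _ hA _ i.hom.base]
  refine i.hom.isPolystable h fun e he => ?_
  have h1 := i.inv.exc_subset _ he
  have h2 : (i.inv ≫ i.hom).base.onE e = e := by rw [i.inv_hom_id]; rfl
  rwa [← h2]

/-- Every stable graph is isomorphic to one of finitely many coded graphs, each of which carries
finitely many semistable pseudo-divisors; a triple is transported along the isomorphism of graphs.
-/
theorem exists_finite_representatives (p : ObjectProperty (Triple n))
    (hp : ∀ A, p A → ∃ h : A.G.IsStable g, A.pd.IsSemistable (μ.val A.G h))
    (hiso : ∀ A B, (A ≅ B) → p A → p B) :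
    ∃ s : Set p.FullSubcategory, s.Finite ∧ ∀ x, ∃ y ∈ s, Nonempty (x ≅ y) := by
  let s₀ : Set (Triple n) := ⋃ (c : WGraph.Code n (3 * g + n))
    (h : (WGraph.ofCode c).IsStable g),
    Triple.mk (WGraph.ofCode c) '' {P | P.IsSemistable (μ.val _ h)}
  have hs₀ : s₀.Finite := Set.finite_iUnion fun c => Set.finite_iUnion fun h =>
    (PseudoDiv.finite_isSemistable _).image _
  refine ⟨ObjectProperty.FullSubcategory.obj ⁻¹' s₀, hs₀.preimage ?_, fun x => ?_⟩
  · rintro ⟨A, hA⟩ - ⟨B, hB⟩ - (rfl : A = B)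
    rfl
  · obtain ⟨hx, -⟩ := hp x.obj x.2
    obtain ⟨c, k, hk, hk'⟩ := hx.exists_code
    obtain ⟨P, ⟨i⟩⟩ := x.obj.exists_iso_of_spec k hk hk'
    have hy := hiso _ _ i x.2
    obtain ⟨h1, h2⟩ := hp _ hy
    refine ⟨⟨_, hy⟩, Set.mem_iUnion₂.2 ⟨c, h1, P, h2, rfl⟩, ⟨?_⟩⟩
    exact p.fullyFaithfulι.preimageIso i

theorem isGeneralizedConeComplex_diagramJ [NeZero n] :
    IsGeneralizedConeComplex μ.diagramJ where
  face f := μ.isFaceMorphism_diagramJ f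
  finite_obj := μ.exists_finite_representatives μ.isQD
    (fun _ ⟨h, hA⟩ => ⟨h, hA.isSemistable⟩) fun _ _ i => μ.isQD_of_iso i
  finite_hom x y := by
    have : Finite (μ.isQD.ι.obj x ⟶ μ.isQD.ι.obj y) := Triple.finite_hom x.obj y.obj
    exact Finite.of_injective (μ.isQD.ι.map : (x ⟶ y) → _) μ.isQD.ι.map_injective

theorem isGeneralizedConeComplex_diagramP : IsGeneralizedConeComplex μ.diagramP where
  face f := μ.isFaceMorphism_diagramP f
  finite_obj := μ.exists_finite_representatives μ.isPSD
    (fun _ ⟨h, hA⟩ => ⟨h, hA.isSemistable⟩) fun _ _ i => μ.isPSD_of_iso i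
  finite_hom x y := by
    have : Finite (μ.isPSD.ι.obj x ⟶ μ.isPSD.ι.obj y) := Triple.finite_hom x.obj y.obj
    exact Finite.of_injective (μ.isPSD.ι.map : (x ⟶ y) → _) μ.isPSD.ι.map_injective

end UnivPolarization

end TropJac

end

/-! ### Rational functions on tropical curves and combinatorial linear equivalence. -/

noncomputable section

namespace TropJac

section Slopes

/-- On a small interval to the right of `t`, the function is affine with slope `m`. -/
def RightSlope (k : ℝ → ℝ) (t m : ℝ) : Prop :=
  ∃ ε > 0, ∀ s ∈ Set.Icc 0 ε, k (t + s) = k t + m * s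

/-- On a small interval to the left of `t`, the function is affine with outgoing slope `m`. -/
def LeftSlope (k : ℝ → ℝ) (t m : ℝ) : Prop :=
  ∃ ε > 0, ∀ s ∈ Set.Icc 0 ε, k (t - s) = k t + m * s

variable {k k' : ℝ → ℝ} {t m m' L : ℝ}

theorem RightSlope.add (h : RightSlope k t m) (h' : RightSlope k' t m') :
    RightSlope (fun t => k t + k' t) t (m + m') := by
  obtain ⟨ε, hε, h⟩ := h
  obtain ⟨ε', hε', h'⟩ := h'
  refine ⟨min ε ε', lt_min hε hε', fun s hs => ?_⟩
  beta_reduce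
  rw [h s ⟨hs.1, hs.2.trans (min_le_left _ _)⟩, h' s ⟨hs.1, hs.2.trans (min_le_right _ _)⟩]
  ring

theorem LeftSlope.add (h : LeftSlope k t m) (h' : LeftSlope k' t m') :
    LeftSlope (fun t => k t + k' t) t (m + m') := by
  obtain ⟨ε, hε, h⟩ := h
  obtain ⟨ε', hε', h'⟩ := h'
  refine ⟨min ε ε', lt_min hε hε', fun s hs => ?_⟩
  beta_reduce
  rw [h s ⟨hs.1, hs.2.trans (min_le_left _ _)⟩, h' s ⟨hs.1, hs.2.trans (min_le_right _ _)⟩]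
  ring

theorem RightSlope.const_mul (c : ℝ) (h : RightSlope k t m) :
    RightSlope (fun t => c * k t) t (c * m) := by
  obtain ⟨ε, hε, h⟩ := h
  refine ⟨ε, hε, fun s hs => ?_⟩
  beta_reduce
  rw [h s hs]
  ring

theorem LeftSlope.const_mul (c : ℝ) (h : LeftSlope k t m) :
    LeftSlope (fun t => c * k t) t (c * m) := by
  obtain ⟨ε, hε, h⟩ := h
  refine ⟨ε, hε, fun s hs => ?_⟩
  beta_reduce
  rw [h s hs]
  ring

theorem rightSlope_affine (a c t : ℝ) : RightSlope (fun t => a + c * t) t c :=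
  ⟨1, one_pos, fun s _ => by ring⟩

theorem leftSlope_affine (a c t : ℝ) : LeftSlope (fun t => a + c * t) t (-c) :=
  ⟨1, one_pos, fun s _ => by ring⟩

theorem rightSlope_max (p t : ℝ) :
    RightSlope (fun t => max (t - p) 0) t (if p ≤ t then 1 else 0) := by
  split_ifs with h
  · refine ⟨1, one_pos, fun s hs => ?_⟩
    have := hs.1
    beta_reduce
    rw [max_eq_left (by linarith), max_eq_left (by linarith)]
    ring
  · refine ⟨p - t, by linarith, fun s hs => ?_⟩
    have := hs.2
    beta_reduce
    rw [max_eq_right (by linarith), max_eq_right (by linarith)]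
    ring

theorem leftSlope_max (p t : ℝ) :
    LeftSlope (fun t => max (t - p) 0) t (if p < t then -1 else 0) := by
  split_ifs with h
  · refine ⟨t - p, by linarith, fun s hs => ?_⟩
    have := hs.2
    beta_reduce
    rw [max_eq_left (by linarith), max_eq_left (by linarith)]
    ring
  · refine ⟨1, one_pos, fun s hs => ?_⟩
    have := hs.1
    beta_reduce
    rw [max_eq_right (by linarith), max_eq_right (by linarith)]
    ring

theorem RightSlope.congr (h : RightSlope k t m) (ht : t ∈ Set.Ico 0 L)
    (hk : ∀ s ∈ Set.Icc 0 L, k' s = k s) : RightSlope k' t m := by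
  obtain ⟨ε, hε, h⟩ := h
  have h2 := ht.1
  refine ⟨min ε (L - t), lt_min hε (sub_pos.2 ht.2), fun s hs => ?_⟩
  have h1 := hs.1
  have h3 := hs.2.trans (min_le_right _ _)
  rw [hk _ ⟨by linarith, by linarith⟩, hk _ ⟨h2, ht.2.le⟩, h s ⟨h1, hs.2.trans (min_le_left _ _)⟩]

theorem LeftSlope.congr (h : LeftSlope k t m) (ht : t ∈ Set.Ioc 0 L)
    (hk : ∀ s ∈ Set.Icc 0 L, k' s = k s) : LeftSlope k' t m := by
  obtain ⟨ε, hε, h⟩ := h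
  have h2 := ht.2
  refine ⟨min ε t, lt_min hε ht.1, fun s hs => ?_⟩
  have h1 := hs.1
  have h3 := hs.2.trans (min_le_right _ _)
  rw [hk _ ⟨by linarith, by linarith⟩, hk _ ⟨ht.1.le, h2⟩, h s ⟨h1, hs.2.trans (min_le_left _ _)⟩]

/-- Two different points to the left of `t` in the affine range both have value `c`; this determines
the slope and the value at `t`. -/
theorem LeftSlope.eq_of_const {c : ℝ} (h : LeftSlope k t m) (ht : 0 < t)
    (hc : ∀ s ∈ Set.Ico 0 t, k s = c) : k t = c ∧ m = 0 := by
  obtain ⟨ε, hε, h⟩ := h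
  set r := min ε t with hr
  have hr0 : 0 < r := lt_min hε ht
  have hr1 : r ≤ ε := min_le_left _ _
  have hr2 : r ≤ t := min_le_right _ _
  have h1 := h r ⟨hr0.le, hr1⟩
  have h2 := h (r / 2) ⟨by linarith, by linarith⟩
  rw [hc _ ⟨by linarith, by linarith⟩] at h1 h2
  have h3 : m * r = 0 := by linarith
  have h4 : m = 0 := (mul_eq_zero.1 h3).resolve_right hr0.ne'
  subst h4
  exact ⟨by linarith, rfl⟩

/-- A piecewise affine function on an interval, with initial slope zero and without bends, is
constant. -/
theorem eq_of_slopes (hL : 0 < L) {a b : ℝ → ℝ} (ha : ∀ t ∈ Set.Ico 0 L, RightSlope k t (a t))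
    (hb : ∀ t ∈ Set.Ioc 0 L, LeftSlope k t (b t)) (hab : ∀ t ∈ Set.Ioo 0 L, a t + b t = 0)
    (h0 : a 0 = 0) : k L = k 0 ∧ b L = 0 := by
  -- Continuous induction: the function is still constant at the supremum of `T` by its left slope
  -- there, and without a bend at a supremum smaller than `L` the constancy would extend further.
  let T : Set ℝ := {t | t ∈ Set.Icc 0 L ∧ ∀ u ∈ Set.Icc 0 t, k u = k 0}
  have hT0 : (0 : ℝ) ∈ T := ⟨⟨le_rfl, hL.le⟩, fun u hu => by rw [le_antisymm hu.2 hu.1]⟩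
  have hTb : BddAbove T := ⟨L, fun t ht => ht.1.2⟩
  set τ := sSup T with hτ
  have hτ0 : 0 ≤ τ := le_csSup hTb hT0
  have hτL : τ ≤ L := csSup_le ⟨0, hT0⟩ fun t ht => ht.1.2
  have hlt : ∀ u ∈ Set.Ico 0 τ, k u = k 0 := by
    intro u hu
    obtain ⟨t, ht, hut⟩ := exists_lt_of_lt_csSup ⟨0, hT0⟩ hu.2
    exact ht.2 u ⟨hu.1, hut.le⟩
  have hpos : 0 < τ → k τ = k 0 ∧ b τ = 0 := fun h =>
    (hb τ ⟨h, hτL⟩).eq_of_const h hlt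
  have hk : k τ = k 0 := by
    rcases hτ0.eq_or_lt with h | h
    · rw [← h]
    · exact (hpos h).1
  have hτeq : τ = L := by
    by_contra hne
    have hlt' : τ < L := lt_of_le_of_ne hτL hne
    have haτ : a τ = 0 := by
      rcases hτ0.eq_or_lt with h | h
      · rw [← h, h0]
      · have := hab τ ⟨h, hlt'⟩
        rw [(hpos h).2, add_zero] at this
        exact this
    obtain ⟨ε, hε, h⟩ := ha τ ⟨hτ0, hlt'⟩
    rw [haτ] at h
    have hmem : τ + min ε (L - τ) ∈ T := by
      have h1 : min ε (L - τ) ≤ L - τ := min_le_right _ _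
      have h2 : 0 < min ε (L - τ) := lt_min hε (sub_pos.2 hlt')
      refine ⟨⟨by linarith, by linarith⟩, fun u hu => ?_⟩
      by_cases hu' : u < τ
      · exact hlt u ⟨hu.1, hu'⟩
      · have h3 := hu.2
        have h4 : min ε (L - τ) ≤ ε := min_le_left _ _
        have := h (u - τ) ⟨by linarith, by linarith⟩
        rw [add_sub_cancel, zero_mul, add_zero] at this
        rw [this, hk]
    have h1 := le_csSup hTb hmem
    have h2 : 0 < min ε (L - τ) := lt_min hε (sub_pos.2 hlt')
    linarith
  rw [hτeq] at hpos
  exact hpos hL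

end Slopes

namespace PseudoDiv

variable {n : ℕ} {Γ : WGraph n} (Q R : PseudoDiv Γ)

/-- The length of a half of an exceptional edge, and zero for the other edges. -/
def partLength (x : Q.graph.E → ℝ) (e : Γ.E) (b : Bool) : ℝ :=
  if h : e ∈ Q.exc then x (Γ.halfE Q.exc e h b) else 0

/-- The indicator function of the exceptional edges. -/
def ind (e : Γ.E) : ℤ := if e ∈ Q.exc then 1 else 0

variable {Q}

theorem totalLength_of_mem (x : Q.graph.E → ℝ) {e : Γ.E} (he : e ∈ Q.exc) :
    Q.totalLength x e = x (Γ.halfE Q.exc e he false) + x (Γ.halfE Q.exc e he true) := by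
  rw [totalLength, Finset.sum_filter, Γ.sum_subdiv_E]
  rw [Finset.sum_eq_single e]
  · rw [dif_pos he]
    simp
  · intro e' _ hne
    by_cases h : e' ∈ Q.exc
    · rw [dif_pos h]; simp [hne]
    · rw [dif_neg h]; simp [hne]
  · intro h; exact absurd (Finset.mem_univ _) h

theorem totalLength_of_notMem (x : Q.graph.E → ℝ) {e : Γ.E} (he : e ∉ Q.exc) :
    Q.totalLength x e = x (Γ.oldE Q.exc e he) := by
  rw [totalLength, Finset.sum_filter, Γ.sum_subdiv_E]
  rw [Finset.sum_eq_single e]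
  · rw [dif_neg he]
    simp
  · intro e' _ hne
    by_cases h : e' ∈ Q.exc
    · rw [dif_pos h]; simp [hne]
    · rw [dif_neg h]; simp [hne]
  · intro h; exact absurd (Finset.mem_univ _) h

theorem totalLength_pos {x : Q.graph.E → ℝ} (hx : x ∈ openOrthant _) (e : Γ.E) :
    0 < Q.totalLength x e := by
  by_cases he : e ∈ Q.exc
  · rw [totalLength_of_mem x he]
    exact add_pos (hx _) (hx _)
  · rw [totalLength_of_notMem x he]
    exact hx _

theorem ind_partLength_cases {x : Q.graph.E → ℝ} (hx : x ∈ openOrthant _) (e : Γ.E) :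
    (e ∉ Q.exc ∧ Q.ind e = 0 ∧ ∀ b, Q.partLength x e b = 0) ∨
    (e ∈ Q.exc ∧ Q.ind e = 1 ∧ (∀ b, 0 < Q.partLength x e b) ∧
      Q.partLength x e false + Q.partLength x e true = Q.totalLength x e) := by
  by_cases he : e ∈ Q.exc
  · right
    refine ⟨he, if_pos he, fun b => ?_, ?_⟩
    · rw [partLength, dif_pos he]
      exact hx _
    · rw [totalLength_of_mem x he, partLength, partLength, dif_pos he, dif_pos he]
  · left
    exact ⟨he, if_neg he, fun b => dif_neg he⟩

/-- The combinatorial form of linear equivalence of unitary divisors on a graph with edge lengths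
`ℓ`: here `φ` gives the values at the vertices of a rational function, and `s` its slopes at the
sources of the edges. -/
def IsLinEquiv (ℓ : Γ.E → ℝ) (Q : PseudoDiv Γ) (x : Q.graph.E → ℝ) (R : PseudoDiv Γ)
    (y : R.graph.E → ℝ) : Prop :=
  ∃ (φ : Γ.V → ℝ) (s : Γ.E → ℤ),
    (∀ e, φ (Γ.tgt e) - φ (Γ.src e) =
      s e * ℓ e - Q.partLength x e true + R.partLength y e true) ∧
    ∀ v, Q.div (Γ.oldV Q.exc v) - R.div (Γ.oldV R.exc v) =
      ∑ e, ((if Γ.src e = v then s e else 0) +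
        (if Γ.tgt e = v then -s e + Q.ind e - R.ind e else 0))

end PseudoDiv

namespace TropCurve

variable {n : ℕ} {X : TropCurve n} {Q R : PseudoDiv X.G} {x : Q.graph.E → ℝ}
  {y : R.graph.E → ℝ}

theorem unitaryDivisor_inr (x : Q.graph.E → ℝ) (p : Σ e : X.G.E, Set.Ioo (0 : ℝ) (X.len e)) :
    Q.unitaryDivisor (X := X) x (Sum.inr p) =
      -if (p.2 : ℝ) = Q.partLength x p.1 false then Q.ind p.1 else 0 := by
  have key : Q.unitaryDivisor (X := X) x (Sum.inr p) =
      if ∃ h : p.1 ∈ Q.exc, (p.2 : ℝ) = x (X.G.halfE Q.exc p.1 h false) then -1 else 0 := by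
    unfold PseudoDiv.unitaryDivisor
    rw [Sum.elim_inr]
    congr
  rw [key]
  by_cases h : p.1 ∈ Q.exc
  · rw [PseudoDiv.partLength, PseudoDiv.ind, dif_pos h, if_pos h]
    by_cases h' : (p.2 : ℝ) = x (X.G.halfE Q.exc p.1 h false)
    · rw [if_pos ⟨h, h'⟩, if_pos h']
    · rw [if_neg fun ⟨_, h''⟩ => h' h'', if_neg h', neg_zero]
  · rw [if_neg fun ⟨h', _⟩ => h h', PseudoDiv.ind, if_neg h, ite_self, neg_zero]

theorem along_zero (f : X.Point → ℝ) (e : X.G.E) : along f e 0 = f (Sum.inl (X.G.src e)) := by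
  unfold along
  rw [dif_neg fun h => lt_irrefl _ h.1, if_pos le_rfl]

theorem along_len (f : X.Point → ℝ) (e : X.G.E) :
    along f e (X.len e) = f (Sum.inl (X.G.tgt e)) := by
  unfold along
  rw [dif_neg fun h => lt_irrefl _ h.2, if_neg (not_le.2 (X.len_pos e))]

theorem along_of_mem (f : X.Point → ℝ) (e : X.G.E) {t : ℝ} (ht : t ∈ Set.Ioo 0 (X.len e)) :
    along f e t = f (Sum.inr ⟨e, t, ht⟩) := by
  unfold along
  rw [dif_pos ht]

theorem isLinEquiv_of_linEquiv (hx : x ∈ openOrthant _) (hy : y ∈ openOrthant _)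
    (hQ : Q.totalLength x = X.len) (hR : R.totalLength y = X.len)
    (h : LinEquiv (Q.unitaryDivisor (X := X) x) (R.unitaryDivisor y)) :
    PseudoDiv.IsLinEquiv X.len Q x R y := by
  obtain ⟨f, hf⟩ := h
  have key : ∀ e, f.val (Sum.inl (X.G.tgt e)) - f.val (Sum.inl (X.G.src e)) =
      f.up e 0 * X.len e - Q.partLength x e true + R.partLength y e true ∧
      f.down e (X.len e) = -f.up e 0 + Q.ind e - R.ind e := by
    intro e
    set p := Q.partLength x e false
    set p' := R.partLength y e false
    -- The initial slope is subtracted, and hinges cancel the bends at the exceptional points of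
    -- both divisors, so `k` is constant and comparing the ends of the edge gives the claim. On an
    -- edge without an exceptional point, `ind` is zero and the default position 0 has no effect.
    let k : ℝ → ℝ := fun t => along f.val e t + ((0 + -f.up e 0 * t) +
      (Q.ind e * max (t - p) 0 + (-R.ind e) * max (t - p') 0))
    have hk := eq_of_slopes (k := k) (X.len_pos e)
      (a := fun t => f.up e t + (-f.up e 0 +
        (Q.ind e * (if p ≤ t then 1 else 0) + (-R.ind e) * (if p' ≤ t then 1 else 0))))
      (b := fun t => f.down e t + (- -f.up e 0 +
        (Q.ind e * (if p < t then -1 else 0) + (-R.ind e) * (if p' < t then -1 else 0))))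
      (fun t ht => RightSlope.add (f.up_spec e t ht) ((rightSlope_affine _ _ _).add
        (((rightSlope_max _ _).const_mul _).add ((rightSlope_max _ _).const_mul _))))
      (fun t ht => LeftSlope.add (f.down_spec e t ht) ((leftSlope_affine _ _ _).add
        (((leftSlope_max _ _).const_mul _).add ((leftSlope_max _ _).const_mul _))))
      (by
        intro t ht
        have h1 := hf (Sum.inr ⟨e, t, ht⟩)
        rw [unitaryDivisor_inr, unitaryDivisor_inr] at h1
        have h1 : (-if t = p then Q.ind e else 0) - (-if t = p' then R.ind e else 0) =
          f.up e t + f.down e t := h1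
        have h2 : ((-if t = p then (Q.ind e : ℝ) else 0) - (-if t = p' then (R.ind e : ℝ) else 0)) =
          f.up e t + f.down e t := by
            have := congrArg (Int.cast : ℤ → ℝ) h1
            push_cast at this
            exact this
        have h3 : ∀ (c q : ℝ), c * (if q ≤ t then 1 else 0) + c * (if q < t then -1 else 0) =
            if t = q then c else 0 := by
          intro c q
          rcases lt_trichotomy q t with h | h | h
          · simp [h, h.le, h.ne']
          · simp [h]
          · simp [h.not_ge, h.not_gt, h.ne]
        have h4 := h3 (Q.ind e) p
        have h5 := h3 (R.ind e) p'
        linarith)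
      (by
        rcases Q.ind_partLength_cases hx e with ⟨-, h1, -⟩ | ⟨-, -, h1, -⟩ <;>
        rcases R.ind_partLength_cases hy e with ⟨-, h2, -⟩ | ⟨-, -, h2, -⟩
        · simp [h1, h2]
        · simp [h1, p', (h2 false).not_ge]
        · simp [p, h2, (h1 false).not_ge]
        · simp [p, p', (h1 false).not_ge, (h2 false).not_ge])
    obtain ⟨hk1, hk2⟩ := hk
    simp only [k, along_zero, along_len] at hk1
    have hend : ∀ {P : PseudoDiv X.G} {z : P.graph.E → ℝ} (_ : z ∈ openOrthant _)
        (_ : P.totalLength z = X.len),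
        (P.ind e : ℝ) * max (X.len e - P.partLength z e false) 0 = P.partLength z e true ∧
        (P.ind e : ℝ) * max (0 - P.partLength z e false) 0 = 0 ∧
        (P.ind e : ℝ) * (if P.partLength z e false < X.len e then -1 else 0) = -P.ind e := by
      intro P z hz hP
      rcases P.ind_partLength_cases hz e with ⟨-, h1, h2⟩ | ⟨-, h1, h2, h3⟩
      · rw [h1, h2 false, h2 true]; simp
      · rw [hP] at h3
        have h4 := h2 false
        have h5 := h2 true
        rw [h1, max_eq_left (by linarith), max_eq_right (by linarith), if_pos (by linarith)]
        push_cast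
        exact ⟨by linarith, by ring, by ring⟩
    obtain ⟨q1, q2, q3⟩ := hend hx hQ
    obtain ⟨r1, r2, r3⟩ := hend hy hR
    constructor
    · linarith
    · have : (f.down e (X.len e) : ℝ) = -f.up e 0 + Q.ind e - R.ind e := by linarith
      exact_mod_cast this
  refine ⟨fun v => f.val (Sum.inl v), fun e => f.up e 0, fun e => (key e).1, fun v => ?_⟩
  refine (hf (Sum.inl v)).trans ?_
  refine Finset.sum_congr rfl fun e _ => ?_
  rw [(key e).2]

/-- The rational function is rebuilt on each edge from its value and slope at the source, with a
hinge at each exceptional point. The condition on `φ` makes its value at the end agree with the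
target. -/
theorem linEquiv_of_isLinEquiv (hx : x ∈ openOrthant _) (hy : y ∈ openOrthant _)
    (hQ : Q.totalLength x = X.len) (hR : R.totalLength y = X.len)
    (h : PseudoDiv.IsLinEquiv X.len Q x R y) :
    LinEquiv (Q.unitaryDivisor (X := X) x) (R.unitaryDivisor y) := by
  obtain ⟨φ, s, h1, h2⟩ := h
  let k : X.G.E → ℝ → ℝ := fun e t => (φ (X.G.src e) + s e * t) +
    ((-Q.ind e) * max (t - Q.partLength x e false) 0 +
      R.ind e * max (t - R.partLength y e false) 0)
  let f : X.Point → ℝ := Sum.elim φ fun p => k p.1 p.2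
  have hend : ∀ {P : PseudoDiv X.G} {z : P.graph.E → ℝ} (_ : z ∈ openOrthant _)
      (_ : P.totalLength z = X.len) (e : X.G.E),
      (P.ind e : ℝ) * max (X.len e - P.partLength z e false) 0 = P.partLength z e true ∧
      (P.ind e : ℝ) * max (0 - P.partLength z e false) 0 = 0 ∧
      (P.ind e : ℤ) * (if P.partLength z e false < X.len e then 1 else 0) = P.ind e ∧
      (P.ind e : ℤ) * (if P.partLength z e false ≤ 0 then 1 else 0) = 0 := by
    intro P z hz hP e
    rcases P.ind_partLength_cases hz e with ⟨-, h1, h2⟩ | ⟨-, h1, h2, h3⟩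
    · rw [h1, h2 false, h2 true]; simp
    · rw [hP] at h3
      have h4 := h2 false
      have h5 := h2 true
      rw [h1, max_eq_left (by linarith), max_eq_right (by linarith), if_pos (by linarith),
        if_neg (by linarith)]
      exact ⟨by push_cast; linarith, by simp, by simp, by simp⟩
  have halong : ∀ e, ∀ t ∈ Set.Icc 0 (X.len e), along f e t = k e t := by
    intro e t ht
    obtain ⟨q1, q2, -⟩ := hend hx hQ e
    obtain ⟨r1, r2, -⟩ := hend hy hR e
    rcases ht.1.eq_or_lt with h | h
    · subst h
      rw [along_zero]
      change φ _ = _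
      simp only [k]
      linarith
    · rcases ht.2.eq_or_lt with h' | h'
      · subst h'
        rw [along_len]
        change φ _ = _
        have := h1 e
        simp only [k]
        linarith
      · exact along_of_mem f e ⟨h, h'⟩
  let F : X.RatFun :=
    { val := f
      up := fun e t => s e + (-Q.ind e * (if Q.partLength x e false ≤ t then 1 else 0) +
        R.ind e * (if R.partLength y e false ≤ t then 1 else 0))
      down := fun e t => -s e + (-Q.ind e * (if Q.partLength x e false < t then -1 else 0) +
        R.ind e * (if R.partLength y e false < t then -1 else 0))
      up_spec := fun e t ht => by
        push_cast
        exact RightSlope.congr ((rightSlope_affine _ _ _).add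
          (((rightSlope_max _ _).const_mul _).add ((rightSlope_max _ _).const_mul _))) ht (halong e)
      down_spec := fun e t ht => by
        push_cast
        exact LeftSlope.congr ((leftSlope_affine _ _ _).add
          (((leftSlope_max _ _).const_mul _).add ((leftSlope_max _ _).const_mul _))) ht (halong e) }
  refine ⟨F, fun p => ?_⟩
  rcases p with v | ⟨e, t, ht⟩
  · refine (h2 v).trans ?_
    refine Finset.sum_congr rfl fun e _ => ?_
    obtain ⟨-, -, q3, q4⟩ := hend hx hQ e
    obtain ⟨-, -, r3, r4⟩ := hend hy hR e
    have hup : F.up e 0 = s e := by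
      simp only [F]
      linarith
    have hdown : F.down e (X.len e) = -s e + Q.ind e - R.ind e := by
      have h3 : ∀ (c : ℤ) (P : Prop) [Decidable P], c * (if P then -1 else 0) =
          -(c * if P then 1 else 0) := by
        intro c P _; split_ifs <;> ring
      simp only [F, h3]
      linarith
    rw [hup, hdown]
  · rw [unitaryDivisor_inr, unitaryDivisor_inr]
    change (-if t = _ then Q.ind e else 0) - (-if t = _ then R.ind e else 0) =
      F.up e t + F.down e t
    have h3 : ∀ (c : ℤ) (q : ℝ), c * (if q ≤ t then 1 else 0) + c * (if q < t then -1 else 0) =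
        if t = q then c else 0 := by
      intro c q
      rcases lt_trichotomy q t with h | h | h
      · simp [h, h.le, h.ne']
      · simp [h]
      · simp [h.not_ge, h.not_gt, h.ne]
    have h4 := h3 (Q.ind e) (Q.partLength x e false)
    have h5 := h3 (R.ind e) (R.partLength y e false)
    simp only [F]
    linarith

end TropCurve

end TropJac

end

/-! ### Uniqueness of quasistable divisors, and linear equivalence from specializations. -/

noncomputable section

namespace TropJac

namespace PseudoDiv

variable {n : ℕ} {Γ : WGraph n} {ℓ : Γ.E → ℝ} {Q R S : PseudoDiv Γ} {x : Q.graph.E → ℝ}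
  {y : R.graph.E → ℝ} {z : S.graph.E → ℝ}

theorem IsLinEquiv.symm (h : IsLinEquiv ℓ Q x R y) : IsLinEquiv ℓ R y Q x := by
  obtain ⟨φ, s, h1, h2⟩ := h
  refine ⟨-φ, -s, fun e => ?_, fun v => ?_⟩
  · have := h1 e
    simp only [Pi.neg_apply]
    push_cast
    linarith
  · rw [← neg_sub, h2 v, ← Finset.sum_neg_distrib]
    refine Finset.sum_congr rfl fun e _ => ?_
    simp only [Pi.neg_apply]
    split_ifs <;> ring

theorem IsLinEquiv.trans (h : IsLinEquiv ℓ Q x R y) (h' : IsLinEquiv ℓ R y S z) :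
    IsLinEquiv ℓ Q x S z := by
  obtain ⟨φ, s, h1, h2⟩ := h
  obtain ⟨φ', s', h1', h2'⟩ := h'
  refine ⟨φ + φ', s + s', fun e => ?_, fun v => ?_⟩
  · have := h1 e
    have := h1' e
    simp only [Pi.add_apply]
    push_cast
    linarith
  · rw [← sub_add_sub_cancel _ (R.div (Γ.oldV R.exc v)), h2 v, h2' v, ← Finset.sum_add_distrib]
    refine Finset.sum_congr rfl fun e _ => ?_
    simp only [Pi.add_apply]
    split_ifs <;> ring

/-- The sum is rearranged over the edges. Along an edge that leaves `W` the rational function falls,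
so its integer slope is bounded away from zero by a whole unit, up to a shift by one when an
exceptional point bends the function. This unit absorbs the contributions 1/2 of the edge to the two
cuts. -/
theorem betaExc_add_betaExc_compl_le {μ : Γ.V → ℝ} (hR : R.HasDegreeOf μ)
    (hx : x ∈ openOrthant _) (hy : y ∈ openOrthant _) (hQℓ : Q.totalLength x = ℓ)
    (hRℓ : R.totalLength y = ℓ) {φ : Γ.V → ℝ} {s : Γ.E → ℤ}
    (h1 : ∀ e, φ (Γ.tgt e) - φ (Γ.src e) =
      s e * ℓ e - Q.partLength x e true + R.partLength y e true)
    (h2 : ∀ v, Q.div (Γ.oldV Q.exc v) - R.div (Γ.oldV R.exc v) =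
      ∑ e, ((if Γ.src e = v then s e else 0) +
        (if Γ.tgt e = v then -s e + Q.ind e - R.ind e else 0)))
    (W : Finset Γ.V) (hW : ∀ v ∈ W, ∀ w ∉ W, φ w < φ v) :
    Q.betaExc μ W + R.betaExc μ Wᶜ ≤ 0 := by
  have hdeg := (R.hasDegreeOf_iff μ).1 hR
  have h3 := Finset.sum_add_sum_compl W fun v => (R.div (Γ.oldV R.exc v) : ℝ) - μ v
  have h5 : ∑ v, ((R.div (Γ.oldV R.exc v) : ℝ) - μ v) = R.exc.card := by
    rw [Finset.sum_sub_distrib, hdeg, add_sub_cancel_left]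
  have h4 : (R.exc.card : ℝ) = ∑ e, if e ∈ R.exc then (1 : ℝ) else 0 := by
    rw [Finset.sum_ite_mem, Finset.univ_inter, Finset.sum_const, nsmul_eq_mul, mul_one]
  have h6 : ∑ v ∈ W, ((Q.div (Γ.oldV Q.exc v) : ℝ) - μ v) -
      ∑ v ∈ W, ((R.div (Γ.oldV R.exc v) : ℝ) - μ v) =
      ∑ e, ((if Γ.src e ∈ W then (s e : ℝ) else 0) +
        (if Γ.tgt e ∈ W then -(s e : ℝ) + Q.ind e - R.ind e else 0)) := by
    rw [← Finset.sum_sub_distrib]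
    have h7 : ∀ v, ((Q.div (Γ.oldV Q.exc v) : ℝ) - μ v) - ((R.div (Γ.oldV R.exc v) : ℝ) - μ v) =
        ∑ e, ((if Γ.src e = v then (s e : ℝ) else 0) +
        (if Γ.tgt e = v then -(s e : ℝ) + Q.ind e - R.ind e else 0)) := by
      intro v
      rw [sub_sub_sub_cancel_right]
      exact_mod_cast h2 v
    rw [Finset.sum_congr rfl fun v _ => h7 v, Finset.sum_comm]
    refine Finset.sum_congr rfl fun e _ => ?_
    rw [Finset.sum_add_distrib, Finset.sum_ite_eq, Finset.sum_ite_eq]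
  rw [betaExc_formula, betaExc_formula]
  have h7 : ∑ v ∈ W, ((Q.div (Γ.oldV Q.exc v) : ℝ) - μ v) +
      ∑ v ∈ Wᶜ, ((R.div (Γ.oldV R.exc v) : ℝ) - μ v) =
      ∑ e, ((if Γ.src e ∈ W then (s e : ℝ) else 0) +
        (if Γ.tgt e ∈ W then -(s e : ℝ) + Q.ind e - R.ind e else 0)) +
      ∑ e, if e ∈ R.exc then (1 : ℝ) else 0 := by
    rw [← h6, ← h4]; linarith
  have h8 : ∀ a b c d : ℝ, (a + c) + (b + d) = (a + b) + (c + d) := fun a b c d => by ring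
  rw [h8, h7, ← Finset.sum_add_distrib, ← Finset.sum_add_distrib, ← Finset.sum_add_distrib]
  refine Finset.sum_nonpos fun e _ => ?_
  have hc := Γ.mem_cut_iff W e false
  have hc' := Γ.mem_cut_iff Wᶜ e false
  simp only [WGraph.endp_false, Bool.not_false, WGraph.endp_true, Finset.mem_compl] at hc hc'
  simp only [hc, hc', Finset.mem_compl]
  have hpos := Q.totalLength_pos hx e
  have hpos' := hpos
  rw [hQℓ] at hpos
  have he := h1 e
  have hQ := Q.ind_partLength_cases hx e
  have hR := R.ind_partLength_cases hy e
  rw [hQℓ] at hQ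
  rw [hRℓ] at hR
  have hs : ∀ k : ℤ, (k : ℝ) * ℓ e < 0 → k ≤ -1 := fun k hk => by
    have : (k : ℝ) < 0 := by
      by_contra hn
      exact absurd hk (not_lt.2 (mul_nonneg (not_lt.1 hn) hpos.le))
    have : k < 0 := by exact_mod_cast this
    omega
  by_cases hsrc : Γ.src e ∈ W <;> by_cases htgt : Γ.tgt e ∈ W
  · rcases hQ with ⟨q0, q1, q2⟩ | ⟨q0, q1, q2, q3⟩ <;>
    rcases hR with ⟨r0, r1, r2⟩ | ⟨r0, r1, r2, r3⟩ <;>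
    simp [hsrc, htgt, q0, q1, r0, r1]; linarith
  · have hlt := hW _ hsrc _ htgt
    rcases hQ with ⟨q0, q1, q2⟩ | ⟨q0, q1, q2, q3⟩ <;>
    rcases hR with ⟨r0, r1, r2⟩ | ⟨r0, r1, r2, r3⟩
    · have h9 := hs (s e) (by rw [q2, r2] at he; linarith)
      have h10 : (s e : ℝ) ≤ -1 := by exact_mod_cast h9
      simp [hsrc, htgt, q0, r0]; linarith
    · have h9 := hs (s e) (by rw [q2] at he; linarith [r2 true])
      have h10 : (s e : ℝ) ≤ -1 := by exact_mod_cast h9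
      simp [hsrc, htgt, q0, r0]; linarith
    · have h9 := hs (s e - 1) (by
        rw [r2] at he; push_cast; linarith [q2 false])
      have h10 : (s e : ℝ) ≤ 0 := by exact_mod_cast (by omega : s e ≤ 0)
      simp [hsrc, htgt, q0, r0]; linarith
    · have h9 := hs (s e - 1) (by
        push_cast; linarith [q2 false, r2 true])
      have h10 : (s e : ℝ) ≤ 0 := by exact_mod_cast (by omega : s e ≤ 0)
      simp [hsrc, htgt, q0, r0]; linarith
  · have hlt := hW _ htgt _ hsrc
    rcases hQ with ⟨q0, q1, q2⟩ | ⟨q0, q1, q2, q3⟩ <;>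
    rcases hR with ⟨r0, r1, r2⟩ | ⟨r0, r1, r2, r3⟩
    · have h9 := hs (-s e) (by rw [q2, r2] at he; push_cast; linarith)
      have h10 : (1 : ℝ) ≤ s e := by exact_mod_cast (by omega : 1 ≤ s e)
      simp [hsrc, htgt, q0, q1, r0, r1]; linarith
    · have h9 := hs (-s e - 1) (by rw [q2] at he; push_cast; linarith [r2 false])
      have h10 : (0 : ℝ) ≤ s e := by exact_mod_cast (by omega : 0 ≤ s e)
      simp [hsrc, htgt, q0, q1, r0, r1]; linarith
    · have h9 := hs (-s e) (by
        rw [r2] at he; push_cast; linarith [q2 true])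
      have h10 : (1 : ℝ) ≤ s e := by exact_mod_cast (by omega : 1 ≤ s e)
      simp [hsrc, htgt, q0, q1, r0, r1]; linarith
    · have h9 := hs (-s e - 1) (by
        push_cast; linarith [q2 true, r2 false])
      have h10 : (0 : ℝ) ≤ s e := by exact_mod_cast (by omega : 0 ≤ s e)
      simp [hsrc, htgt, q0, q1, r0, r1]; linarith
  · rcases hQ with ⟨q0, q1, q2⟩ | ⟨q0, q1, q2, q3⟩ <;>
    rcases hR with ⟨r0, r1, r2⟩ | ⟨r0, r1, r2, r3⟩ <;>
    norm_num [hsrc, htgt, q0, q1, r0, r1]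

/-- A quasistable divisor is determined by its linear equivalence class. -/
theorem IsLinEquiv.eq {μ : Γ.V → ℝ} {v₀ : Γ.V} (h : IsLinEquiv ℓ Q x R y)
    (hQ : Q.IsQuasistable μ v₀) (hR : R.IsQuasistable μ v₀) (hx : x ∈ openOrthant _)
    (hy : y ∈ openOrthant _) (hQℓ : Q.totalLength x = ℓ) (hRℓ : R.totalLength y = ℓ) :
    (⟨Q, x⟩ : Σ P : PseudoDiv Γ, P.graph.E → ℝ) = ⟨R, y⟩ := by
  obtain ⟨φ, s, h1, h2⟩ := h
  obtain ⟨m, -, hm⟩ := Finset.exists_max_image Finset.univ φ ⟨v₀, Finset.mem_univ _⟩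
  have hm : ∀ v, φ v ≤ φ m := fun v => hm v (Finset.mem_univ v)
  have hconst : ∀ v, φ v = φ m := by
    -- Otherwise the set where `φ` is maximal is nonempty and proper. Its invariant for `Q` and that
    -- of its complement for `R` are nonnegative with sum at most zero, but the one of the set
    -- containing `v₀` is positive.
    by_contra hn
    push Not at hn
    obtain ⟨w, hw⟩ := hn
    classical
    let W : Finset Γ.V := Finset.univ.filter fun v => φ v = φ m
    have hW : ∀ v, v ∈ W ↔ φ v = φ m := fun v => by simp [W]
    have hle := betaExc_add_betaExc_compl_le hR.1 hx hy hQℓ hRℓ h1 h2 W fun v hv w hw => by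
      rw [(hW v).1 hv]
      exact lt_of_le_of_ne (hm w) fun h => hw ((hW w).2 h)
    have h3 := hQ.isSemistable.2 W
    have h4 := hR.isSemistable.2 Wᶜ
    by_cases hv : v₀ ∈ W
    · have := hQ.betaExc_pos (W := W) (fun h => hw ((hW w).1 (h ▸ Finset.mem_univ w))) hv
      linarith
    · have := hR.betaExc_pos (W := Wᶜ) (fun h => by
        have : m ∈ Wᶜ := h ▸ Finset.mem_univ m
        exact Finset.mem_compl.1 this ((hW m).2 rfl)) (Finset.mem_compl.2 hv)
      linarith
  -- For constant `φ`, the number `s e * ℓ e` is a difference of partial lengths, of absolute value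
  -- less than `ℓ e`, so the integer `s e` vanishes and the partial lengths agree.
  have key : ∀ e, s e = 0 ∧ (e ∈ Q.exc ↔ e ∈ R.exc) ∧ Q.ind e = R.ind e ∧
      ∀ b, Q.partLength x e b = R.partLength y e b := by
    intro e
    have he := h1 e
    rw [hconst, hconst (Γ.src e), sub_self] at he
    have hpos := Q.totalLength_pos hx e
    rw [hQℓ] at hpos
    have hQ := Q.ind_partLength_cases hx e
    have hR := R.ind_partLength_cases hy e
    rw [hQℓ] at hQ
    rw [hRℓ] at hR
    have hs : ∀ c : ℝ, s e * ℓ e = c → -ℓ e < c → c < ℓ e → s e = 0 := by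
      intro c hc h3 h4
      have h5 : (s e : ℝ) < 1 := by
        by_contra hn
        nlinarith [not_lt.1 hn]
      have h6 : (-1 : ℝ) < s e := by
        by_contra hn
        nlinarith [not_lt.1 hn]
      have h7 : s e < 1 := by exact_mod_cast h5
      have h8 : -1 < s e := by exact_mod_cast h6
      omega
    rcases hQ with ⟨q0, q1, q2⟩ | ⟨q0, q1, q2, q3⟩ <;>
    rcases hR with ⟨r0, r1, r2⟩ | ⟨r0, r1, r2, r3⟩
    · rw [q2, r2] at he
      have h0 := hs 0 (by linarith) (by linarith) hpos
      exact ⟨h0, by simp [q0, r0], by rw [q1, r1], fun b => by rw [q2, r2]⟩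
    · rw [q2] at he
      have h0 := hs (-R.partLength y e true) (by linarith) (by linarith [r2 false])
        (by linarith [r2 true])
      rw [h0] at he
      have := r2 true
      push_cast at he
      linarith
    · rw [r2] at he
      have h0 := hs (Q.partLength x e true) (by linarith) (by linarith [q2 true])
        (by linarith [q2 false])
      rw [h0] at he
      have := q2 true
      push_cast at he
      linarith
    · have h0 := hs (Q.partLength x e true - R.partLength y e true) (by linarith)
        (by linarith [q2 true, r2 false]) (by linarith [q2 false, r2 true])
      rw [h0] at he
      push_cast at he
      refine ⟨h0, by simp [q0, r0], by rw [q1, r1], fun b => ?_⟩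
      cases b <;> linarith
  have hdiv : ∀ v, Q.div (Γ.oldV Q.exc v) = R.div (Γ.oldV R.exc v) := by
    intro v
    rw [← sub_eq_zero, h2 v]
    refine Finset.sum_eq_zero fun e _ => ?_
    obtain ⟨h3, -, h4, -⟩ := key e
    rw [h3, h4]
    simp
  have hlen : ∀ e, Q.totalLength x e = R.totalLength y e := fun e => by rw [hQℓ, hRℓ]
  obtain ⟨E, D, hD⟩ := Q
  obtain ⟨E', D', hD'⟩ := R
  obtain rfl : E = E' := Finset.ext fun e => (key e).2.1
  obtain rfl : D = D' := PseudoDiv.ext_of_old (fun e h => hD ⟨e, h⟩) (fun e h => hD' ⟨e, h⟩) hdiv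
  congr 1
  funext k
  obtain ⟨e, he, rfl⟩ | ⟨e, he, b, rfl⟩ := Γ.subdiv_E_cases _ k
  · have := hlen e
    rwa [totalLength_of_notMem x he, totalLength_of_notMem y he] at this
  · have := (key e).2.2.2 b
    rwa [partLength, partLength, dif_pos he, dif_pos he] at this

end PseudoDiv

namespace Triple

variable {n : ℕ} {Γ : WGraph n} {Q R : PseudoDiv Γ} {x : Q.graph.E → ℝ} {y : R.graph.E → ℝ}

/-- The possible behaviour of a standard specialization at an edge. -/
theorem Hom.IsStandard.cases {f : Triple.mk Γ R ⟶ Triple.mk Γ Q} (hf : Hom.IsStandard f)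
    (x : Q.graph.E → ℝ) (e : Γ.E) :
    (∃ (hR : e ∈ R.exc) (hQ : e ∈ Q.exc),
      (∀ b, Hom.extend f x (Γ.halfE R.exc e hR b) = x (Γ.halfE Q.exc e hQ b)) ∧
      f.hat.onV (Γ.midV R.exc e hR) = Γ.midV Q.exc e hQ) ∨
    (∃ (hR : e ∈ R.exc) (hQ : e ∉ Q.exc) (c : Bool),
      Hom.extend f x (Γ.halfE R.exc e hR c) = x (Γ.oldE Q.exc e hQ) ∧
      Hom.extend f x (Γ.halfE R.exc e hR !c) = 0 ∧
      f.hat.onV (Γ.midV R.exc e hR) = Γ.oldV Q.exc (Γ.endp e !c)) ∨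
    ∃ (hR : e ∉ R.exc) (hQ : e ∉ Q.exc),
      Hom.extend f x (Γ.oldE R.exc e hR) = x (Γ.oldE Q.exc e hQ) := by
  by_cases hQ : e ∈ Q.exc
  · left
    obtain ⟨hR, h1⟩ := hf.2 e hQ
    obtain ⟨_, _, -, -, h2⟩ := f.onE_halfE_of_base_eq_id hf.1 hQ false
    refine ⟨hR, hQ, fun b => ?_, h2⟩
    have h3 : Hom.extend f x (f.hat.onE (Γ.halfE Q.exc e hQ b)) = _ := Hom.extend_apply f x _
    rwa [h1 b] at h3
  · right
    obtain ⟨base, hat, k1, k2, k3, k4⟩ := f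
    obtain rfl : base = Spec.id Γ := hf.1
    let f : Triple.mk Γ R ⟶ Triple.mk Γ Q := Hom.mk (Spec.id Γ) hat k1 k2 k3 k4
    by_cases hR : e ∈ R.exc
    · left
      obtain ⟨c, h1, h2⟩ := f.onE_oldE_of_mem hQ hR
      refine ⟨hR, hQ, c, ?_, Hom.extend_apply' f x _ h2, f.onV_midV_of_notMem_range hR h2⟩
      have h3 : Hom.extend f x (f.hat.onE (Γ.oldE Q.exc e hQ)) = _ := Hom.extend_apply f x _
      rwa [h1] at h3
    · right
      refine ⟨hR, hQ, ?_⟩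
      have h3 : Hom.extend f x (f.hat.onE (Γ.oldE Q.exc e hQ)) = _ := Hom.extend_apply f x _
      rwa [f.onE_oldE_of_notMem hQ hR] at h3

theorem Hom.IsStandard.div_sub {f : Triple.mk Γ R ⟶ Triple.mk Γ Q} (hf : Hom.IsStandard f)
    (v : Γ.V) : Q.div (Γ.oldV Q.exc v) - R.div (Γ.oldV R.exc v) =
      ∑ e, if h : e ∈ R.exc then
        (if f.hat.onV (Γ.midV R.exc e h) = Γ.oldV Q.exc v then -1 else 0) else 0 := by
  have h1 : Q.div = f.hat.push R.div := f.div_eq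
  have h2 : ∀ w, f.hat.onV (Γ.oldV R.exc w) = Γ.oldV Q.exc w := fun w => by
    refine (f.onV_oldV w).trans ?_
    rw [hf.1]; rfl
  rw [h1]
  unfold Spec.push
  rw [Finset.sum_filter, Γ.sum_subdiv_V]
  simp only [h2, WGraph.oldV_inj, PseudoDiv.div_midV]
  rw [Finset.sum_ite_eq' Finset.univ v fun v => R.div (Γ.oldV R.exc v)]
  simp

/-- A coboundary changes the two halves of an exceptional edge by opposite amounts and does not
change ordinary edges. -/
theorem Hom.IsStandard.totalLength_eq {f : Triple.mk Γ R ⟶ Triple.mk Γ Q}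
    (hf : Hom.IsStandard f) (h : Hom.extend f x - y ∈ Γ.cutSpace R.exc) :
    R.totalLength y = Q.totalLength x := by
  obtain ⟨φ, hφ, h⟩ := (Γ.mem_cutSpace_iff _ _).1 h
  funext e
  rcases hf.cases x e with ⟨hR, hQ, h1, -⟩ | ⟨hR, hQ, c, h1, h2, -⟩ | ⟨hR, hQ, h1⟩
  · have h3 := congrFun h (Γ.halfE R.exc e hR false)
    have h4 := congrFun h (Γ.halfE R.exc e hR true)
    rw [Pi.sub_apply, h1, WGraph.delta_halfE] at h3 h4
    rw [PseudoDiv.totalLength_of_mem y hR, PseudoDiv.totalLength_of_mem x hQ]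
    simp only [Bool.not_false, Bool.not_true] at h3 h4
    linarith
  · have h3 := congrFun h (Γ.halfE R.exc e hR c)
    have h4 := congrFun h (Γ.halfE R.exc e hR !c)
    rw [Pi.sub_apply, h1, WGraph.delta_halfE] at h3
    rw [Pi.sub_apply, h2, WGraph.delta_halfE, Bool.not_not] at h4
    rw [PseudoDiv.totalLength_of_mem y hR, PseudoDiv.totalLength_of_notMem x hQ]
    cases c <;> simp only [Bool.not_false, Bool.not_true] at h3 h4 <;> linarith
  · have h3 := congrFun h (Γ.oldE R.exc e hR)
    rw [Pi.sub_apply, h1, WGraph.delta_oldE] at h3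
    rw [PseudoDiv.totalLength_of_notMem y hR, PseudoDiv.totalLength_of_notMem x hQ]
    linarith

/-- If `extend f x - y` is the coboundary of `φ`, the values of the rational function at the
vertices are given by `-φ`. Its slope at the source of an edge is -1 if the exceptional vertex on
that edge is merged into the source, and 0 otherwise. -/
theorem Hom.IsStandard.isLinEquiv {f : Triple.mk Γ R ⟶ Triple.mk Γ Q}
    (hf : Hom.IsStandard f) (h : Hom.extend f x - y ∈ Γ.cutSpace R.exc) :
    PseudoDiv.IsLinEquiv (Q.totalLength x) Q x R y := by
  obtain ⟨φ, hφ, h⟩ := (Γ.mem_cutSpace_iff _ _).1 h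
  have key : ∀ e, ∃ s : ℤ, (-φ (Γ.tgt e) - -φ (Γ.src e) =
      s * Q.totalLength x e - Q.partLength x e true + R.partLength y e true) ∧
      ∀ v, (if h : e ∈ R.exc then
        (if f.hat.onV (Γ.midV R.exc e h) = Γ.oldV Q.exc v then (-1 : ℤ) else 0) else 0) =
        (if Γ.src e = v then s else 0) +
          (if Γ.tgt e = v then -s + Q.ind e - R.ind e else 0) := by
    intro e
    rcases hf.cases x e with ⟨hR, hQ, h1, h2⟩ | ⟨hR, hQ, c, h1, h2, h3⟩ | ⟨hR, hQ, h1⟩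
    · refine ⟨0, ?_, fun v => ?_⟩
      · have h4 := congrFun h (Γ.halfE R.exc e hR true)
        rw [Pi.sub_apply, h1, WGraph.delta_halfE] at h4
        simp only [Bool.not_true, WGraph.endp_true, WGraph.endp_false] at h4
        rw [PseudoDiv.partLength, PseudoDiv.partLength, dif_pos hQ, dif_pos hR]
        push_cast
        linarith
      · rw [dif_pos hR, h2, if_neg Γ.midV_ne_oldV, PseudoDiv.ind, PseudoDiv.ind, if_pos hQ,
          if_pos hR]
        simp
    · have h4 := congrFun h (Γ.halfE R.exc e hR c)
      have h5 := congrFun h (Γ.halfE R.exc e hR !c)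
      rw [Pi.sub_apply, h1, WGraph.delta_halfE] at h4
      rw [Pi.sub_apply, h2, WGraph.delta_halfE, Bool.not_not] at h5
      rw [PseudoDiv.totalLength_of_notMem x hQ, PseudoDiv.partLength, PseudoDiv.partLength,
        dif_neg hQ, dif_pos hR, PseudoDiv.ind, PseudoDiv.ind, if_neg hQ, if_pos hR]
      cases c
      · simp only [Bool.not_false, WGraph.endp_true, WGraph.endp_false] at h3 h4 h5
        refine ⟨0, by push_cast; linarith, fun v => ?_⟩
        rw [dif_pos hR, h3]
        simp only [WGraph.oldV_inj]
        simp
      · simp only [Bool.not_true, WGraph.endp_true, WGraph.endp_false] at h3 h4 h5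
        refine ⟨-1, by push_cast; linarith, fun v => ?_⟩
        rw [dif_pos hR, h3]
        simp only [WGraph.oldV_inj]
        simp
    · refine ⟨0, ?_, fun v => ?_⟩
      · rw [PseudoDiv.partLength, PseudoDiv.partLength, dif_neg hQ, dif_neg hR, hφ e hR]
        simp
      · rw [dif_neg hR, PseudoDiv.ind, PseudoDiv.ind, if_neg hQ, if_neg hR]
        simp
  choose s hs1 hs2 using key
  refine ⟨-φ, s, fun e => hs1 e, fun v => ?_⟩
  rw [hf.div_sub v]
  exact Finset.sum_congr rfl fun e _ => hs2 e v

end Triple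

end TropJac

end

/-! ### The map ρ, its inverse, and its description by divisors. -/

noncomputable section

namespace TropJac

namespace Triple

variable {n : ℕ} {A B C : Triple n}

theorem cellMap_comp (f : A ⟶ B) (h : B ⟶ C) (x : C.graph.E → ℝ) :
    cellMap (f ≫ h) x = cellMap f (Hom.extend h x) :=
  congrArg (Submodule.mkQ _) (Hom.extend_comp f h x)

theorem cellMap_mem (f : A ⟶ B) {x : B.graph.E → ℝ} (hx : x ∈ orthant _) :
    cellMap f x ∈ (sigma A).carrier :=
  ⟨Hom.extend f x, Hom.extend_orthant f hx, rfl⟩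

/-- A point of the closed orthant lies in the interior of the orthant of a contraction. -/
theorem exists_extend_eq (A : Triple n) {x : A.graph.E → ℝ} (hx : x ∈ orthant _) :
    ∃ (B : Triple n) (f : A ⟶ B) (y : B.graph.E → ℝ), y ∈ openOrthant _ ∧ Hom.extend f y = x := by
  obtain ⟨B, f, hf⟩ := exists_contract A {h | x h = 0}
  refine ⟨B, f, x ∘ f.hat.onE, fun h => ?_, Hom.extend_comp_onE f fun h hh => ?_⟩
  · have : f.hat.onE h ∈ Set.range f.hat.onE := ⟨h, rfl⟩
    rw [hf] at this
    exact lt_of_le_of_ne (hx _) (Ne.symm this)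
  · rw [hf] at hh
    exact not_not.1 hh

/-- The morphism of cones from `τ` to `σ` which is defined by a specialization. -/
def cellHom (f : A ⟶ B) : tau B ⟶ sigma A :=
  RPCone.Hom.ofLinear (C := tau B) (D := sigma A) (cellMap f)
    (fun x hx => ⟨Hom.extend f x, Hom.extend_intLattice f hx, rfl⟩) fun _ hx => cellMap_mem f hx

theorem continuous_cellHom (f : A ⟶ B) : Continuous (cellHom f).toFun := by
  let T : (tau B).N →ₗ[ℝ] (sigma A).N := cellMap f
  have := IsModuleTopology.toContinuousAdd ℝ (sigma A).N
  have hT : Continuous T := IsModuleTopology.continuous_of_linearMap T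
  exact (hT.comp continuous_subtype_val).subtype_mk _

end Triple

namespace UnivPolarization

variable {g n : ℕ} [NeZero n] {d : ℤ} (μ : UnivPolarization g n d)

theorem isQD_of_hom_of_isQD {A B : Triple n} (hA : μ.isQD A) (f : A ⟶ B) : μ.isQD B := by
  obtain ⟨h, hA⟩ := hA
  exact μ.isQD_of_hom h f (f.isQuasistable hA)

theorem exists_universal (Q : μ.QD) : ∃ (R : PseudoDiv Q.obj.G)
    (f : Triple.mk Q.obj.G R ⟶ Triple.mk Q.obj.G Q.obj.pd), μ.isPSD ⟨Q.obj.G, R⟩ ∧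
      Triple.Hom.IsStandard f ∧
      (∀ h : Q.obj.G.IsStable g, Triple.Hom.IsUniversal (μ.val Q.obj.G h) f) ∧
      Triple.Hom.IsInterior f := by
  obtain ⟨h, hQ⟩ := Q.2
  obtain ⟨R, f, h1, h2, h3, h4⟩ := Triple.exists_polystable hQ.isSemistable
  exact ⟨R, f, ⟨h, h1⟩, h2, fun _ => h3, h4⟩

/-- The polystable triple assigned to a quasistable one. -/
def polTriple (Q : μ.QD) : μ.PSD :=
  ⟨⟨Q.obj.G, (μ.exists_universal Q).choose⟩, (μ.exists_universal Q).choose_spec.choose_spec.1⟩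

/-- The universal specialization from a polystable triple. -/
def polHom (Q : μ.QD) : (μ.polTriple Q).obj ⟶ Q.obj :=
  (μ.exists_universal Q).choose_spec.choose

/-- Any specialization from a polystable triple to `Q` factors through the universal one, and the
first factor is an arrow of the diagram of `P`. So the point of `P` does not depend on the
polystable triple used. -/
theorem mk_cellMap_eq (A : μ.PSD) (Q : μ.QD) (f : A.obj ⟶ Q.obj) (x : (Triple.tau Q.obj).carrier) :
    ConeSpace.mk μ.diagramP A ((Triple.cellHom f).toFun x) =
      ConeSpace.mk μ.diagramP (μ.polTriple Q) ((Triple.cellHom (μ.polHom Q)).toFun x) := by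
  obtain ⟨hQ, -⟩ := Q.2
  obtain ⟨hA, hA'⟩ := A.2
  obtain ⟨f₁, hf₁⟩ := (μ.exists_universal Q).choose_spec.choose_spec.2.2.1 hQ A.obj f
    (μ.val A.obj.G hA) hA' (μ.push_eq _ _ hA hQ f.base)
  have h : f = f₁ ≫ μ.polHom Q := hf₁.symm
  have h1 : (Triple.cellHom f).toFun x = (μ.diagramP.map (ObjectProperty.homMk f₁ :
      A ⟶ μ.polTriple Q).op).toFun ((Triple.cellHom (μ.polHom Q)).toFun x) := by
    apply Subtype.ext
    rw [h]
    exact Triple.cellMap_comp f₁ (μ.polHom Q) x.1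
  rw [h1]
  exact (Quot.sound (Glue.of _ _)).symm

/-- The map from the universal tropical Jacobian of quasistable divisors to the one of polystable
divisors. -/
def rho : μ.J → μ.P :=
  Quot.lift (fun z => ConeSpace.mk μ.diagramP (μ.polTriple z.1)
    ((Triple.cellHom (μ.polHom z.1)).toFun z.2)) (by
      rintro _ _ ⟨f, z⟩
      rename_i A B
      refine (μ.mk_cellMap_eq (μ.polTriple A) B (μ.polHom A ≫ f.hom) z).symm.trans ?_
      congr 1
      exact Subtype.ext (Triple.cellMap_comp _ _ _))

theorem rho_mk (A : μ.PSD) (Q : μ.QD) (f : A.obj ⟶ Q.obj) (x : (Triple.tau Q.obj).carrier) :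
    μ.rho (ConeSpace.mk μ.diagramJ Q x) =
      ConeSpace.mk μ.diagramP A ((Triple.cellHom f).toFun x) :=
  (μ.mk_cellMap_eq A Q f x).symm

theorem mk_extend_eq (Q Q' : μ.QD) (f : Q.obj ⟶ Q'.obj) {x : Q.obj.graph.E → ℝ}
    {y : Q'.obj.graph.E → ℝ} (hx : x ∈ orthant _) (hy : y ∈ orthant _)
    (h : Triple.Hom.extend f y = x) :
    ConeSpace.mk μ.diagramJ Q ⟨x, hx⟩ = ConeSpace.mk μ.diagramJ Q' ⟨y, hy⟩ := by
  subst h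
  exact (Quot.sound (Glue.of (F := μ.diagramJ) (ObjectProperty.homMk f : Q ⟶ Q') ⟨y, hy⟩)).symm

/-- Equal points of σ have the same normalized representative, so the two quasistable triples are
isomorphic compatibly with the points. This makes the inverse of ρ well defined. -/
theorem mkJ_eq_of_cellMap_eq (A : μ.PSD) (B B' : μ.QD) (f : A.obj ⟶ B.obj) (f' : A.obj ⟶ B'.obj)
    {y : B.obj.graph.E → ℝ} {y' : B'.obj.graph.E → ℝ} (hy : y ∈ openOrthant _)
    (hy' : y' ∈ openOrthant _) (h : Triple.cellMap f y = Triple.cellMap f' y') :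
    μ.mkJ B.obj B.2 y hy = μ.mkJ B'.obj B'.2 y' hy' := by
  obtain ⟨hA, hA'⟩ := A.2
  obtain ⟨i, -, hi⟩ := Triple.exists_iso_of_extend_eq f f' hy hy'
    (Triple.extend_eq_of_cellMap_eq hA'.isSemistable f f' (μ.isQuasistable_of_hom hA B.2 f)
      (μ.isQuasistable_of_hom hA B'.2 f') (fun k => (hy k).le) (fun k => (hy' k).le) h)
  exact μ.mk_extend_eq B B' i.hom _ _ hi

theorem exists_mkJ (Q : μ.QD) (x : (Triple.tau Q.obj).carrier) :
    ∃ (Q' : μ.QD) (f : Q.obj ⟶ Q'.obj) (y : Q'.obj.graph.E → ℝ) (hy : y ∈ openOrthant _),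
      Triple.Hom.extend f y = x.1 ∧
      ConeSpace.mk μ.diagramJ Q x = μ.mkJ Q'.obj Q'.2 y hy := by
  obtain ⟨B, f, y, hy, h⟩ := Q.obj.exists_extend_eq x.2
  let Q' : μ.QD := ⟨B, μ.isQD_of_hom_of_isQD Q.2 f⟩
  exact ⟨Q', f, y, hy, h, μ.mk_extend_eq Q Q' f _ _ h⟩

theorem exists_mkP (A : μ.PSD) (z : (Triple.sigma A.obj).carrier) :
    ∃ (B : μ.QD) (f : A.obj ⟶ B.obj) (y : B.obj.graph.E → ℝ), y ∈ openOrthant _ ∧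
      (z : (Triple.sigma A.obj).N) = Triple.cellMap f y := by
  obtain ⟨_, x, hx, rfl⟩ := z
  obtain ⟨hA, hA'⟩ := A.2
  obtain ⟨B, f, y, hy, hB, h⟩ := Triple.exists_cell hA.1 hA' (A.obj.G.leg 0) hx
  exact ⟨⟨B, μ.isQD_of_hom hA f hB⟩, f, y, hy, h⟩

theorem rho_mkJ (A : μ.PSD) (B : μ.QD) (f : A.obj ⟶ B.obj) {y : B.obj.graph.E → ℝ}
    (hy : y ∈ openOrthant _) (z : (Triple.sigma A.obj).carrier)
    (h : (z : (Triple.sigma A.obj).N) = Triple.cellMap f y) :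
    μ.rho (μ.mkJ B.obj B.2 y hy) = ConeSpace.mk μ.diagramP A z := by
  refine (μ.rho_mk A B f ⟨y, fun k => (hy k).le⟩).trans ?_
  congr 1
  exact Subtype.ext h.symm

/-- The inverse of `rho`. -/
def rhoInv : μ.P → μ.J :=
  Quot.lift (fun z => μ.mkJ (μ.exists_mkP z.1 z.2).choose.obj (μ.exists_mkP z.1 z.2).choose.2
    (μ.exists_mkP z.1 z.2).choose_spec.choose_spec.choose
    (μ.exists_mkP z.1 z.2).choose_spec.choose_spec.choose_spec.1) (by
      rintro _ _ ⟨f, z⟩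
      rename_i A B
      have h1 := (μ.exists_mkP B z).choose_spec.choose_spec.choose_spec.2
      have h2 := (μ.exists_mkP A ((μ.diagramP.map f.op).toFun z)).choose_spec.choose_spec.choose_spec.2
      refine μ.mkJ_eq_of_cellMap_eq A _ _ (f.hom ≫ (μ.exists_mkP B z).choose_spec.choose)
        (μ.exists_mkP A ((μ.diagramP.map f.op).toFun z)).choose_spec.choose _ _ ?_
      rw [← h2, Triple.cellMap_comp]
      exact (congrArg (Triple.Hom.extendQuot f.hom) h1).symm)

theorem rhoInv_mk (A : μ.PSD) (B : μ.QD) (f : A.obj ⟶ B.obj) {y : B.obj.graph.E → ℝ}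
    (hy : y ∈ openOrthant _) (z : (Triple.sigma A.obj).carrier)
    (h : (z : (Triple.sigma A.obj).N) = Triple.cellMap f y) :
    μ.rhoInv (ConeSpace.mk μ.diagramP A z) = μ.mkJ B.obj B.2 y hy := by
  refine μ.mkJ_eq_of_cellMap_eq A _ _ (μ.exists_mkP A z).choose_spec.choose f
    (μ.exists_mkP A z).choose_spec.choose_spec.choose_spec.1 hy ?_
  rw [← h]
  exact (μ.exists_mkP A z).choose_spec.choose_spec.choose_spec.2.symm

theorem exists_eq_mkJ (j : μ.J) : ∃ (Q : μ.QD) (y : Q.obj.graph.E → ℝ) (hy : y ∈ openOrthant _),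
    j = μ.mkJ Q.obj Q.2 y hy := by
  induction j using Quot.ind with
  | _ z =>
    obtain ⟨Q, x⟩ := z
    obtain ⟨Q', -, y, hy, -, h⟩ := μ.exists_mkJ Q x
    exact ⟨Q', y, hy, h⟩

theorem rho_bijective : Function.Bijective μ.rho := by
  refine ⟨Function.LeftInverse.injective (g := μ.rhoInv) fun j => ?_, fun p => ?_⟩
  · obtain ⟨Q, y, hy, rfl⟩ := μ.exists_eq_mkJ j
    rw [μ.rho_mkJ (μ.polTriple Q) Q (μ.polHom Q) hy
      ⟨_, Triple.cellMap_mem _ fun k => (hy k).le⟩ rfl]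
    exact μ.rhoInv_mk _ _ (μ.polHom Q) hy _ rfl
  · induction p using Quot.ind with
    | _ z =>
      obtain ⟨A, z⟩ := z
      obtain ⟨B, f, y, hy, h⟩ := μ.exists_mkP A z
      exact ⟨_, μ.rho_mkJ A B f hy z h⟩

theorem rho_isRefinement : IsRefinement μ.rho := by
  refine ⟨⟨?_, fun Q => ⟨μ.polTriple Q, Triple.cellHom (μ.polHom Q), fun z => rfl⟩⟩,
    μ.rho_bijective⟩
  refine continuous_quot_lift _ (continuous_sigma fun Q => ?_)
  have h : Continuous (Quot.mk (Glue μ.diagramP)) := continuous_quot_mk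
  have h' : Continuous fun z : (μ.diagramP.obj (Opposite.op (μ.polTriple Q))).carrier =>
      (⟨μ.polTriple Q, z⟩ : ConeSum μ.diagramP) :=
    continuous_sigmaMk (σ := fun R : μ.PSD => (μ.diagramP.obj (Opposite.op R)).carrier)
      (i := μ.polTriple Q)
  exact h.comp (h'.comp (Triple.continuous_cellHom (μ.polHom Q)))

/-- In one direction, the interior property of the universal specialization yields a polystable
divisor on the same curve, linearly equivalent to the given one. -/
theorem rho_eq_iff_isRho (j : μ.J) (p : μ.P) : μ.rho j = p ↔ μ.IsRho j p := by
  constructor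
  · rintro rfl
    obtain ⟨⟨⟨Γ, Q⟩, hQ⟩, x, hx, rfl⟩ := μ.exists_eq_mkJ j
    obtain ⟨R, f, hR, hst, -, hint⟩ := μ.exists_universal ⟨⟨Γ, Q⟩, hQ⟩
    obtain ⟨y, hy, h⟩ := hint x hx
    let X : TropCurve n := ⟨Γ, Q.totalLength x, Q.totalLength_pos hx⟩
    have hRl : R.totalLength y = X.len := hst.totalLength_eq h
    refine ⟨X, Q, R, hQ, hR, x, y, hx, hy, rfl, hRl, ?_, rfl, ?_⟩
    · exact TropCurve.linEquiv_of_isLinEquiv (X := X) hx hy rfl hRl (hst.isLinEquiv h)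
    · exact μ.rho_mkJ ⟨⟨Γ, R⟩, hR⟩ ⟨⟨Γ, Q⟩, hQ⟩ f hx _ ((Triple.mkQ_eq_iff ⟨Γ, R⟩).2 h).symm
  · rintro ⟨⟨Γ, ℓ, hℓ⟩, Q, R, hQ, hR, x, y, hx, hy, hQl, hRl, heq, rfl, rfl⟩
    obtain ⟨hΓ, hR'⟩ := hR
    obtain ⟨-, hQ'⟩ := hQ
    -- Conversely, the point of the polystable divisor lies in the cell of some quasistable divisor
    -- on the same curve. It is linearly equivalent to the given one, hence equal to it, and the
    -- cell exhibits the value of ρ.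
    obtain ⟨Q', f, x', hx', hQS, -, hst, h⟩ :=
      Triple.exists_cell_of_pos hΓ.1 hR' (Γ.leg 0) hy
    have hmem := (Triple.mkQ_eq_iff ⟨Γ, R⟩).1 h.symm
    have hl : Q'.totalLength x' = ℓ := (hst.totalLength_eq hmem).symm.trans hRl
    have h1 := hst.isLinEquiv hmem
    rw [hl] at h1
    have h2 := (TropCurve.isLinEquiv_of_linEquiv hx hy hQl hRl heq).trans h1.symm
    have h3 := h2.eq hQ' hQS hx hx' hQl hl
    cases h3
    exact μ.rho_mkJ ⟨⟨Γ, R⟩, hΓ, hR'⟩ ⟨⟨Γ, Q⟩, hΓ, hQ'⟩ f hx _ h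

end UnivPolarization

end TropJac

end

theorem mainTheorem2 {g n : ℕ} [NeZero n] {d : ℤ} (μ : UnivPolarization g n d) :
    -- the diagrams of cones define generalized cone complexes
    IsGeneralizedConeComplex μ.diagramJ ∧ IsGeneralizedConeComplex μ.diagramP ∧
    -- the relation `IsRho` is the graph of a map, which is a refinement
    (∃ ρ : μ.J → μ.P, (∀ j p, ρ j = p ↔ μ.IsRho j p) ∧ IsRefinement ρ) ∧
    ∀ (Γ : WGraph n) (hΓ : Γ.IsStable g) (R : PseudoDiv Γ), R.IsPolystable (μ.val Γ hΓ) →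
      -- every specialization to a quasistable triple embeds the cone `τ` in `σ`
      (∀ (B : μ.QD) (f : Triple.mk Γ R ⟶ B.obj),
        Set.InjOn (Triple.cellMap f) (orthant B.obj.graph.E)) ∧
      -- the decomposition of the interior of `σ`, with one cell for each `Q` with `R = pol(Q)`
      ((Triple.sigma ⟨Γ, R⟩).relint =
        ⋃ (Q : PseudoDiv Γ) (_ : Q.IsQuasistable (μ.val Γ hΓ) (Γ.leg 0))
          (_ : PseudoDiv.IsPol (μ.val Γ hΓ) R Q) (f : Triple.mk Γ R ⟶ Triple.mk Γ Q)
          (_ : f.base = Spec.id Γ), Triple.cell f) ∧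
      (∀ Q : PseudoDiv Γ, Q.IsQuasistable (μ.val Γ hΓ) (Γ.leg 0) →
        PseudoDiv.IsPol (μ.val Γ hΓ) R Q → ∀ f f' : Triple.mk Γ R ⟶ Triple.mk Γ Q,
          f.base = Spec.id Γ → f'.base = Spec.id Γ → Triple.cell f = Triple.cell f') ∧
      (∀ Q Q' : PseudoDiv Γ, Q.IsQuasistable (μ.val Γ hΓ) (Γ.leg 0) →
        Q'.IsQuasistable (μ.val Γ hΓ) (Γ.leg 0) → PseudoDiv.IsPol (μ.val Γ hΓ) R Q →
        PseudoDiv.IsPol (μ.val Γ hΓ) R Q' → Q ≠ Q' →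
        ∀ (f : Triple.mk Γ R ⟶ Triple.mk Γ Q) (f' : Triple.mk Γ R ⟶ Triple.mk Γ Q'),
          f.base = Spec.id Γ → f'.base = Spec.id Γ →
          Disjoint (Triple.cell f) (Triple.cell f')) ∧
      -- the decomposition of `σ`, with one cell for each isomorphism class of specializations
      ((Triple.sigma ⟨Γ, R⟩).carrier =
        ⋃ (B : μ.QD) (f : Triple.mk Γ R ⟶ B.obj), Triple.cell f) ∧
      (∀ (B B' : μ.QD) (f : Triple.mk Γ R ⟶ B.obj) (f' : Triple.mk Γ R ⟶ B'.obj),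
        (∃ i : B.obj ≅ B'.obj, f ≫ i.hom = f') ∨
          Disjoint (Triple.cell f) (Triple.cell f')) := 
  ⟨μ.isGeneralizedConeComplex_diagramJ, μ.isGeneralizedConeComplex_diagramP,
    ⟨μ.rho, μ.rho_eq_iff_isRho, μ.rho_isRefinement⟩, μ.cell_decomposition⟩
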